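/- \textbf{Fermions.} Let $\psi,\psi^\dag$ and $\psi^{(a)}_i,\psi^{\dag(a)}_i$ ($a=1,2$, $i\in\mathbb Z$) be fermions with $[\psi,\psi^\dag]_+=1$, $[\psi^{(a)}_i,\psi^{\dag(b)}_j]_+=\delta_{ab}\delta_{ij}$, all other anticommutators being $0$, acting on the Fock space with vacuum $|0\rangle$, $\langle 0|0\rangle=1$, where $\psi^\dag|0\rangle=0=\langle0|\psi$ and, for $i<0$, $\psi^{(a)}_i|0\rangle=\psi^{\dag(a)}_{-1-i}|0\rangle=0=\langle0|\psi^{\dag(a)}_i=\langle0|\psi^{(a)}_{-1-i}$. Put $$\psi_j=\tfrac{1}{\sqrt2}\bigl(\psi^{(1)}_j+\psi^{\dag(2)}_{-1-j}\bigr),\quad \psi^\dag_j=\tfrac{1}{\sqrt2}\bigl(\psi^{\dag(1)}_j+\psi^{(2)}_{-1-j}\bigr),\quad \varphi=\tfrac{1}{\sqrt2}(\psi+\psi^\dag),$$ $\psi(z)=\sum_{i\in\mathbb Z}\psi_iz^i$, $\psi^{(1)}(z)=\sum_{i\in\mathbb Z}\psi^{(1)}_iz^i$, $\psi^{\dag(2)}(z)=\sum_{i\in\mathbb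 Z}\psi^{\dag(2)}_iz^{-i-1}$ and, with $:\!XY\!:\;=XY-\langle0|XY|0\rangle$, $\beta_k=\sum_l:\!\psi_l\psi^\dag_{l+k}\!:$, $\alpha^{(a)}_k=\sum_i:\!\psi^{(a)}_i\psi^{\dag(a)}_{i+k}\!:$. Let $\Psi_n=\psi_{n-1}\cdots\psi_0$ and $\Psi^\dag_n=\psi_0^\dag\cdots\psi_{n-1}^\dag$ for $n\ge0$, and $\Psi_n=\psi^\dag_n\cdots\psi^\dag_{-1}$ and $\Psi^\dag_n=\psi_{-1}\cdots\psi_n$ for $n<0$; define $\Psi^{(a)}_n,\Psi^{\dag(a)}_n$ in the same way from $\psi^{(a)}_i,\psi^{\dag(a)}_i$. Let $|n\rangle=\Psi_n|0\rangle$, $\langle n|=\langle0|\Psi_n^\dag$ for even $n$; $|n\rangle=\sqrt2\,\Psi_n\varphi|0\rangle$, $\langle n|=\sqrt2\,\langle0|\varphi\Psi^\dag_n$ for odd $n$; and $|n,m\rangle=\Psi^{(2)}_m\Psi^{(1)}_n|0\rangle$, $\langle n,m|=\langle0|\Psi^{\dag(1)}_n\Psi^{\dag(2)}_m$. \textbf{Tau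 functions.} Let $t=(t_1,t_2,\dots)$ and $\bar t=(\bar t_1,\bar t_2,\dots)$ be formal variables, $n,m\in\mathbb Z$. Let $d\omega$ be a complex Borel measure on $\mathbb C\times\mathbb C$ with $d\omega(z_1,z_2)=-d\omega(z_2,z_1)$ and $d\nu$ a complex Borel measure on $\mathbb C$. Assume that all moments $\int z_1^iz_2^j\,d\omega$, $\int z^i\,d\nu$ with $i,j\in\mathbb Z$ converge absolutely. (Should $0$ carry mass, read $0^{i}=0$ for $i\neq0$ and $0^0=1$.) Define, as power series in $t,\bar t$, $$\tau^B_{n,m}(t,\bar t)=\langle n|\,e^{\sum_{k\ge1}t_k\beta_k}\, e^{\frac12\int\psi(z_1)\psi(z_2)\,d\omega(z_1,z_2)+\sqrt2\int\psi(z)\,d\nu(z)\,\varphi}\, e^{\sum_{k\ge1}\bar t_k\beta_{-k}}\,|m\rangle ,$$ and, for a complex measure $d\mu$ on $\mathbb C\times\mathbb C$, $$\tau^{TL}_{n,m}[d\mu](t^{(1)},t^{(2)};\bar t^{(1)},\bar t^{(2)})=(-1)^{\frac{n(n+1)}2+\frac{m(m+1)}2} \langle n,-n|\,e^{\sum_{a,k}t^{(a)}_k\alpha^{(a)}_k}\,e^{\int\psi^{(1)}(z_1)\psi^{\dag(2)}(z_2)\,d\mu(z_1,z_2)}\,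 e^{\sum_{a,k}\bar t^{(a)}_k\alpha^{(a)}_{-k}}\,|m,-m\rangle .$$ \textbf{Proposition.} When the exponentials are expanded, every coefficient of $\tau^B_{n,m}(t,\bar t)$ and of $\tau^{TL}_{n,m}[d\omega\pm d\nu\otimes d\nu](t,-t;\bar t,-\bar t)$ is a finite sum, and $$\bigl(\tau^B_{n,m}(t,\bar t)\bigr)^2=\tau^{TL}_{n,m}[d\omega+d\nu\otimes d\nu](t,-t;\bar t,-\bar t) =(-1)^{n-m}\,\tau^{TL}_{n,m}[d\omega-d\nu\otimes d\nu](t,-t;\bar t,-\bar t).$$ The same holds at $\bar t=0$ if only the moments with exponents $i,j\ge m$ are assumed to converge absolutely. -/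

import Mathlib

open MeasureTheory

noncomputable section

namespace PfaffToda

/-! ### Fermions and the Fock space

There is one fermion `ψ, ψ†` (the mode `none`) and there are two infinite families
`ψ⁽ᵃ⁾ᵢ, ψ†⁽ᵃ⁾ᵢ`, `i ∈ ℤ` (the modes `some (a, i)`, where `a = 0` and `a = 1` stand for the
components `1` and `2`).  The right Fock space, generated from the vacuum `|0⟩` by the
creation operators, is the exterior algebra on the modes, with `|0⟩ = 1`. -/

/-- The fermionic modes. -/
abbrev Mode : Type := Option (Fin 2 × ℤ)

/-- The right Fock space. -/
abbrev Fock : Type := ExteriorAlgebra ℂ (Mode →₀ ℂ)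

/-- Linear operators on the Fock space. -/
abbrev Op : Type := Module.End ℂ Fock

/-- Exterior multiplication by the basis vector of the mode `x`. -/
def create (x : Mode) : Op :=
  LinearMap.mulLeft ℂ (ExteriorAlgebra.ι ℂ (Finsupp.single x (1 : ℂ)))

/-- Contraction with the dual basis vector of the mode `x`; an antiderivation that kills the
vacuum and satisfies `[annihilate x, create y]₊ = δ_{xy}`. -/
def annihilate (x : Mode) : Op :=
  CliffordAlgebra.contractLeft (Q := (0 : QuadraticForm ℂ (Mode →₀ ℂ)))
    (Finsupp.lapply x : (Mode →₀ ℂ) →ₗ[ℂ] ℂ)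

/-- The vacuum expectation value `⟨0| X |0⟩`: the component of `X |0⟩` along `|0⟩`. -/
def vev (X : Op) : ℂ := ExteriorAlgebra.algebraMapInv (X (1 : Fock))

/-- `ψ`, with `⟨0|ψ = 0`. -/
def psiZero : Op := create none

/-- `ψ†`, with `ψ†|0⟩ = 0`. -/
def psiZeroDag : Op := annihilate none

/-- `ψ⁽ᵃ⁾ᵢ`: it kills `|0⟩` for `i < 0`, and `⟨0|` for `i ≥ 0`. -/
def psi (a : Fin 2) (i : ℤ) : Op :=
  if 0 ≤ i then create (some (a, i)) else annihilate (some (a, i))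

/-- `ψ†⁽ᵃ⁾ᵢ`: it kills `|0⟩` for `i ≥ 0`, and `⟨0|` for `i < 0`. -/
def psiDag (a : Fin 2) (i : ℤ) : Op :=
  if 0 ≤ i then annihilate (some (a, i)) else create (some (a, i))

/-- `√2` as a complex number. -/
def sqrtTwo : ℂ := ((Real.sqrt 2 : ℝ) : ℂ)

/-- The fermion `ψ_j = (ψ⁽¹⁾_j + ψ†⁽²⁾_{-1-j}) / √2` of type B. -/
def psiB (j : ℤ) : Op := sqrtTwo⁻¹ • (psi 0 j + psiDag 1 (-1 - j))

/-- The fermion `ψ†_j = (ψ†⁽¹⁾_j + ψ⁽²⁾_{-1-j}) / √2` of type B. -/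
def psiBDag (j : ℤ) : Op := sqrtTwo⁻¹ • (psiDag 0 j + psi 1 (-1 - j))

/-- The neutral fermion `φ = (ψ + ψ†) / √2`, with `φ² = 1/2`. -/
def phi : Op := sqrtTwo⁻¹ • (psiZero + psiZeroDag)

/-- The normally ordered product `:XY: = XY - ⟨0|XY|0⟩`. -/
def normalOrder (X Y : Op) : Op := X * Y - vev (X * Y) • (1 : Op)

/-! ### Charged vacua -/

/-- `Ψ_n = f_{n-1} ⋯ f_0` for `n ≥ 0` and `Ψ_n = f†_n ⋯ f†_{-1}` for `n < 0`. -/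
def chargeKet (f fd : ℤ → Op) : ℤ → Op
  | Int.ofNat n => ((List.range n).reverse.map fun k : ℕ => f k).prod
  | Int.negSucc n => ((List.range (n + 1)).reverse.map fun k : ℕ => fd (-1 - k)).prod

/-- `Ψ†_n = f†_0 ⋯ f†_{n-1}` for `n ≥ 0` and `Ψ†_n = f_{-1} ⋯ f_n` for `n < 0`. -/
def chargeBra (f fd : ℤ → Op) : ℤ → Op
  | Int.ofNat n => ((List.range n).map fun k : ℕ => fd k).prod
  | Int.negSucc n => ((List.range (n + 1)).map fun k : ℕ => f (-1 - k)).prod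

/-- The operator that produces `|m₁, m₂⟩ = Ψ⁽²⁾_{m₂} Ψ⁽¹⁾_{m₁} |0⟩` from `|0⟩`. -/
def ketTL (m₁ m₂ : ℤ) : Op :=
  chargeKet (psi 1) (psiDag 1) m₂ * chargeKet (psi 0) (psiDag 0) m₁

/-- The operator that produces `⟨n₁, n₂| = ⟨0| Ψ†⁽¹⁾_{n₁} Ψ†⁽²⁾_{n₂}` from `⟨0|`. -/
def braTL (n₁ n₂ : ℤ) : Op :=
  chargeBra (psi 0) (psiDag 0) n₁ * chargeBra (psi 1) (psiDag 1) n₂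

/-- The operator that produces the vacuum `|m⟩` of type B from `|0⟩`: it is `Ψ_m` for even `m`
and `√2 Ψ_m φ` for odd `m`. -/
def ketB (m : ℤ) : Op :=
  if Even m then chargeKet psiB psiBDag m else sqrtTwo • (chargeKet psiB psiBDag m * phi)

/-- The operator that produces the vacuum `⟨n|` of type B from `⟨0|`: it is `Ψ†_n` for even `n`
and `√2 φ Ψ†_n` for odd `n`. -/
def braB (n : ℤ) : Op :=
  if Even n then chargeBra psiB psiBDag n else sqrtTwo • (phi * chargeBra psiB psiBDag n)

/-! ### Formal power series in the higher times, and exponentials of formal operator sums -/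

/-- Formal power series over `ℂ` in `t = (t₁, t₂, …)` and `t̄ = (t̄₁, t̄₂, …)`. -/
abbrev TimeSeries : Type := MvPowerSeries (ℕ+ ⊕ ℕ+) ℂ

/-- The times `t_k`. -/
def time (k : ℕ+) : TimeSeries := MvPowerSeries.X (Sum.inl k)

/-- The times `t̄_k`. -/
def timeBar (k : ℕ+) : TimeSeries := MvPowerSeries.X (Sum.inr k)

/-- Consider formal sums `E = ∑_x c_x X_x`, `H` and `E'` of operators `X_x` with coefficients
`c_x` in the power series in the times, each given as the family of the pairs `(c_x, X_x)`.
Expanding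
`e^E = ∑_r (1/r!) ∑_{x₁,…,x_r} c_{x₁} ⋯ c_{x_r} X_{x₁} ⋯ X_{x_r}`,
and likewise `e^H` and `e^{E'}`, turns `⟨0| L e^E e^H e^{E'} R |0⟩` into a sum over triples of
words.  This is the contribution of the triple `w` to the coefficient of the monomial `d`. -/
def expTerm {ι κ ι' : Type} (L : Op) (E : ι → TimeSeries × Op) (H : κ → TimeSeries × Op)
    (E' : ι' → TimeSeries × Op) (R : Op) (d : (ℕ+ ⊕ ℕ+) →₀ ℕ)
    (w : List ι × List κ × List ι') : ℂ :=
  let P : TimeSeries × Op := (w.1.map E).prod * (w.2.1.map H).prod * (w.2.2.map E').prod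
  ((w.1.length.factorial : ℂ) * w.2.1.length.factorial * w.2.2.length.factorial)⁻¹ *
    (MvPowerSeries.coeff d P.1 * vev (L * P.2 * R))

/-- The expectation value `⟨0| L e^E e^H e^{E'} R |0⟩` as a power series in the times. -/
def expVev {ι κ ι' : Type} (L : Op) (E : ι → TimeSeries × Op) (H : κ → TimeSeries × Op)
    (E' : ι' → TimeSeries × Op) (R : Op) : TimeSeries :=
  fun d => ∑ᶠ w, expTerm L E H E' R d w

/-- Every coefficient of `expVev` is a finite sum. -/
def ExpVevFinite {ι κ ι' : Type} (L : Op) (E : ι → TimeSeries × Op) (H : κ → TimeSeries × Op)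
    (E' : ι' → TimeSeries × Op) (R : Op) : Prop :=
  ∀ d, (Function.support (expTerm L E H E' R d)).Finite

/-! ### Measures and their moments -/

/-- The moment `∫ z^i dν(z)`. -/
def moment (ν : ComplexMeasure ℂ) (i : ℤ) : ℂ :=
  ν.integral (fun z : ℂ => z ^ i) (ContinuousLinearMap.mul ℝ ℂ)

/-- The moment `∫ z₁^i z₂^j dμ(z₁, z₂)`. -/
def biMoment (μ : ComplexMeasure (ℂ × ℂ)) (i j : ℤ) : ℂ :=
  μ.integral (fun z : ℂ × ℂ => z.1 ^ i * z.2 ^ j) (ContinuousLinearMap.mul ℝ ℂ)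

/-- The moments of `dω` and `dν` with exponents in `I` converge absolutely. -/
def HasMoments (I : Set ℤ) (ω : ComplexMeasure (ℂ × ℂ)) (ν : ComplexMeasure ℂ) : Prop :=
  (∀ i ∈ I, ∀ j ∈ I, ω.Integrable (fun z : ℂ × ℂ => z.1 ^ i * z.2 ^ j)) ∧
    ∀ i ∈ I, ν.Integrable (fun z : ℂ => z ^ i)

/-- The product bi-measure `dν(z₁) dν(z₂)`. -/
def square (ν : ComplexMeasure ℂ) : ComplexMeasure (ℂ × ℂ) :=
  ν.prod ν (ContinuousLinearMap.mul ℝ ℂ)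

/-! ### The tau functions -/

/-- `∑_{k ≥ 1} s_k β_{ε k}` with `β_k = ∑_l :ψ_l ψ†_{l+k}:`, for a sign `ε`. -/
def flowB (ε : ℤ) (s : ℕ+ → TimeSeries) (x : ℕ+ × ℤ) : TimeSeries × Op :=
  (s x.1, normalOrder (psiB x.2) (psiBDag (x.2 + ε * (x.1 : ℕ))))

/-- `½ ∫ ψ(z₁)ψ(z₂) dω(z₁,z₂) + √2 ∫ ψ(z) dν(z) φ`, where `ψ(z) = ∑ᵢ ψᵢ zⁱ`. -/
def interactionB (ω : ComplexMeasure (ℂ × ℂ)) (ν : ComplexMeasure ℂ) :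
    (ℤ × ℤ) ⊕ ℤ → TimeSeries × Op
  | Sum.inl x => (MvPowerSeries.C (1 / 2 * biMoment ω x.1 x.2), psiB x.1 * psiB x.2)
  | Sum.inr i => (MvPowerSeries.C (sqrtTwo * moment ν i), psiB i * phi)

/-- The semi-infinite tau function of the Pfaff lattice of type B,
`τᴮ_{n,m}(t, t̄) = ⟨n| e^{∑ tₖβₖ} e^{½∫ψ(z₁)ψ(z₂)dω(z₁,z₂) + √2∫ψ(z)dν(z)φ} e^{∑ t̄ₖβ₋ₖ} |m⟩`. -/
def tauB (n m : ℤ) (ω : ComplexMeasure (ℂ × ℂ)) (ν : ComplexMeasure ℂ)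
    (t tbar : ℕ+ → TimeSeries) : TimeSeries :=
  expVev (braB n) (flowB 1 t) (interactionB ω ν) (flowB (-1) tbar) (ketB m)

/-- Every coefficient of `tauB` is a finite sum. -/
def TauBFinite (n m : ℤ) (ω : ComplexMeasure (ℂ × ℂ)) (ν : ComplexMeasure ℂ)
    (t tbar : ℕ+ → TimeSeries) : Prop :=
  ExpVevFinite (braB n) (flowB 1 t) (interactionB ω ν) (flowB (-1) tbar) (ketB m)

/-- `∑_{a = 1,2} ∑_{k ≥ 1} s⁽ᵃ⁾_k α⁽ᵃ⁾_{ε k}` with `α⁽ᵃ⁾_k = ∑_i :ψ⁽ᵃ⁾_i ψ†⁽ᵃ⁾_{i+k}:`,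
for a sign `ε`. -/
def flowTL (ε : ℤ) (s : Fin 2 → ℕ+ → TimeSeries) (x : Fin 2 × ℕ+ × ℤ) : TimeSeries × Op :=
  (s x.1 x.2.1, normalOrder (psi x.1 x.2.2) (psiDag x.1 (x.2.2 + ε * (x.2.1 : ℕ))))

/-- `∫ ψ⁽¹⁾(z₁) ψ†⁽²⁾(z₂) dμ(z₁,z₂)`, where `ψ⁽¹⁾(z) = ∑ᵢ ψ⁽¹⁾ᵢ zⁱ` and
`ψ†⁽²⁾(z) = ∑ⱼ ψ†⁽²⁾ⱼ z^{-j-1}`. -/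
def interactionTL (μ : ComplexMeasure (ℂ × ℂ)) (x : ℤ × ℤ) : TimeSeries × Op :=
  (MvPowerSeries.C (biMoment μ x.1 (-x.2 - 1)), psi 0 x.1 * psiDag 1 x.2)

/-- The semi-infinite Toda lattice tau function `τᵀᴸ_{n,m}(t⁽¹⁾, t⁽²⁾; t̄⁽¹⁾, t̄⁽²⁾)`, that is,
`(-1)^{n(n+1)/2 + m(m+1)/2}` times
`⟨n,-n| e^{∑ₐₖ t⁽ᵃ⁾ₖα⁽ᵃ⁾ₖ} e^{∫ψ⁽¹⁾(z₁)ψ†⁽²⁾(z₂)dμ(z₁,z₂)} e^{∑ₐₖ t̄⁽ᵃ⁾ₖα⁽ᵃ⁾₋ₖ} |m,-m⟩`. -/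
def tauTL (n m : ℤ) (μ : ComplexMeasure (ℂ × ℂ)) (t₁ t₂ tbar₁ tbar₂ : ℕ+ → TimeSeries) :
    TimeSeries :=
  ((-1 : ℂ) ^ (n * (n + 1) / 2 + m * (m + 1) / 2)) •
    expVev (braTL n (-n)) (flowTL 1 ![t₁, t₂]) (interactionTL μ) (flowTL (-1) ![tbar₁, tbar₂])
      (ketTL m (-m))

/-- Every coefficient of `tauTL` is a finite sum. -/
def TauTLFinite (n m : ℤ) (μ : ComplexMeasure (ℂ × ℂ)) (t₁ t₂ tbar₁ tbar₂ : ℕ+ → TimeSeries) :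
    Prop :=
  ExpVevFinite (braTL n (-n)) (flowTL 1 ![t₁, t₂]) (interactionTL μ)
    (flowTL (-1) ![tbar₁, tbar₂]) (ketTL m (-m))

end PfaffToda

end

open MeasureTheory Filter

open scoped TensorProduct

set_option linter.unusedSectionVars false

noncomputable section

namespace PfaffToda

/-! ### Fubini's theorem for products of complex measures. -/

section ComplexMeasures

variable {X Y : Type*} [MeasurableSpace X] [MeasurableSpace Y]

/-! Each ψ_j has a twin ψ̂_j = i(ψ⁽¹⁾_j - ψ†⁽²⁾_{-1-j})/√2. The passage from ψ⁽¹⁾_j, ψ†⁽²⁾_{-1-j} to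
ψ_j, ψ̂_j is unitary and mixes only operators with the same j, so the ψ's and the ψ̂'s are two
mutually anticommuting copies of charged fermions over the same vacuum (`isFermi_fR`).

In these fermions the Toda side splits. The flow at (t,-t) is the type B flow plus its twin
(`fT_mul_fdT_add`). The charged vacua are products of a type B vacuum word and its twin, up to a
power of -i (`ketTL_eq`, `braTL_eq`). Put H = ½∫ψψ dω and α = ∫ψ dν; as dω is antisymmetric and
dν⊗dν symmetric, the interaction for dω ± dν⊗dν is H + Ĥ ± iαα̂ (`sum_fT_mul_fT`). Since α² = 0, its
last term exponentiates to 1 ± iαα̂, and on the type B side √2αφ exponentiates to 1 + √2αφ.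

Vacuum expectation values are determined by the anticommutators and the vacuum conditions (Wick's
theorem, `IsWick.eq_zero`), hence ⟨uŵ⟩ = ⟨u⟩⟨w⟩ (`vevQ_evQ_mul_evQ`). The Toda value thus becomes a
combination of two squares, of a word without α and of a word with one α, and parity kills one of
them: the word with α survives exactly when n - m is odd. The type B value is, up to sign, the same
surviving word, φ being absorbed by φ² = 1/2. The surviving Toda term is linear in ±i exactly for
odd n - m, which gives the factor (-1)^{n-m} (`vevB_sq`).

What remains is to make sense of the exponentials. A monomial in the times bounds the flow words by
its weight; these bounds confine the modes of the interaction from both sides, and no interaction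
letter can be repeated (`expVevFinite_of_isFermi`). So a coefficient can be computed with finitely
many letters and truncated exponentials over a quotient of the power series ring in which every time
is nilpotent (`eventually_trunc_expVev`). At t̄ = 0 the modes below m kill |m⟩ through the
interaction, so only moments with exponents at least m matter (`expVev_congr_of_pos`). -/

instance isFiniteMeasure_variation (ν : ComplexMeasure X) : IsFiniteMeasure ν.variation := by
  -- The real and imaginary parts have finite total variation and dominate ν. Finiteness makes
  -- constants on measurable sets integrable, as the density argument below requires.
  refine isFiniteMeasure_of_le
    ((ComplexMeasure.re ν).totalVariation + (ComplexMeasure.im ν).totalVariation)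
    (VectorMeasure.variation_le_of_forall_enorm_le fun s hs => ?_)
  have h := ComplexMeasure.toComplexMeasure_to_signedMeasure ν
  have h1 : ν s = (((ComplexMeasure.re ν) s : ℝ) : ℂ)
      + (((ComplexMeasure.im ν) s : ℝ) : ℂ) * Complex.I := by
    conv_lhs => rw [← h]
    rw [SignedMeasure.toComplexMeasure_apply]
    apply Complex.ext <;> simp
  rw [h1]
  refine (enorm_add_le _ _).trans ?_
  rw [Measure.add_apply]
  refine add_le_add ?_ ?_
  · refine le_trans (le_of_eq ?_) (SignedMeasure.enorm_le_totalVariation _ s)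
    rw [← ofReal_norm, ← ofReal_norm, Complex.norm_real]
  · refine le_trans (le_of_eq ?_) (SignedMeasure.enorm_le_totalVariation _ s)
    rw [← ofReal_norm, ← ofReal_norm, norm_mul, Complex.norm_real, Complex.norm_I, mul_one]

local notation "𝔪" => ContinuousLinearMap.mul ℝ ℂ

variable (ν : ComplexMeasure X) (ρ : ComplexMeasure Y)

/-- The constant is 1 because multiplication in ℂ has operator norm at most 1; integrability on the
product then follows from positive measures. -/
theorem variation_prod_mul_le :
    (ν.prod ρ 𝔪).variation ≤ ν.variation.prod ρ.variation := by
  refine VectorMeasure.variation_prod_le.trans ?_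
  have h : ‖(𝔪 : ℂ →L[ℝ] ℂ →L[ℝ] ℂ)‖ₑ ≤ 1 := by
    rw [← ofReal_norm, ENNReal.ofReal_le_one]
    exact ContinuousLinearMap.opNorm_mul_le ℝ ℂ
  intro s
  rw [Measure.smul_apply]
  calc _ ≤ (1 : ENNReal) • (ν.variation.prod ρ.variation) s := by
        simp only [smul_eq_mul]; gcongr
    _ = _ := one_smul _ _

variable {ν ρ}

theorem integrable_prod_mul {f : X → ℂ} {g : Y → ℂ} (hf : ν.Integrable f) (hg : ρ.Integrable g) :
    (ν.prod ρ 𝔪).Integrable fun z : X × Y => f z.1 * g z.2 :=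
  (hf.mul_prod hg).mono_measure (variation_prod_mul_le ν ρ)

theorem norm_integral_prod_mul_le {f : X → ℂ} {g : Y → ℂ} (hf : ν.Integrable f)
    (hg : ρ.Integrable g) :
    ‖(ν.prod ρ 𝔪).integral (fun z : X × Y => f z.1 * g z.2) 𝔪‖
      ≤ (∫ x, ‖f x‖ ∂ν.variation) * ∫ y, ‖g y‖ ∂ρ.variation := by
  refine VectorMeasure.norm_integral_le_integral_norm.trans ?_
  have h1 : ∫ z : X × Y, ‖f z.1 * g z.2‖ ∂(ν.prod ρ 𝔪).variation
      ≤ ∫ z : X × Y, ‖f z.1 * g z.2‖ ∂(ν.variation.prod ρ.variation) :=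
    integral_mono_measure (variation_prod_mul_le ν ρ)
      (Filter.Eventually.of_forall fun _ => norm_nonneg _) (hf.mul_prod hg).norm
  have h2 : ∫ z : X × Y, ‖f z.1 * g z.2‖ ∂(ν.variation.prod ρ.variation)
      = (∫ x, ‖f x‖ ∂ν.variation) * ∫ y, ‖g y‖ ∂ρ.variation := by
    simp_rw [norm_mul]
    exact integral_prod_mul (fun x => ‖f x‖) (fun y => ‖g y‖)
  rw [← h2]
  refine le_trans ?_ h1
  exact mul_le_of_le_one_left (integral_nonneg fun _ => norm_nonneg _)
    (ContinuousLinearMap.opNorm_mul_le ℝ ℂ)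

theorem norm_integral_mul_le {f : X → ℂ} :
    ‖ν.integral f 𝔪‖ ≤ ∫ x, ‖f x‖ ∂ν.variation := by
  refine VectorMeasure.norm_integral_le_integral_norm.trans ?_
  exact mul_le_of_le_one_left (integral_nonneg fun _ => norm_nonneg _)
    (ContinuousLinearMap.opNorm_mul_le ℝ ℂ)

/-- A bounded additive functional on `L¹` that vanishes on indicators vanishes. -/
theorem eq_zero_of_indicator {Φ : (X → ℂ) → ℂ} {μ : Measure X} {C : ℝ}
    (hbound : ∀ f, Integrable f μ → ‖Φ f‖ ≤ C * ∫ x, ‖f x‖ ∂μ)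
    (hadd : ∀ f g, Integrable f μ → Integrable g μ → Φ (f + g) = Φ f + Φ g)
    (hsub : ∀ f g, Integrable f μ → Integrable g μ → Φ (f - g) = Φ f - Φ g)
    (hind : ∀ (c : ℂ) (s : Set X), MeasurableSet s → μ s < ⊤ → Φ (s.indicator fun _ => c) = 0)
    {f : X → ℂ} (hf : Integrable f μ) : Φ f = 0 := by
  have hsub0 : ∀ f g, Integrable f μ → Integrable g μ → f =ᵐ[μ] g → Φ f = Φ g := by
    intro f g hf hg h
    rw [← sub_eq_zero, ← hsub f g hf hg, ← norm_le_zero_iff]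
    refine (hbound _ (hf.sub hg)).trans (le_of_eq ?_)
    rw [integral_eq_zero_of_ae, mul_zero]
    filter_upwards [h] with x hx
    simp [hx]
  refine Integrable.induction (fun f => Φ f = 0) (fun c s hs hs' => hind c s hs hs') ?_ ?_ ?_ hf
  · intro f g _ hf hg h1 h2
    change Φ (f + g) = 0
    rw [hadd f g hf hg, h1, h2, add_zero]
  -- The bound makes Φ Lipschitz on `L¹`, so its zero set is closed.
  · have hlip : LipschitzWith C.toNNReal (fun f : X →₁[μ] ℂ => Φ f) := by
      refine LipschitzWith.of_dist_le_mul fun f g => ?_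
      have hf := L1.integrable_coeFn f
      have hg := L1.integrable_coeFn g
      rw [dist_eq_norm, ← hsub _ _ hf hg, dist_eq_norm, L1.norm_eq_integral_norm]
      refine (hbound _ (hf.sub hg)).trans ?_
      have : ∫ x, ‖((f : X → ℂ) - g) x‖ ∂μ = ∫ x, ‖(f - g : X →₁[μ] ℂ) x‖ ∂μ := by
        refine integral_congr_ae ?_
        filter_upwards [Lp.coeFn_sub f g] with x hx
        rw [hx]
      rw [this]
      gcongr
      exact Real.le_coe_toNNReal C
    exact isClosed_eq hlip.continuous continuous_const
  · intro f g hfg hf h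
    rw [← hsub0 f g hf (hf.congr hfg) hfg]
    exact h

theorem integral_prod_mul_indicator (c d : ℂ) {s : Set X} {t : Set Y} (hs : MeasurableSet s)
    (ht : MeasurableSet t) :
    (ν.prod ρ 𝔪).integral
        (fun z : X × Y => s.indicator (fun _ => c) z.1 * t.indicator (fun _ => d) z.2) 𝔪
      = ν.integral (s.indicator fun _ => c) 𝔪 * ρ.integral (t.indicator fun _ => d) 𝔪 := by
  have h : (fun z : X × Y => s.indicator (fun _ => c) z.1 * t.indicator (fun _ => d) z.2)
      = (s ×ˢ t).indicator fun _ => c * d := by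
    funext z
    by_cases h1 : z.1 ∈ s <;> by_cases h2 : z.2 ∈ t <;> simp [h1, h2]
  rw [h]
  erw [VectorMeasure.integral_indicator_const _ (hs.prod ht),
    VectorMeasure.integral_indicator_const _ hs, VectorMeasure.integral_indicator_const _ ht]
  rw [VectorMeasure.prod_apply]
  simp only [ContinuousLinearMap.mul_apply']
  ring

/-- Fubini's theorem for the product of a function of `x` and a function of `y`. -/
theorem integral_prod_mul_eq {f : X → ℂ} {g : Y → ℂ} (hf : ν.Integrable f)
    (hg : ρ.Integrable g) :
    (ν.prod ρ 𝔪).integral (fun z : X × Y => f z.1 * g z.2) 𝔪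
      = ν.integral f 𝔪 * ρ.integral g 𝔪 := by
  -- Density is used one variable at a time: for fixed g the identity passes from indicators in x to
  -- all integrable f; afterwards the same is done in y against an indicator in x.
  have key : ∀ g : Y → ℂ, ρ.Integrable g → (∀ (c : ℂ) (s : Set X), MeasurableSet s →
      (ν.prod ρ 𝔪).integral (fun z : X × Y => s.indicator (fun _ => c) z.1 * g z.2) 𝔪
        = ν.integral (s.indicator fun _ => c) 𝔪 * ρ.integral g 𝔪) →
      (ν.prod ρ 𝔪).integral (fun z : X × Y => f z.1 * g z.2) 𝔪
        = ν.integral f 𝔪 * ρ.integral g 𝔪 := by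
    intro g hg hind
    rw [← sub_eq_zero]
    refine eq_zero_of_indicator (μ := ν.variation)
      (Φ := fun f => (ν.prod ρ 𝔪).integral (fun z : X × Y => f z.1 * g z.2) 𝔪
        - ν.integral f 𝔪 * ρ.integral g 𝔪)
      (C := (∫ y, ‖g y‖ ∂ρ.variation) + ‖ρ.integral g 𝔪‖) ?_ ?_ ?_ ?_ hf
    · intro f hf
      refine (norm_sub_le _ _).trans ?_
      rw [norm_mul, add_mul]
      refine add_le_add ?_ ?_
      · rw [mul_comm]; exact norm_integral_prod_mul_le hf hg
      · rw [mul_comm]; gcongr; exact norm_integral_mul_le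
    · intro f f' hf hf'
      have h := VectorMeasure.integral_add (B := 𝔪) (integrable_prod_mul hf hg)
        (integrable_prod_mul hf' hg)
      have h' : (fun z : X × Y => (f + f') z.1 * g z.2)
          = (fun z : X × Y => f z.1 * g z.2) + fun z : X × Y => f' z.1 * g z.2 := by
        funext z; simp [add_mul]
      simp only [h', h, VectorMeasure.integral_add hf hf']
      ring
    · intro f f' hf hf'
      have h := VectorMeasure.integral_sub (B := 𝔪) (integrable_prod_mul hf hg)
        (integrable_prod_mul hf' hg)
      have h' : (fun z : X × Y => (f - f') z.1 * g z.2)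
          = (fun z : X × Y => f z.1 * g z.2) - fun z : X × Y => f' z.1 * g z.2 := by
        funext z; simp [sub_mul]
      simp only [h', h, VectorMeasure.integral_sub hf hf']
      ring
    · intro c s hs _
      simp only [hind c s hs, sub_self]
  refine key g hg fun c s hs => ?_
  have hc : ν.Integrable (s.indicator fun _ => c) := (integrable_const c).indicator hs
  rw [← sub_eq_zero]
  refine eq_zero_of_indicator (μ := ρ.variation)
    (Φ := fun g => (ν.prod ρ 𝔪).integral
        (fun z : X × Y => s.indicator (fun _ => c) z.1 * g z.2) 𝔪
      - ν.integral (s.indicator fun _ => c) 𝔪 * ρ.integral g 𝔪)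
    (C := (∫ x, ‖s.indicator (fun _ => c) x‖ ∂ν.variation)
      + ‖ν.integral (s.indicator fun _ => c) 𝔪‖) ?_ ?_ ?_ ?_ hg
  · intro g hg
    refine (norm_sub_le _ _).trans ?_
    rw [norm_mul, add_mul]
    refine add_le_add (norm_integral_prod_mul_le hc hg) ?_
    gcongr
    exact norm_integral_mul_le
  · intro g g' hg hg'
    have h := VectorMeasure.integral_add (B := 𝔪) (integrable_prod_mul hc hg)
      (integrable_prod_mul hc hg')
    have h' : (fun z : X × Y => s.indicator (fun _ => c) z.1 * (g + g') z.2)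
        = (fun z : X × Y => s.indicator (fun _ => c) z.1 * g z.2)
          + fun z : X × Y => s.indicator (fun _ => c) z.1 * g' z.2 := by
      funext z; simp [mul_add]
    simp only [h', h, VectorMeasure.integral_add hg hg']
    ring
  · intro g g' hg hg'
    have h := VectorMeasure.integral_sub (B := 𝔪) (integrable_prod_mul hc hg)
      (integrable_prod_mul hc hg')
    have h' : (fun z : X × Y => s.indicator (fun _ => c) z.1 * (g - g') z.2)
        = (fun z : X × Y => s.indicator (fun _ => c) z.1 * g z.2)
          - fun z : X × Y => s.indicator (fun _ => c) z.1 * g' z.2 := by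
      funext z; simp [mul_sub]
    simp only [h', h, VectorMeasure.integral_sub hg hg']
    ring
  · intro d t ht _
    simp only [integral_prod_mul_indicator c d hs ht, sub_self]

end ComplexMeasures

/-! ### Moments of antisymmetric measures and of their perturbations by dν⊗dν. -/

/-- Change of variables along a measurable equivalence requires no integrability, so antisymmetry
holds for all exponents, including those whose moments are not assumed to converge. -/
theorem biMoment_swap {ω : ComplexMeasure (ℂ × ℂ)} (hω : ω.map Prod.swap = -ω) (i j : ℤ) :
    biMoment ω j i = -biMoment ω i j := by
  have h := VectorMeasure.integral_map_equiv (μ := ω) (B := ContinuousLinearMap.mul ℝ ℂ)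
    (MeasurableEquiv.prodComm (α := ℂ) (β := ℂ)) (fun z : ℂ × ℂ => z.1 ^ i * z.2 ^ j)
  have h' : ω.map (MeasurableEquiv.prodComm (α := ℂ) (β := ℂ)) = -ω := hω
  rw [h', VectorMeasure.integral_neg_vectorMeasure] at h
  unfold biMoment
  rw [h]
  congr 1
  funext z
  simp [MeasurableEquiv.prodComm, mul_comm]

theorem biMoment_add_square {I : Set ℤ} {ω : ComplexMeasure (ℂ × ℂ)} {ν : ComplexMeasure ℂ}
    (h : HasMoments I ω ν) {i j : ℤ} (hi : i ∈ I) (hj : j ∈ I) :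
    biMoment (ω + square ν) i j = biMoment ω i j + moment ν i * moment ν j := by
  have h1 := integral_prod_mul_eq (f := fun z : ℂ => z ^ i) (g := fun z : ℂ => z ^ j)
    (h.2 i hi) (h.2 j hj)
  have h2 := integrable_prod_mul (f := fun z : ℂ => z ^ i) (g := fun z : ℂ => z ^ j)
    (h.2 i hi) (h.2 j hj)
  unfold biMoment moment square
  rw [← h1]
  exact VectorMeasure.integral_add_vectorMeasure (h.1 i hi j hj) h2

theorem biMoment_sub_square {I : Set ℤ} {ω : ComplexMeasure (ℂ × ℂ)} {ν : ComplexMeasure ℂ}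
    (h : HasMoments I ω ν) {i j : ℤ} (hi : i ∈ I) (hj : j ∈ I) :
    biMoment (ω - square ν) i j = biMoment ω i j - moment ν i * moment ν j := by
  have h1 := integral_prod_mul_eq (f := fun z : ℂ => z ^ i) (g := fun z : ℂ => z ^ j)
    (h.2 i hi) (h.2 j hj)
  have h2 := integrable_prod_mul (f := fun z : ℂ => z ^ i) (g := fun z : ℂ => z ^ j)
    (h.2 i hi) (h.2 j hj)
  unfold biMoment moment square
  rw [← h1]
  exact VectorMeasure.integral_sub_vectorMeasure (h.1 i hi j hj) h2

/-! ### Anticommutation relations -/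

theorem sqrtTwo_mul_self : sqrtTwo * sqrtTwo = 2 := by
  unfold sqrtTwo
  rw [← Complex.ofReal_mul, Real.mul_self_sqrt (by norm_num)]
  norm_num

theorem inv_sqrtTwo_mul_self : sqrtTwo⁻¹ * sqrtTwo⁻¹ = 1 / 2 := by
  rw [← mul_inv, sqrtTwo_mul_self, one_div]

theorem create_add_create (x y : Mode) : create x * create y + create y * create x = 0 := by
  refine LinearMap.ext fun v => ?_
  simp only [create, LinearMap.add_apply, Module.End.mul_apply, LinearMap.mulLeft_apply,
    LinearMap.zero_apply, ← mul_assoc, ← add_mul, ExteriorAlgebra.ι_add_mul_swap, zero_mul]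

theorem annihilate_add_annihilate (x y : Mode) :
    annihilate x * annihilate y + annihilate y * annihilate x = 0 := by
  refine LinearMap.ext fun v => ?_
  simp only [annihilate, LinearMap.add_apply, Module.End.mul_apply, LinearMap.zero_apply]
  rw [CliffordAlgebra.contractLeft_comm, neg_add_cancel]

theorem create_add_annihilate (x y : Mode) :
    create x * annihilate y + annihilate y * create x = if x = y then 1 else 0 := by
  refine LinearMap.ext fun v => ?_
  simp only [create, annihilate, LinearMap.add_apply, Module.End.mul_apply,
    LinearMap.mulLeft_apply]
  erw [CliffordAlgebra.contractLeft_ι_mul]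
  rw [Finsupp.lapply_apply, Finsupp.single_apply]
  have h : ∀ (a b : Fock), a + (b - a) = b := fun a b => by abel
  erw [h]
  split_ifs <;> simp

theorem annihilate_add_create (x y : Mode) :
    annihilate x * create y + create y * annihilate x = if x = y then 1 else 0 := by
  rw [add_comm, create_add_annihilate]
  simp only [eq_comm]

theorem annihilate_one (x : Mode) : annihilate x (1 : Fock) = 0 :=
  CliffordAlgebra.contractLeft_one _ _

theorem algebraMapInv_create (x : Mode) (v : Fock) :
    ExteriorAlgebra.algebraMapInv (create x v) = 0 := by
  simp only [create, LinearMap.mulLeft_apply, map_mul]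
  simp [ExteriorAlgebra.algebraMapInv]

/-- Two families `f s i`, `f† s i` of fermions that satisfy the canonical anticommutation
relations and the vacuum conditions of charged fermions, and that anticommute with `φ`. -/
structure IsFermi {σ : Type} [DecidableEq σ] (f fd : σ → ℤ → Op) : Prop where
  ff : ∀ s i t j, f s i * f t j + f t j * f s i = 0
  dd : ∀ s i t j, fd s i * fd t j + fd t j * fd s i = 0
  anti : ∀ s i t j, f s i * fd t j + fd t j * f s i = if s = t ∧ i = j then 1 else 0
  f_one : ∀ s i, i < 0 → f s i (1 : Fock) = 0
  d_one : ∀ s i, 0 ≤ i → fd s i (1 : Fock) = 0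
  vac_f : ∀ s i, 0 ≤ i → ∀ v, ExteriorAlgebra.algebraMapInv (f s i v) = 0
  vac_d : ∀ s i, i < 0 → ∀ v, ExteriorAlgebra.algebraMapInv (fd s i v) = 0
  phi_f : ∀ s i, phi * f s i + f s i * phi = 0
  phi_d : ∀ s i, phi * fd s i + fd s i * phi = 0

/-- `ψ⁽¹⁾_j` and `ψ†⁽²⁾_{-1-j}`. -/
def fT (s : Bool) (j : ℤ) : Op := if s then psiDag 1 (-1 - j) else psi 0 j

/-- `ψ†⁽¹⁾_j` and `ψ⁽²⁾_{-1-j}`. -/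
def fdT (s : Bool) (j : ℤ) : Op := if s then psi 1 (-1 - j) else psiDag 0 j

/-- Exchanging ψ⁽²⁾ with ψ†⁽²⁾ and reflecting i to -1-i respects the vacuum conditions, as the
reflection swaps i < 0 and i ≥ 0. -/
theorem isFermi_fT : IsFermi fT fdT := by
  -- In both copies the operator of index j creates, for j ≥ 0, or annihilates, for j < 0, one mode
  -- M s j; these modes are distinct and differ from the mode of φ. All nine conditions reduce to
  -- this.
  obtain ⟨M, hp, hd, hm, hn⟩ : ∃ M : Bool → ℤ → Mode,
      (∀ s j, fT s j = if 0 ≤ j then create (M s j) else annihilate (M s j)) ∧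
      (∀ s j, fdT s j = if 0 ≤ j then annihilate (M s j) else create (M s j)) ∧
      (∀ s t i j, M s i = M t j ↔ s = t ∧ i = j) ∧ ∀ s i, none ≠ M s i := by
    refine ⟨fun s j => some (if s then 1 else 0, if s then -1 - j else j), ?_, ?_, ?_, ?_⟩
    · intro s j
      cases s <;> simp only [fT, psi, psiDag] <;> simp <;> split_ifs <;> first | rfl | omega
    · intro s j
      cases s <;> simp only [fdT, psi, psiDag] <;> simp <;> split_ifs <;> first | rfl | omega
    · intro s t i j
      cases s <;> cases t <;> simp
    · intro s i
      simp
  have hphi : ∀ X : Op, psiZero * X + X * psiZero = 0 → psiZeroDag * X + X * psiZeroDag = 0 →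
      phi * X + X * phi = 0 := by
    intro X h1 h2
    have : phi * X + X * phi = sqrtTwo⁻¹ • ((psiZero * X + X * psiZero)
        + (psiZeroDag * X + X * psiZeroDag)) := by
      simp only [phi, smul_mul_assoc, mul_smul_comm, ← smul_add, add_mul, mul_add]
      congr 1; abel
    rw [this, h1, h2, add_zero, smul_zero]
  refine ⟨?_, ?_, ?_, ?_, ?_, ?_, ?_, ?_, ?_⟩
  · intro s i t j
    rw [hp, hp]
    split_ifs with h1 h2 h2
    · exact create_add_create _ _
    · rw [create_add_annihilate, if_neg]
      rw [hm]; omega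
    · rw [annihilate_add_create, if_neg]
      rw [hm]; omega
    · exact annihilate_add_annihilate _ _
  · intro s i t j
    rw [hd, hd]
    split_ifs with h1 h2 h2
    · exact annihilate_add_annihilate _ _
    · rw [annihilate_add_create, if_neg]
      rw [hm]; omega
    · rw [create_add_annihilate, if_neg]
      rw [hm]; omega
    · exact create_add_create _ _
  · intro s i t j
    rw [hp, hd]
    by_cases h1 : 0 ≤ i <;> by_cases h2 : 0 ≤ j <;> simp only [h1, h2, if_true, if_false]
    · rw [create_add_annihilate]; simp only [hm]
    · rw [create_add_create, if_neg]; omega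
    · rw [annihilate_add_annihilate, if_neg]; omega
    · rw [annihilate_add_create]; simp only [hm]
  · intro s i hi
    rw [hp, if_neg (by omega), annihilate_one]
  · intro s i hi
    rw [hd, if_pos hi, annihilate_one]
  · intro s i hi v
    rw [hp, if_pos hi, algebraMapInv_create]
  · intro s i hi v
    rw [hd, if_neg (by omega), algebraMapInv_create]
  · intro s i
    apply hphi <;> rw [hp] <;> simp only [psiZero, psiZeroDag] <;> split_ifs
    · exact create_add_create _ _
    · rw [create_add_annihilate, if_neg (hn _ _)]
    · rw [annihilate_add_create, if_neg (hn _ _)]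
    · exact annihilate_add_annihilate _ _
  · intro s i
    apply hphi <;> rw [hd] <;> simp only [psiZero, psiZeroDag] <;> split_ifs
    · rw [create_add_annihilate, if_neg (hn _ _)]
    · exact create_add_create _ _
    · exact annihilate_add_annihilate _ _
    · rw [annihilate_add_create, if_neg (hn _ _)]

theorem phi_mul_phi : phi * phi = (1 / 2 : ℂ) • (1 : Op) := by
  have h1 : create none * create none = 0 := by
    have := create_add_create none none
    rwa [← two_smul ℂ, smul_eq_zero_iff_right two_ne_zero] at this
  have h2 : annihilate none * annihilate none = 0 := by
    have := annihilate_add_annihilate none none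
    rwa [← two_smul ℂ, smul_eq_zero_iff_right two_ne_zero] at this
  have h3 := create_add_annihilate none none
  rw [if_pos rfl] at h3
  simp only [phi, psiZero, psiZeroDag, smul_mul_smul_comm, inv_sqrtTwo_mul_self, mul_add, add_mul,
    h1, h2, zero_add, add_zero]
  rw [add_comm, h3]

theorem vev_phi : vev phi = 0 := by
  simp only [vev, phi, psiZero, psiZeroDag, LinearMap.smul_apply, LinearMap.add_apply, map_smul,
    annihilate_one, add_zero, algebraMapInv_create, smul_zero]

/-- Combinations of operators with equal index inherit the vacuum conditions; the mixed
anticommutators survive because, by `huw`, the coefficients for f and f† are dual to each other. -/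
theorem IsFermi.linear {σ τ : Type} [DecidableEq σ] [DecidableEq τ] {f fd : σ → ℤ → Op}
    (h : IsFermi f fd) (s₁ s₂ : σ) (hs : s₁ ≠ s₂) (u u' w w' : τ → ℂ)
    (huw : ∀ s t, u s * w t + u' s * w' t = if s = t then 1 else 0) :
    IsFermi (fun (s : τ) i => u s • f s₁ i + u' s • f s₂ i)
      (fun (s : τ) i => w s • fd s₁ i + w' s • fd s₂ i) := by
  have expand : ∀ (a b c d : ℂ) (A B C D : Op),
      (a • A + b • B) * (c • C + d • D) + (c • C + d • D) * (a • A + b • B)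
        = (a * c) • (A * C + C * A) + (a * d) • (A * D + D * A)
          + (b * c) • (B * C + C * B) + (b * d) • (B * D + D * B) := by
    intro a b c d A B C D
    simp only [add_mul, mul_add, smul_mul_smul_comm, smul_add, mul_comm c, mul_comm d]
    abel
  have expand' : ∀ (c d : ℂ) (A C D : Op),
      A * (c • C + d • D) + (c • C + d • D) * A
        = c • (A * C + C * A) + d • (A * D + D * A) := by
    intro c d A C D
    simp only [add_mul, mul_add, smul_mul_assoc, mul_smul_comm, smul_add]
    abel
  refine ⟨?_, ?_, ?_, ?_, ?_, ?_, ?_, ?_, ?_⟩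
  · intro s i t j; simp only [expand, h.ff, smul_zero, add_zero]
  · intro s i t j; simp only [expand, h.dd, smul_zero, add_zero]
  · intro s i t j
    simp only [expand, h.anti, true_and, hs, hs.symm, false_and, if_false, smul_zero, add_zero]
    by_cases hij : i = j
    · simp only [hij, if_true, ← add_smul, huw, and_true]
      split_ifs <;> simp
    · simp [hij]
  · intro s i hi; simp [h.f_one _ _ hi]
  · intro s i hi; simp [h.d_one _ _ hi]
  · intro s i hi v; simp [h.vac_f _ _ hi]
  · intro s i hi v; simp [h.vac_d _ _ hi]
  · intro s i; simp only [expand', h.phi_f, smul_zero, add_zero]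
  · intro s i; simp only [expand', h.phi_d, smul_zero, add_zero]

/-- The fermions `ψ_j` of type B, and their twins `ψ̂_j = i (ψ⁽¹⁾_j - ψ†⁽²⁾_{-1-j}) / √2`. -/
def fR (s : Bool) (j : ℤ) : Op :=
  (if s then Complex.I * sqrtTwo⁻¹ else sqrtTwo⁻¹) • fT false j
    + (if s then -(Complex.I * sqrtTwo⁻¹) else sqrtTwo⁻¹) • fT true j

/-- The fermions `ψ†_j` of type B, and their twins `ψ̂†_j = -i (ψ†⁽¹⁾_j - ψ⁽²⁾_{-1-j}) / √2`. -/
def fdR (s : Bool) (j : ℤ) : Op :=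
  (if s then -(Complex.I * sqrtTwo⁻¹) else sqrtTwo⁻¹) • fdT false j
    + (if s then Complex.I * sqrtTwo⁻¹ else sqrtTwo⁻¹) • fdT true j

/-- The coefficients form a unitary 2×2 matrix, with the complex conjugate entries on the f† side.
-/
theorem isFermi_fR : IsFermi fR fdR := by
  refine isFermi_fT.linear false true (by simp) _ _ _ _ fun s t => ?_
  have h := inv_sqrtTwo_mul_self
  have hI := Complex.I_mul_I
  cases s <;> cases t <;> simp only [if_true, if_false, Bool.false_eq_true, reduceCtorEq]
  · rw [h]; norm_num
  · ring
  · ring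
  · linear_combination 2 * h - 2 * sqrtTwo⁻¹ * sqrtTwo⁻¹ * hI

theorem psiB_eq (j : ℤ) : psiB j = fR false j := by
  simp [psiB, fR, fT]

theorem psiBDag_eq (j : ℤ) : psiBDag j = fdR false j := by
  simp [psiBDag, fdR, fdT]

theorem isFermi_psiB : IsFermi (fun _ : Unit => psiB) fun _ : Unit => psiBDag := by
  have h := isFermi_fR
  have h1 : psiB = fR false := funext psiB_eq
  have h2 : psiBDag = fdR false := funext psiBDag_eq
  rw [h1, h2]
  exact ⟨fun _ i _ => h.ff _ i _, fun _ i _ => h.dd _ i _,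
    fun _ i _ j => by simp [h.anti], fun _ => h.f_one _, fun _ => h.d_one _, fun _ => h.vac_f _,
    fun _ => h.vac_d _, fun _ => h.phi_f _, fun _ => h.phi_d _⟩

/-- This and the next three lemmas invert the unitary change of fermions. -/
theorem fT_false (j : ℤ) :
    fT false j = sqrtTwo⁻¹ • (fR false j - Complex.I • fR true j) := by
  have h := inv_sqrtTwo_mul_self
  have hI := Complex.I_mul_I
  simp only [fR, smul_sub, smul_add, smul_smul, if_true, if_false, Bool.false_eq_true, h]
  have : sqrtTwo⁻¹ * (Complex.I * (Complex.I * sqrtTwo⁻¹)) = -(1 / 2) := by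
    linear_combination (-1 : ℂ) * h + sqrtTwo⁻¹ * sqrtTwo⁻¹ * hI
  rw [mul_neg, mul_neg, this]
  module

theorem fT_true (j : ℤ) :
    fT true j = sqrtTwo⁻¹ • (fR false j + Complex.I • fR true j) := by
  have h := inv_sqrtTwo_mul_self
  have hI := Complex.I_mul_I
  simp only [fR, smul_add, smul_smul, if_true, if_false, Bool.false_eq_true, h]
  have : sqrtTwo⁻¹ * (Complex.I * (Complex.I * sqrtTwo⁻¹)) = -(1 / 2) := by
    linear_combination (-1 : ℂ) * h + sqrtTwo⁻¹ * sqrtTwo⁻¹ * hI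
  rw [mul_neg, mul_neg, this]
  module

theorem fdT_false (j : ℤ) :
    fdT false j = sqrtTwo⁻¹ • (fdR false j + Complex.I • fdR true j) := by
  have h := inv_sqrtTwo_mul_self
  have hI := Complex.I_mul_I
  simp only [fdR, smul_add, smul_smul, if_true, if_false, Bool.false_eq_true, h]
  have : sqrtTwo⁻¹ * (Complex.I * (Complex.I * sqrtTwo⁻¹)) = -(1 / 2) := by
    linear_combination (-1 : ℂ) * h + sqrtTwo⁻¹ * sqrtTwo⁻¹ * hI
  rw [mul_neg, mul_neg, this]
  module

theorem fdT_true (j : ℤ) :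
    fdT true j = sqrtTwo⁻¹ • (fdR false j - Complex.I • fdR true j) := by
  have h := inv_sqrtTwo_mul_self
  have hI := Complex.I_mul_I
  simp only [fdR, smul_sub, smul_add, smul_smul, if_true, if_false, Bool.false_eq_true, h]
  have : sqrtTwo⁻¹ * (Complex.I * (Complex.I * sqrtTwo⁻¹)) = -(1 / 2) := by
    linear_combination (-1 : ℂ) * h + sqrtTwo⁻¹ * sqrtTwo⁻¹ * hI
  rw [mul_neg, mul_neg, this]
  module

/-! ### Wick's theorem, as a uniqueness statement -/

section Wick

variable {R G : Type*} [CommRing R]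

/-- A functional on the free algebra that respects the anticommutation relations `pair`, kills
the words that end in a letter satisfying `kill`, and those that start with another letter. -/
structure IsWick (kill : G → Prop) (pair : G → G → R) (f : FreeAlgebra R G →ₗ[R] R) : Prop where
  left : ∀ x, ¬ kill x → ∀ w, f (FreeAlgebra.ι R x * w) = 0
  right : ∀ x, kill x → ∀ w, f (w * FreeAlgebra.ι R x) = 0
  pair : ∀ x y u v, f (u * (FreeAlgebra.ι R x * FreeAlgebra.ι R y
    + FreeAlgebra.ι R y * FreeAlgebra.ι R x) * v) = pair x y * f (u * v)

variable {kill : G → Prop} {pair : G → G → R} {f g : FreeAlgebra R G →ₗ[R] R}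

/-- Strong induction on the length of a word. A letter that kills the vacuum can be anticommuted to
the right end, each step costing a word that is two letters shorter. If there is no such letter, the
word is empty or its first letter kills the dual vacuum. -/
theorem IsWick.eq_zero (h : IsWick kill pair f) (h0 : f 1 = 0) : f = 0 := by
  have hw : ∀ n : ℕ, ∀ l : List G, l.length = n → f (l.map (FreeAlgebra.ι R)).prod = 0 := by
    intro n
    induction n using Nat.strong_induction_on with
    | _ n ih =>
    intro l hl
    by_cases hk : ∃ x ∈ l, kill x
    · obtain ⟨x, hx, hkx⟩ := hk
      obtain ⟨u, v, rfl⟩ := List.append_of_mem hx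
      -- Induction on the letters to the right of x, with the letters to its left left free.
      have key : ∀ v u : List G, u.length + v.length + 1 = n →
          f ((u.map (FreeAlgebra.ι R)).prod * FreeAlgebra.ι R x
            * (v.map (FreeAlgebra.ι R)).prod) = 0 := by
        intro v
        induction v with
        | nil =>
          intro u _
          rw [List.map_nil, List.prod_nil, mul_one]
          exact h.right x hkx _
        | cons y v ihv =>
          intro u huv
          have h1 := h.pair x y (u.map (FreeAlgebra.ι R)).prod (v.map (FreeAlgebra.ι R)).prod
          have h2 := ih (u ++ v).length (by simp at huv ⊢; omega) (u ++ v) rfl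
          have h3 := ihv (u ++ [y]) (by simp at huv ⊢; omega)
          rw [List.map_append, List.prod_append] at h2
          rw [List.map_append, List.prod_append] at h3
          simp only [List.map_cons, List.map_nil, List.prod_cons, List.prod_nil, mul_one] at h3 ⊢
          rw [h2, mul_zero, mul_add, add_mul, map_add] at h1
          simp only [mul_assoc] at h1 h3 ⊢
          rw [h3, add_zero] at h1
          exact h1
      have := key v u (by simp at hl; omega)
      simpa [mul_assoc] using this
    · cases l with
      | nil => simpa using h0
      | cons x l =>
        rw [List.map_cons, List.prod_cons]
        exact h.left x (fun hx => hk ⟨x, by simp, hx⟩) _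
  refine LinearMap.ext fun w => ?_
  have hmem : w ∈ Submodule.span R
      (Submonoid.closure (Set.range (FreeAlgebra.ι R : G → _)) : Set (FreeAlgebra R G)) := by
    rw [← Algebra.adjoin_eq_span, FreeAlgebra.adjoin_range_ι]
    trivial
  rw [LinearMap.zero_apply]
  induction hmem using Submodule.span_induction with
  | mem x hx =>
    obtain ⟨l, hl, rfl⟩ := Submonoid.exists_list_of_mem_closure hx
    obtain ⟨l, rfl⟩ : l ∈ Set.range (List.map (FreeAlgebra.ι R : G → _)) := by
      rw [Set.range_list_map]; exact hl
    exact hw _ l rfl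
  | zero => exact map_zero f
  | add x y _ _ hx hy => rw [map_add, hx, hy, add_zero]
  | smul a x _ hx => rw [map_smul, hx, smul_zero]

theorem IsWick.eq_mul (hf : IsWick kill pair f) (hg : IsWick kill pair g) (h1 : g 1 = 1)
    (w : FreeAlgebra R G) : f w = f 1 * g w := by
  have h : IsWick kill pair (f - f 1 • g) := by
    refine ⟨fun x hx w => ?_, fun x hx w => ?_, fun x y u v => ?_⟩
    · simp [hf.left x hx, hg.left x hx]
    · simp [hf.right x hx, hg.right x hx]
    · simp only [LinearMap.sub_apply, LinearMap.smul_apply, hf.pair, hg.pair, smul_eq_mul]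
      ring
  have := LinearMap.congr_fun (h.eq_zero (by simp [h1])) w
  simpa [sub_eq_zero] using this

end Wick

/-! ### Operators with coefficients in a commutative algebra -/

/-- The letters `ψ_i` and `ψ†_i`. -/
abbrev Letter : Type := ℤ ⊕ ℤ

/-- The letters that kill the vacuum. -/
def Letter.kill : Letter → Prop
  | Sum.inl i => i < 0
  | Sum.inr i => 0 ≤ i

/-- The operator of a letter, in the copy `s`. -/
def letterOp (s : Bool) : Letter → Op := Sum.elim (fR s) (fdR s)

/-- The anticommutator of two letters. -/
def letterPair (x y : Letter) : ℂ :=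
  match x, y with
  | Sum.inl i, Sum.inr j => if i = j then 1 else 0
  | Sum.inr i, Sum.inl j => if j = i then 1 else 0
  | _, _ => 0

theorem letterOp_anticomm (s t : Bool) (x y : Letter) :
    letterOp s x * letterOp t y + letterOp t y * letterOp s x
      = (if s = t then letterPair x y else 0) • (1 : Op) := by
  have h := isFermi_fR
  rcases x with i | i <;> rcases y with j | j <;>
    simp only [letterOp, letterPair, Sum.elim_inl, Sum.elim_inr]
  · rw [h.ff]; simp
  · rw [h.anti]; by_cases hs : s = t <;> by_cases hi : i = j <;> simp [hs, hi]
  · rw [add_comm, h.anti]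
    by_cases hs : s = t <;> by_cases hi : j = i <;> simp [hs, hi, eq_comm]
  · rw [h.dd]; simp

theorem letterOp_one (s : Bool) (x : Letter) (hx : x.kill) : letterOp s x (1 : Fock) = 0 := by
  rcases x with i | i
  · exact isFermi_fR.f_one s i hx
  · exact isFermi_fR.d_one s i hx

theorem vac_letterOp (s : Bool) (x : Letter) (hx : ¬ x.kill) (v : Fock) :
    ExteriorAlgebra.algebraMapInv (letterOp s x v) = 0 := by
  rcases x with i | i
  · exact isFermi_fR.vac_f s i (not_lt.1 hx) v
  · exact isFermi_fR.vac_d s i (not_le.1 hx) v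

theorem phi_letterOp (s : Bool) (x : Letter) :
    phi * letterOp s x + letterOp s x * phi = 0 := by
  rcases x with i | i
  · exact isFermi_fR.phi_f s i
  · exact isFermi_fR.phi_d s i

/-- The vacuum expectation value as a linear map. -/
def vevLin : Op →ₗ[ℂ] ℂ :=
  (ExteriorAlgebra.algebraMapInv (R := ℂ) (M := Mode →₀ ℂ)).toLinearMap ∘ₗ
    LinearMap.applyₗ (1 : Fock)

theorem vevLin_apply (X : Op) : vevLin X = vev X := rfl

theorem vev_one : vev 1 = 1 := by
  simp [vev]

section Coefficients

variable (Q : Type) [CommRing Q] [Algebra ℂ Q]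

/-- Operators on the Fock space with coefficients in `Q`. -/
def QOp : Type := Q ⊗[ℂ] Op

instance : Ring (QOp Q) := inferInstanceAs (Ring (Q ⊗[ℂ] Op))

instance : Algebra Q (QOp Q) := inferInstanceAs (Algebra Q (Q ⊗[ℂ] Op))

instance : Algebra ℂ (QOp Q) := inferInstanceAs (Algebra ℂ (Q ⊗[ℂ] Op))

instance : IsScalarTower ℂ Q (QOp Q) := inferInstanceAs (IsScalarTower ℂ Q (Q ⊗[ℂ] Op))

/-- The vacuum expectation value, with coefficients in `Q`. -/
def vevQ : QOp Q →ₗ[Q] Q :=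
  ((TensorProduct.AlgebraTensorModule.rid ℂ Q Q).toLinearMap ∘ₗ vevLin.baseChange Q :
    Q ⊗[ℂ] Op →ₗ[Q] Q)

/-- An operator, viewed as an operator with coefficients in `Q`. -/
def opQ : Op →ₐ[ℂ] QOp Q :=
  (Algebra.TensorProduct.includeRight : Op →ₐ[ℂ] Q ⊗[ℂ] Op)

variable {Q}

theorem QOp.induction {P : QOp Q → Prop} (h : ∀ (q : Q) (X : Op), P (q • opQ Q X))
    (hadd : ∀ a b, P a → P b → P (a + b)) (Z : QOp Q) : P Z := by
  have h' : ∀ (q : Q) (X : Op), P ((q ⊗ₜ X : Q ⊗[ℂ] Op)) := by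
    intro q X
    have : (q ⊗ₜ X : Q ⊗[ℂ] Op) = (q • opQ Q X : QOp Q) := by
      change (q ⊗ₜ X : Q ⊗[ℂ] Op) = q • ((1 : Q) ⊗ₜ X : Q ⊗[ℂ] Op)
      rw [TensorProduct.smul_tmul', smul_eq_mul, mul_one]
    rw [this]
    exact h q X
  refine TensorProduct.induction_on (motive := P) Z ?_ h' hadd
  have := h 0 0
  rwa [zero_smul] at this

theorem vevQ_opQ (X : Op) : vevQ Q (opQ Q X) = algebraMap ℂ Q (vev X) := by
  change TensorProduct.AlgebraTensorModule.rid ℂ Q Q (vevLin.baseChange Q ((1 : Q) ⊗ₜ X)) = _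
  simp [vevLin_apply, Algebra.smul_def]

theorem vevQ_letter_mul (s : Bool) (x : Letter) (hx : ¬ x.kill) (Z : QOp Q) :
    vevQ Q (opQ Q (letterOp s x) * Z) = 0 := by
  induction Z using QOp.induction with
  | h q X =>
    rw [mul_smul_comm, map_smul, ← map_mul, vevQ_opQ, vev, Module.End.mul_apply,
      vac_letterOp s x hx, map_zero, smul_zero]
  | hadd a b ha hb => rw [mul_add, map_add, ha, hb, add_zero]

theorem vevQ_mul_letter (s : Bool) (x : Letter) (hx : x.kill) (Z : QOp Q) :
    vevQ Q (Z * opQ Q (letterOp s x)) = 0 := by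
  induction Z using QOp.induction with
  | h q X =>
    rw [smul_mul_assoc, map_smul, ← map_mul, vevQ_opQ, vev, Module.End.mul_apply,
      letterOp_one s x hx, map_zero, map_zero, map_zero, smul_zero]
  | hadd a b ha hb => rw [add_mul, map_add, ha, hb, add_zero]

variable (Q) in
/-- The evaluation of words in the copy `s` of the type B fermions. -/
def evQ (s : Bool) : FreeAlgebra Q Letter →ₐ[Q] QOp Q :=
  FreeAlgebra.lift Q fun x => opQ Q (letterOp s x)

@[simp]
theorem evQ_ι (s : Bool) (x : Letter) : evQ Q s (FreeAlgebra.ι Q x) = opQ Q (letterOp s x) := by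
  simp [evQ]

theorem opQ_letter_anticomm (s t : Bool) (x y : Letter) :
    opQ Q (letterOp s x) * opQ Q (letterOp t y) + opQ Q (letterOp t y) * opQ Q (letterOp s x)
      = algebraMap Q _ (if s = t then algebraMap ℂ Q (letterPair x y) else 0) := by
  rw [← map_mul, ← map_mul, ← map_add, letterOp_anticomm, map_smul, map_one,
    Algebra.smul_def, mul_one]
  split_ifs
  · exact IsScalarTower.algebraMap_apply ℂ Q (QOp Q) _
  · simp

/-- A letter may change the operator it passes, here into an unspecified Z, as long as it arrives
unchanged at the vacuum. -/
theorem isWick_sandwich (s : Bool) (Z₁ Z₂ : QOp Q)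
    (h₁ : ∀ x, ∃ Z, Z₁ * opQ Q (letterOp s x) = opQ Q (letterOp s x) * Z)
    (h₂ : ∀ x, ∃ Z, opQ Q (letterOp s x) * Z₂ = Z * opQ Q (letterOp s x)) :
    IsWick Letter.kill (fun x y => algebraMap ℂ Q (letterPair x y))
      (vevQ Q ∘ₗ LinearMap.mulLeft Q Z₁ ∘ₗ LinearMap.mulRight Q Z₂ ∘ₗ (evQ Q s).toLinearMap) := by
  refine ⟨fun x hx w => ?_, fun x hx w => ?_, fun x y u v => ?_⟩
  · obtain ⟨Z, hZ⟩ := h₁ x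
    simp only [LinearMap.comp_apply, AlgHom.toLinearMap_apply, map_mul, evQ_ι,
      LinearMap.mulLeft_apply, LinearMap.mulRight_apply]
    rw [← mul_assoc, ← mul_assoc, hZ, mul_assoc, mul_assoc, vevQ_letter_mul s x hx]
  · obtain ⟨Z, hZ⟩ := h₂ x
    simp only [LinearMap.comp_apply, AlgHom.toLinearMap_apply, map_mul, evQ_ι,
      LinearMap.mulLeft_apply, LinearMap.mulRight_apply]
    rw [mul_assoc, hZ, ← mul_assoc, ← mul_assoc, vevQ_mul_letter s x hx]
  · simp only [LinearMap.comp_apply, AlgHom.toLinearMap_apply, map_mul, map_add, evQ_ι,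
      LinearMap.mulLeft_apply, LinearMap.mulRight_apply]
    rw [opQ_letter_anticomm, if_pos rfl, ← Algebra.commutes, mul_assoc, mul_assoc,
      ← mul_assoc Z₁, ← Algebra.commutes, mul_assoc, ← Algebra.smul_def, map_smul, smul_eq_mul,
      mul_assoc (evQ Q s u)]

variable (Q) in
/-- The vacuum expectation value of words. -/
def wick : FreeAlgebra Q Letter →ₗ[Q] Q := vevQ Q ∘ₗ (evQ Q false).toLinearMap

theorem wick_apply (w : FreeAlgebra Q Letter) : wick Q w = vevQ Q (evQ Q false w) := rfl

theorem wick_one : wick Q 1 = 1 := by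
  rw [wick_apply, map_one, ← map_one (opQ Q), vevQ_opQ, vev_one, map_one]

theorem isWick_wick :
    IsWick Letter.kill (fun x y => algebraMap ℂ Q (letterPair x y)) (wick Q) := by
  have h := isWick_sandwich (Q := Q) false 1 1 (fun x => ⟨1, by simp⟩) (fun x => ⟨1, by simp⟩)
  convert h using 1
  ext w
  simp [wick]

/-- Uniqueness in Wick's theorem factors out everything foreign to the copy s. It is applied with Z₁
or Z₂ equal to φ, and with Z₂ a word of the twins. -/
theorem vevQ_sandwich (s : Bool) (Z₁ Z₂ : QOp Q)
    (h₁ : ∀ x, ∃ Z, Z₁ * opQ Q (letterOp s x) = opQ Q (letterOp s x) * Z)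
    (h₂ : ∀ x, ∃ Z, opQ Q (letterOp s x) * Z₂ = Z * opQ Q (letterOp s x))
    (w : FreeAlgebra Q Letter) :
    vevQ Q (Z₁ * evQ Q s w * Z₂) = vevQ Q (Z₁ * Z₂) * wick Q w := by
  have h := (isWick_sandwich s Z₁ Z₂ h₁ h₂).eq_mul isWick_wick wick_one w
  simpa [mul_assoc] using h

/-- The twins satisfy the same relations as the type B fermions, hence have the same expectation
values. -/
theorem vevQ_evQ (s : Bool) (w : FreeAlgebra Q Letter) : vevQ Q (evQ Q s w) = wick Q w := by
  have h := vevQ_sandwich (Q := Q) s 1 1 (fun x => ⟨1, by simp⟩) (fun x => ⟨1, by simp⟩) w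
  rw [one_mul, mul_one, mul_one, ← map_one (opQ Q), vevQ_opQ, vev_one, map_one, one_mul] at h
  exact h

/-- The parity automorphism. -/
def parity (Q : Type) [CommRing Q] : FreeAlgebra Q Letter →ₐ[Q] FreeAlgebra Q Letter :=
  FreeAlgebra.lift Q fun x => -FreeAlgebra.ι Q x

@[simp]
theorem parity_ι (x : Letter) : parity Q (FreeAlgebra.ι Q x) = -FreeAlgebra.ι Q x := by
  simp [parity]

/-- Changing the sign of every letter preserves the anticommutators, which are quadratic, so
uniqueness applies. -/
theorem wick_parity (w : FreeAlgebra Q Letter) : wick Q (parity Q w) = wick Q w := by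
  have h : IsWick Letter.kill (fun x y => algebraMap ℂ Q (letterPair x y))
      (wick Q ∘ₗ (parity Q).toLinearMap) := by
    have h := isWick_wick (Q := Q)
    refine ⟨fun x hx w => ?_, fun x hx w => ?_, fun x y u v => ?_⟩
    · simp [h.left x hx]
    · simp [h.right x hx]
    · simp only [LinearMap.comp_apply, AlgHom.toLinearMap_apply, map_mul, map_add, parity_ι,
        neg_mul_neg, h.pair]
  have := h.eq_mul isWick_wick wick_one w
  simpa [wick_one] using this

theorem wick_eq_zero_of_parity {w : FreeAlgebra Q Letter} (h : parity Q w = -w) :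
    wick Q w = 0 := by
  have h1 := wick_parity w
  rw [h, map_neg, neg_eq_iff_add_eq_zero, ← two_smul ℂ] at h1
  have h2 : ((2 : ℂ)⁻¹ * 2) • wick Q w = 0 := by rw [mul_smul, h1, smul_zero]
  simpa using h2

theorem letter_mul_evQ {Z : QOp Q} {s : Bool}
    (hZ : ∀ y, Z * opQ Q (letterOp s y) = -(opQ Q (letterOp s y) * Z))
    (w : FreeAlgebra Q Letter) :
    Z * evQ Q s w = evQ Q s (parity Q w) * Z := by
  induction w using FreeAlgebra.induction with
  | grade0 r => simp [Algebra.commutes]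
  | grade1 y => simp [hZ]
  | mul a b ha hb => rw [map_mul, ← mul_assoc, ha, mul_assoc, hb, map_mul, map_mul, mul_assoc]
  | add a b ha hb => rw [map_add, mul_add, ha, hb, map_add, map_add, add_mul]

theorem letter_anticomm_ne {s t : Bool} (hst : s ≠ t) (x y : Letter) :
    opQ Q (letterOp s x) * opQ Q (letterOp t y)
      = -(opQ Q (letterOp t y) * opQ Q (letterOp s x)) := by
  have h := opQ_letter_anticomm (Q := Q) s t x y
  rw [if_neg hst, map_zero] at h
  exact eq_neg_of_add_eq_zero_left h

theorem phi_anticomm (s : Bool) (x : Letter) :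
    opQ Q phi * opQ Q (letterOp s x) = -(opQ Q (letterOp s x) * opQ Q phi) := by
  rw [eq_neg_iff_add_eq_zero, ← map_mul, ← map_mul, ← map_add, phi_letterOp, map_zero]

theorem phi_mul_evQ (s : Bool) (w : FreeAlgebra Q Letter) :
    opQ Q phi * evQ Q s w = evQ Q s (parity Q w) * opQ Q phi :=
  letter_mul_evQ (phi_anticomm s) w

theorem evQ_mul_evQ_of_even {s t : Bool} (hst : s ≠ t) {w : FreeAlgebra Q Letter}
    (hw : parity Q w = w) (u : FreeAlgebra Q Letter) :
    evQ Q t u * evQ Q s w = evQ Q s w * evQ Q t u := by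
  induction u using FreeAlgebra.induction with
  | grade0 r => simp [Algebra.commutes]
  | grade1 y => rw [evQ_ι, letter_mul_evQ (letter_anticomm_ne hst.symm y), hw]
  | mul a b ha hb => rw [map_mul, mul_assoc, hb, ← mul_assoc, ha, mul_assoc]
  | add a b ha hb => rw [map_add, add_mul, ha, hb, mul_add]

theorem evQ_mul_evQ_of_odd {s t : Bool} (hst : s ≠ t) {w : FreeAlgebra Q Letter}
    (hw : parity Q w = -w) (u : FreeAlgebra Q Letter) :
    evQ Q t u * evQ Q s w = evQ Q s w * evQ Q t (parity Q u) := by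
  induction u using FreeAlgebra.induction with
  | grade0 r => simp [Algebra.commutes]
  | grade1 y => rw [evQ_ι, letter_mul_evQ (letter_anticomm_ne hst.symm y), hw]; simp
  | mul a b ha hb =>
    rw [map_mul, mul_assoc, hb, ← mul_assoc, ha, mul_assoc, map_mul, map_mul]
  | add a b ha hb => rw [map_add, add_mul, ha, hb, map_add, map_add, mul_add]

/-- Factorization over the two copies: a type B letter passes a twin word at the price of the parity
automorphism on that word, so the twin word may serve as Z₂ in `vevQ_sandwich`. -/
theorem vevQ_evQ_mul_evQ (u w : FreeAlgebra Q Letter) :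
    vevQ Q (evQ Q false u * evQ Q true w) = wick Q u * wick Q w := by
  have h := vevQ_sandwich (Q := Q) false 1 (evQ Q true w) (fun x => ⟨1, by simp⟩)
    (fun x => ⟨_, letter_mul_evQ (letter_anticomm_ne (by simp) x) w⟩) u
  rw [one_mul, one_mul, vevQ_evQ, mul_comm] at h
  exact h

theorem vevQ_phi_evQ (w : FreeAlgebra Q Letter) : vevQ Q (opQ Q phi * evQ Q false w) = 0 := by
  have h := vevQ_sandwich (Q := Q) false (opQ Q phi) 1
    (fun x => ⟨-opQ Q phi, by rw [phi_anticomm, mul_neg]⟩) (fun x => ⟨1, by simp⟩) w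
  rw [mul_one, mul_one, vevQ_opQ, vev_phi, map_zero, zero_mul] at h
  exact h

theorem vevQ_evQ_phi (w : FreeAlgebra Q Letter) : vevQ Q (evQ Q false w * opQ Q phi) = 0 := by
  have h := vevQ_sandwich (Q := Q) false 1 (opQ Q phi) (fun x => ⟨1, by simp⟩)
    (fun x => ⟨-opQ Q phi, by rw [neg_mul, phi_anticomm, neg_neg]⟩) w
  rw [one_mul, one_mul, vevQ_opQ, vev_phi, map_zero, zero_mul] at h
  exact h

theorem opQ_phi_mul_phi : opQ Q phi * opQ Q phi = (1 / 2 : ℂ) • 1 := by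
  rw [← map_mul, phi_mul_phi, map_smul, map_one]

end Coefficients

/-! ### Charged vacua -/

/-- `x_{n-1} ⋯ x_0`. -/
def descProd {A : Type*} [Monoid A] (n : ℕ) (x : ℕ → A) : A :=
  ((List.range n).reverse.map x).prod

/-- `x_0 ⋯ x_{n-1}`. -/
def ascProd {A : Type*} [Monoid A] (n : ℕ) (x : ℕ → A) : A := ((List.range n).map x).prod

theorem descProd_succ {A : Type*} [Monoid A] (n : ℕ) (x : ℕ → A) :
    descProd (n + 1) x = x n * descProd n x := by
  simp [descProd, List.range_succ]

theorem ascProd_succ {A : Type*} [Monoid A] (n : ℕ) (x : ℕ → A) :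
    ascProd (n + 1) x = ascProd n x * x n := by
  simp [ascProd, List.range_succ]

theorem map_descProd {A B F : Type*} [Monoid A] [Monoid B] [FunLike F A B] [MonoidHomClass F A B]
    (f : F) (n : ℕ) (x : ℕ → A) : f (descProd n x) = descProd n fun k => f (x k) := by
  simp [descProd, map_list_prod, List.map_map, Function.comp_def]

theorem map_ascProd {A B F : Type*} [Monoid A] [Monoid B] [FunLike F A B] [MonoidHomClass F A B]
    (f : F) (n : ℕ) (x : ℕ → A) : f (ascProd n x) = ascProd n fun k => f (x k) := by
  simp [ascProd, map_list_prod, List.map_map, Function.comp_def]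

theorem descProd_mul_comm {A : Type*} [Ring A] (n : ℕ) (x : ℕ → A) (y : A)
    (h : ∀ k < n, x k * y = -(y * x k)) : descProd n x * y = (-1) ^ n * (y * descProd n x) := by
  induction n with
  | zero => simp [descProd]
  | succ n ih =>
    rw [descProd_succ, mul_assoc, ih fun k hk => h k (by omega), pow_succ]
    have := h n (by omega)
    rw [← mul_assoc (x n), ((Commute.neg_one_right (x n)).pow_right n).eq, mul_assoc,
      ← mul_assoc (x n), this]
    simp [mul_assoc]

theorem ascProd_mul_comm {A : Type*} [Ring A] (n : ℕ) (x : ℕ → A) (y : A)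
    (h : ∀ k < n, x k * y = -(y * x k)) : ascProd n x * y = (-1) ^ n * (y * ascProd n x) := by
  induction n with
  | zero => simp [ascProd]
  | succ n ih =>
    rw [ascProd_succ, mul_assoc, h n (by omega), mul_neg, ← mul_assoc,
      ih fun k hk => h k (by omega), pow_succ]
    simp [mul_assoc]

theorem neg_one_pow_mul_self {A : Type*} [Ring A] (n : ℕ) :
    ((-1 : A) ^ n) * (-1) ^ n = 1 := by
  rw [← pow_add, ← two_mul, pow_mul]; simp

/-- Both sides are reorderings of the product of the pairs b_k a_k = c x_k y_k. The sign (-1)^n from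
moving a_n through the b's is used up again in moving y_n through the x's, so no sign remains. -/
theorem descProd_mul_descProd {A : Type*} [Ring A] [Algebra ℂ A] (n : ℕ) (c : ℂ)
    (a b x y : ℕ → A) (hab : ∀ i j, i < j → b i * a j = -(a j * b i))
    (hxy : ∀ i j, i < j → x i * y j = -(y j * x i)) (h : ∀ k, b k * a k = c • (x k * y k)) :
    descProd n b * descProd n a = c ^ n • (descProd n x * descProd n y) := by
  induction n with
  | zero => simp [descProd]
  | succ n ih =>
    have h1 := descProd_mul_comm n b (a n) fun k hk => hab k n hk
    have h2 := descProd_mul_comm n x (y n) fun k hk => hxy k n hk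
    calc descProd (n + 1) b * descProd (n + 1) a
        = b n * (descProd n b * a n) * descProd n a := by
          simp only [descProd_succ, mul_assoc]
      _ = (-1) ^ n * (b n * a n * (descProd n b * descProd n a)) := by
          rw [h1, ← mul_assoc (b n), ((Commute.neg_one_right (b n)).pow_right n).eq]
          simp only [mul_assoc]
      _ = c ^ (n + 1) • (x n * ((-1) ^ n * (y n * descProd n x)) * descProd n y) := by
          rw [h, ih, ← mul_assoc (x n), ((Commute.neg_one_right (x n)).pow_right n).eq]
          simp only [mul_assoc, smul_mul_assoc, mul_smul_comm, pow_succ', smul_smul, mul_comm c]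
      _ = _ := by
          rw [← h2]
          simp only [descProd_succ, mul_assoc]

theorem ascProd_mul_ascProd {A : Type*} [Ring A] [Algebra ℂ A] (n : ℕ) (c : ℂ)
    (a b x y : ℕ → A) (hab : ∀ i j, i < j → b i * a j = -(a j * b i))
    (hxy : ∀ i j, i < j → y i * x j = -(x j * y i)) (h : ∀ k, a k * b k = c • (x k * y k)) :
    ascProd n a * ascProd n b = c ^ n • (ascProd n x * ascProd n y) := by
  induction n with
  | zero => simp [ascProd]
  | succ n ih =>
    have h1 := ascProd_mul_comm n b (a n) fun k hk => hab k n hk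
    have h2 := ascProd_mul_comm n y (x n) fun k hk => hxy k n hk
    have h1' : a n * ascProd n b = (-1) ^ n * (ascProd n b * a n) := by
      rw [h1, ← mul_assoc, neg_one_pow_mul_self, one_mul]
    calc ascProd (n + 1) a * ascProd (n + 1) b
        = ascProd n a * (a n * ascProd n b) * b n := by
          simp only [ascProd_succ, mul_assoc]
      _ = (-1) ^ n * (ascProd n a * ascProd n b * (a n * b n)) := by
          rw [h1', ← mul_assoc (ascProd n a),
            ((Commute.neg_one_right (ascProd n a)).pow_right n).eq]
          simp only [mul_assoc]
      _ = c ^ (n + 1) • ((-1) ^ n * (ascProd n x * (ascProd n y * x n) * y n)) := by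
          rw [h, ih]
          simp only [mul_assoc, smul_mul_assoc, mul_smul_comm, pow_succ, smul_smul, mul_comm c]
      _ = _ := by
          rw [h2, ← mul_assoc (ascProd n x),
            ((Commute.neg_one_right (ascProd n x)).pow_right n).eq]
          simp only [ascProd_succ, mul_assoc]
          rw [← mul_assoc ((-1 : A) ^ n), neg_one_pow_mul_self, one_mul]

theorem chargeKet_natCast (f fd : ℤ → Op) (n : ℕ) :
    chargeKet f fd n = descProd n fun k => f k := rfl

theorem chargeKet_neg_natCast (f fd : ℤ → Op) (n : ℕ) :
    chargeKet f fd (-n) = descProd n fun k => fd (-1 - k) := by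
  cases n <;> rfl

theorem chargeBra_natCast (f fd : ℤ → Op) (n : ℕ) :
    chargeBra f fd n = ascProd n fun k => fd k := rfl

theorem chargeBra_neg_natCast (f fd : ℤ → Op) (n : ℕ) :
    chargeBra f fd (-n) = ascProd n fun k => f (-1 - k) := by
  cases n <;> rfl

theorem IsFermi.ff' {σ : Type} [DecidableEq σ] {f fd : σ → ℤ → Op} (h : IsFermi f fd)
    (s i t j) : f s i * f t j = -(f t j * f s i) :=
  eq_neg_of_add_eq_zero_left (h.ff s i t j)

theorem IsFermi.dd' {σ : Type} [DecidableEq σ] {f fd : σ → ℤ → Op} (h : IsFermi f fd)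
    (s i t j) : fd s i * fd t j = -(fd t j * fd s i) :=
  eq_neg_of_add_eq_zero_left (h.dd s i t j)

/-- The squares vanish and the cross terms ixy and -iyx agree; the prefactor 1/2 compensates their
doubling. -/
theorem sub_mul_add_twin {A : Type*} [Ring A] [Algebra ℂ A] {x y : A} (hx : x * x = 0)
    (hy : y * y = 0) (hxy : x * y = -(y * x)) :
    (sqrtTwo⁻¹ • (x - Complex.I • y)) * (sqrtTwo⁻¹ • (x + Complex.I • y))
      = Complex.I • (x * y) := by
  have h := inv_sqrtTwo_mul_self
  rw [smul_mul_smul_comm, h]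
  simp only [sub_mul, mul_add, mul_smul_comm, smul_mul_assoc, hx, hy, smul_zero]
  rw [eq_neg_iff_add_eq_zero, add_comm, ← eq_neg_iff_add_eq_zero] at hxy
  rw [hxy]
  module

theorem add_mul_sub_twin {A : Type*} [Ring A] [Algebra ℂ A] {x y : A} (hx : x * x = 0)
    (hy : y * y = 0) (hxy : x * y = -(y * x)) :
    (sqrtTwo⁻¹ • (x + Complex.I • y)) * (sqrtTwo⁻¹ • (x - Complex.I • y))
      = (-Complex.I) • (x * y) := by
  have h := sub_mul_add_twin (x := x) (y := -y) hx (by simpa using hy) (by simp [hxy])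
  simpa [sub_eq_add_neg] using h

theorem self_mul_self_eq_zero {A : Type*} [Ring A] [Algebra ℂ A] {x : A} (h : x * x = -(x * x)) :
    x * x = 0 := by
  rw [eq_neg_iff_add_eq_zero, ← two_smul ℂ] at h
  exact (smul_eq_zero_iff_right two_ne_zero).1 h

theorem neg_I_zpow_neg (n : ℕ) : (-Complex.I) ^ (-(n : ℤ)) = Complex.I ^ n := by
  rw [zpow_neg, zpow_natCast, ← inv_pow, inv_neg, Complex.inv_I, neg_neg]

/-- Index by index, ψ†⁽²⁾_{-1-k} ψ⁽¹⁾_k = -i ψ_k ψ̂_k. For negative m the conjugate pairs give a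
factor i for each index, that is, (-i)⁻¹. -/
theorem ketTL_eq (m : ℤ) :
    ketTL m (-m) = (-Complex.I) ^ m • (chargeKet (fR false) (fdR false) m
      * chargeKet (fR true) (fdR true) m) := by
  have hT := isFermi_fT
  have hR := isFermi_fR
  obtain ⟨n, rfl | rfl⟩ := m.eq_nat_or_neg
  · rw [ketTL, chargeKet_natCast, chargeKet_natCast, chargeKet_natCast, chargeKet_neg_natCast,
      zpow_natCast]
    have h0 : (fun k : ℕ => psi 0 (k : ℤ)) = fun k : ℕ => fT false k := by
      funext k; simp [fT]
    have h1 : (fun k : ℕ => psiDag 1 (-1 - (k : ℤ))) = fun k : ℕ => fT true k := by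
      funext k; simp [fT]
    rw [h0, h1]
    refine descProd_mul_descProd n _ (fun k => fT false k) (fun k => fT true k) _ _
      (fun i j _ => hT.ff' _ _ _ _) (fun i j _ => hR.ff' _ _ _ _) fun k => ?_
    simp only [fT_false, fT_true]
    exact add_mul_sub_twin (self_mul_self_eq_zero (hR.ff' _ _ _ _))
      (self_mul_self_eq_zero (hR.ff' _ _ _ _)) (hR.ff' _ _ _ _)
  · rw [ketTL, neg_neg, chargeKet_natCast, chargeKet_neg_natCast, chargeKet_neg_natCast,
      chargeKet_neg_natCast, neg_I_zpow_neg]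
    have h1 : (fun k : ℕ => psi 1 (k : ℤ)) = fun k : ℕ => fdT true (-1 - k) := by
      funext k; simp [fdT]
    have h0 : (fun k : ℕ => psiDag 0 (-1 - (k : ℤ))) = fun k : ℕ => fdT false (-1 - k) := by
      funext k; simp [fdT]
    rw [h0, h1]
    refine descProd_mul_descProd n _ (fun k => fdT false (-1 - k)) (fun k => fdT true (-1 - k)) _ _
      (fun i j _ => hT.dd' _ _ _ _) (fun i j _ => hR.dd' _ _ _ _) fun k => ?_
    simp only [fdT_false, fdT_true]
    exact sub_mul_add_twin (self_mul_self_eq_zero (hR.dd' _ _ _ _))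
      (self_mul_self_eq_zero (hR.dd' _ _ _ _)) (hR.dd' _ _ _ _)

theorem braTL_eq (n : ℤ) :
    braTL n (-n) = (-Complex.I) ^ n • (chargeBra (fR false) (fdR false) n
      * chargeBra (fR true) (fdR true) n) := by
  have hT := isFermi_fT
  have hR := isFermi_fR
  obtain ⟨p, rfl | rfl⟩ := n.eq_nat_or_neg
  · rw [braTL, chargeBra_natCast, chargeBra_natCast, chargeBra_natCast, chargeBra_neg_natCast,
      zpow_natCast]
    have h0 : (fun k : ℕ => psiDag 0 (k : ℤ)) = fun k : ℕ => fdT false k := by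
      funext k; simp [fdT]
    have h1 : (fun k : ℕ => psi 1 (-1 - (k : ℤ))) = fun k : ℕ => fdT true k := by
      funext k; simp [fdT]
    rw [h0, h1]
    refine ascProd_mul_ascProd p _ (fun k => fdT false k) (fun k => fdT true k) _ _
      (fun i j _ => hT.dd' _ _ _ _) (fun i j _ => hR.dd' _ _ _ _) fun k => ?_
    simp only [fdT_false, fdT_true]
    exact add_mul_sub_twin (self_mul_self_eq_zero (hR.dd' _ _ _ _))
      (self_mul_self_eq_zero (hR.dd' _ _ _ _)) (hR.dd' _ _ _ _)
  · rw [braTL, neg_neg, chargeBra_natCast, chargeBra_neg_natCast, chargeBra_neg_natCast,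
      chargeBra_neg_natCast, neg_I_zpow_neg]
    have h1 : (fun k : ℕ => psiDag 1 (k : ℤ)) = fun k : ℕ => fT true (-1 - k) := by
      funext k; simp [fT]
    have h0 : (fun k : ℕ => psi 0 (-1 - (k : ℤ))) = fun k : ℕ => fT false (-1 - k) := by
      funext k; simp [fT]
    rw [h0, h1]
    refine ascProd_mul_ascProd p _ (fun k => fT false (-1 - k)) (fun k => fT true (-1 - k)) _ _
      (fun i j _ => hT.ff' _ _ _ _) (fun i j _ => hR.ff' _ _ _ _) fun k => ?_
    simp only [fT_false, fT_true]
    exact sub_mul_add_twin (self_mul_self_eq_zero (hR.ff' _ _ _ _))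
      (self_mul_self_eq_zero (hR.ff' _ _ _ _)) (hR.ff' _ _ _ _)

/-- The sign in the definition of τᵀᴸ cancels the powers of -i from the charged vacua, up to one i
per odd index. Both factors depend on n mod 4 only. -/
theorem neg_one_zpow_mul_neg_I_zpow (n : ℤ) :
    (-1 : ℂ) ^ (n * (n + 1) / 2) * (-Complex.I) ^ n = if Even n then 1 else Complex.I := by
  have hI4 : (-Complex.I) ^ (4 : ℤ) = 1 := by
    rw [show (4 : ℤ) = ((4 : ℕ) : ℤ) from rfl, zpow_natCast, neg_pow, Complex.I_pow_four]; norm_num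
  have h1 : (-1 : ℂ) ≠ 0 := by norm_num
  have h2 : -Complex.I ≠ 0 := neg_ne_zero.2 Complex.I_ne_zero
  have h12 : (-1 : ℂ) ^ (2 : ℤ) = 1 := by norm_num
  obtain ⟨q, hq⟩ : ∃ q, n = 4 * q + n % 4 := ⟨n / 4, by omega⟩
  have hr : n % 4 = 0 ∨ n % 4 = 1 ∨ n % 4 = 2 ∨ n % 4 = 3 := by omega
  rcases hr with hr | hr | hr | hr <;> rw [hr] at hq <;> subst hq
  · have e1 : (4 * q + 0) * (4 * q + 0 + 1) / 2 = 2 * (q * (4 * q + 1)) := by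
      apply Int.ediv_eq_of_eq_mul_left (by norm_num); ring
    rw [e1, zpow_mul, h12, one_zpow, add_zero, zpow_mul, hI4, one_zpow,
      if_pos ⟨2 * q, by ring⟩, one_mul]
  · have e1 : (4 * q + 1) * (4 * q + 1 + 1) / 2 = 2 * (q * (4 * q + 3)) + 1 := by
      apply Int.ediv_eq_of_eq_mul_left (by norm_num); ring
    rw [e1, zpow_add₀ h1, zpow_mul, h12, one_zpow, zpow_add₀ h2, zpow_mul, hI4, one_zpow,
      if_neg (by rw [Int.not_even_iff_odd]; exact ⟨2 * q, by ring⟩)]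
    simp
  · have e1 : (4 * q + 2) * (4 * q + 2 + 1) / 2 = 2 * (q * (4 * q + 5) + 1) + 1 := by
      apply Int.ediv_eq_of_eq_mul_left (by norm_num); ring
    rw [e1, zpow_add₀ h1, zpow_mul, h12, one_zpow, zpow_add₀ h2, zpow_mul, hI4, one_zpow,
      if_pos ⟨2 * q + 1, by ring⟩]
    simp
  · have e1 : (4 * q + 3) * (4 * q + 3 + 1) / 2 = 2 * ((q + 1) * (4 * q + 3)) := by
      apply Int.ediv_eq_of_eq_mul_left (by norm_num); ring
    rw [e1, zpow_mul, h12, one_zpow, zpow_add₀ h2, zpow_mul, hI4, one_zpow,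
      if_neg (by rw [Int.not_even_iff_odd]; exact ⟨2 * q + 1, by ring⟩)]
    rw [show (3 : ℤ) = ((3 : ℕ) : ℤ) from rfl, zpow_natCast, neg_pow, Complex.I_pow_three]
    norm_num

/-! ### Truncated exponentials -/

section Texp

variable {Q A B : Type} [CommRing Q] [Algebra ℂ Q] [Ring A] [Algebra Q A] [Ring B] [Algebra Q B]

variable (Q) in
/-- The exponential series, truncated after `n` terms. -/
def texp (n : ℕ) (x : A) : A :=
  ∑ i ∈ Finset.range n, algebraMap ℂ Q ((i.factorial : ℂ)⁻¹) • x ^ i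

theorem map_texp (f : A →ₐ[Q] B) (n : ℕ) (x : A) : f (texp Q n x) = texp Q n (f x) := by
  simp [texp]

theorem texp_add {x y : A} (h : Commute x y) (hx : IsNilpotent x) (hy : IsNilpotent y) :
    ∀ᶠ n in atTop, texp Q n (x + y) = texp Q n x * texp Q n y := by
  -- `IsNilpotent.exp` needs rational scalars; on a nilpotent element it equals every long enough
  -- truncation.
  let _ : Module ℚ A := Module.compHom A ((algebraMap ℂ Q).comp (algebraMap ℚ ℂ))
  have hexp : ∀ z : A, IsNilpotent z → ∀ᶠ n in atTop, IsNilpotent.exp z = texp Q n z := by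
    rintro z ⟨k, hk⟩
    filter_upwards [eventually_ge_atTop k] with n hn
    rw [IsNilpotent.exp_eq_sum (pow_eq_zero_of_le hn hk), texp]
    refine Finset.sum_congr rfl fun i _ => ?_
    change ((algebraMap ℂ Q).comp (algebraMap ℚ ℂ)) _ • z ^ i = _
    simp
  filter_upwards [hexp _ (h.isNilpotent_add hx hy), hexp x hx, hexp y hy] with n h1 h2 h3
  rw [← h1, ← h2, ← h3, IsNilpotent.exp_add_of_commute h hx hy]

theorem texp_of_sq_eq_zero {x : A} (h : x * x = 0) {n : ℕ} (hn : 2 ≤ n) :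
    texp Q n x = 1 + x := by
  obtain ⟨k, rfl⟩ : ∃ k, n = k + 2 := ⟨n - 2, by omega⟩
  have h2 : ∀ i, x ^ (i + 1 + 1) = 0 := fun i => by
    rw [pow_succ, pow_succ, mul_assoc, h, mul_zero]
  rw [texp, Finset.sum_range_succ', Finset.sum_range_succ']
  simp [h2, add_comm x]

end Texp

/-! ### The algebraic identity -/

section Main

variable {Q : Type} [CommRing Q] [Algebra ℂ Q]

/-- `w` is homogeneous of parity `p`. -/
def HasParity (p : ℕ) (w : FreeAlgebra Q Letter) : Prop := parity Q w = (-1 : Q) ^ p • w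

theorem HasParity.mul {p q : ℕ} {u w : FreeAlgebra Q Letter} (hu : HasParity p u)
    (hw : HasParity q w) : HasParity (p + q) (u * w) := by
  unfold HasParity at *
  rw [map_mul, hu, hw, smul_mul_smul_comm, pow_add]

theorem HasParity.smul {p : ℕ} {w : FreeAlgebra Q Letter} (c : Q)
    (hw : HasParity p w) : HasParity p (c • w) := by
  unfold HasParity at *
  rw [map_smul, hw, smul_comm]

theorem HasParity.sum {p : ℕ} {ι : Type*} (s : Finset ι) (f : ι → FreeAlgebra Q Letter)
    (h : ∀ i ∈ s, HasParity p (f i)) : HasParity p (∑ i ∈ s, f i) := by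
  unfold HasParity at *
  rw [map_sum, Finset.smul_sum]
  exact Finset.sum_congr rfl h

theorem hasParity_one : HasParity 0 (1 : FreeAlgebra Q Letter) := by
  simp [HasParity]

theorem hasParity_ι (x : Letter) : HasParity 1 (FreeAlgebra.ι Q x) := by
  simp [HasParity]

theorem HasParity.pow {w : FreeAlgebra Q Letter} (hw : HasParity 0 w) (n : ℕ) :
    HasParity 0 (w ^ n) := by
  induction n with
  | zero => simpa using hasParity_one
  | succ n ih => rw [pow_succ]; exact ih.mul hw

theorem HasParity.texp {w : FreeAlgebra Q Letter} (hw : HasParity 0 w) (n : ℕ) :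
    HasParity 0 (texp Q n w) :=
  HasParity.sum _ _ fun i _ => (hw.pow i).smul _

theorem hasParity_descProd (n : ℕ) (x : ℕ → Letter) :
    HasParity n (descProd n fun k => FreeAlgebra.ι Q (x k)) := by
  induction n with
  | zero => simpa [descProd] using hasParity_one
  | succ n ih => rw [descProd_succ, add_comm]; exact (hasParity_ι _).mul ih

theorem hasParity_ascProd (n : ℕ) (x : ℕ → Letter) :
    HasParity n (ascProd n fun k => FreeAlgebra.ι Q (x k)) := by
  induction n with
  | zero => simpa [ascProd] using hasParity_one
  | succ n ih => rw [ascProd_succ]; exact ih.mul (hasParity_ι _)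

theorem HasParity.wick_eq_zero {p : ℕ} {w : FreeAlgebra Q Letter} (hw : HasParity p w)
    (hp : Odd p) : wick Q w = 0 := by
  refine wick_eq_zero_of_parity ?_
  rw [hw, hp.neg_one_pow, neg_one_smul]

theorem evQ_true_mul_evQ_false {p q : ℕ} {u w : FreeAlgebra Q Letter} (hu : HasParity q u)
    (hw : HasParity p w) :
    evQ Q true u * evQ Q false w = (-1 : Q) ^ (p * q) • (evQ Q false w * evQ Q true u) := by
  rcases Nat.even_or_odd p with hp | hp
  · rw [evQ_mul_evQ_of_even (by simp) (by rw [hw, hp.neg_one_pow, one_smul]),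
      (hp.mul_right q).neg_one_pow, one_smul]
  · rw [evQ_mul_evQ_of_odd (by simp) (by rw [hw, hp.neg_one_pow, neg_one_smul]), hu, map_smul,
      mul_smul_comm, pow_mul, hp.neg_one_pow]

/-- The product of a word in the type B fermions and of a word in their twins. -/
def twin (u w : FreeAlgebra Q Letter) : QOp Q := evQ Q false u * evQ Q true w

/-- The sign comes from carrying w to the left of the twin word of u'. -/
theorem twin_mul_twin {p q : ℕ} {u u' w w' : FreeAlgebra Q Letter} (hu : HasParity q u')
    (hw : HasParity p w) :
    twin u u' * twin w w' = (-1 : Q) ^ (p * q) • twin (u * w) (u' * w') := by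
  unfold twin
  rw [map_mul, map_mul, mul_assoc, ← mul_assoc (evQ Q true u'), evQ_true_mul_evQ_false hu hw,
    smul_mul_assoc, mul_smul_comm]
  simp only [mul_assoc]

theorem twin_mul_twin_even {u u' w w' : FreeAlgebra Q Letter}
    (hw : HasParity 0 w) : twin u u' * twin w w' = twin (u * w) (u' * w') := by
  unfold twin
  rw [map_mul, map_mul, mul_assoc, ← mul_assoc (evQ Q true u'),
    evQ_mul_evQ_of_even (by simp) (by simpa [HasParity] using hw)]
  simp only [mul_assoc]

theorem commute_evQ {w : FreeAlgebra Q Letter} (hw : HasParity 0 w) (u : FreeAlgebra Q Letter)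
    {s t : Bool} (hst : s ≠ t) : Commute (evQ Q s w) (evQ Q t u) :=
  (evQ_mul_evQ_of_even hst (by simpa [HasParity] using hw) u).symm

/-- This is where the square in the theorem arises. -/
theorem vevQ_twin_self (w : FreeAlgebra Q Letter) : vevQ Q (twin w w) = wick Q w ^ 2 := by
  rw [twin, vevQ_evQ_mul_evQ, sq]

theorem texp_twin {E : FreeAlgebra Q Letter} (hE : HasParity 0 E)
    (h : ∀ s, IsNilpotent (evQ Q s E)) :
    ∀ᶠ r in atTop, texp Q r (evQ Q false E + evQ Q true E) = twin (texp Q r E) (texp Q r E) := by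
  filter_upwards [texp_add (Q := Q) (commute_evQ hE E (by simp)) (h false) (h true)] with r hr
  rw [hr, twin, map_texp, map_texp]

theorem twin_self_sq {α : FreeAlgebra Q Letter} (hα : HasParity 1 α)
    (h : ∀ s, evQ Q s α * evQ Q s α = 0) : twin α α * twin α α = 0 := by
  rw [twin_mul_twin hα hα, twin, map_mul, h, zero_mul, smul_zero]

/-- The term cαα̂ has square zero and commutes with H and Ĥ, so its exponential splits off as 1 +
cαα̂. -/
theorem texp_twin_interaction {H α : FreeAlgebra Q Letter} (hH : HasParity 0 H)
    (hα : HasParity 1 α) (c : Q) (h : ∀ s, IsNilpotent (evQ Q s H))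
    (hαα : ∀ s, evQ Q s α * evQ Q s α = 0) (hαH : ∀ s, Commute (evQ Q s H) (evQ Q s α)) :
    ∀ᶠ r in atTop, texp Q r (evQ Q false H + evQ Q true H + c • twin α α)
      = twin (texp Q r H) (texp Q r H)
        + c • (twin (texp Q r H) (texp Q r H) * twin α α) := by
  have h0 : c • twin α α * c • twin α α = 0 := by
    rw [smul_mul_smul_comm, twin_self_sq hα hαα, smul_zero]
  have hc : Commute (evQ Q false H + evQ Q true H) (c • twin α α) := by
    refine Commute.smul_right (Commute.add_left ?_ ?_) c
    · exact (hαH false).mul_right (commute_evQ hH α (by simp))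
    · exact (commute_evQ hH α (by simp)).mul_right (hαH true)
  have hn : IsNilpotent (evQ Q false H + evQ Q true H) :=
    (commute_evQ hH H (by simp)).isNilpotent_add (h false) (h true)
  filter_upwards [texp_add (Q := Q) hc hn ⟨2, by rw [sq, h0]⟩, texp_twin hH h, eventually_ge_atTop 2]
    with r h1 h2 h3
  rw [h1, h2, texp_of_sq_eq_zero h0 h3, mul_add, mul_one, mul_smul_comm]

/-- All exponentials are even, so signs arise only when α or R passes twin words: α passes the twin
of L, of parity p, and R passes twins of parity p or, in the α term, p + 1. -/
theorem vevQ_twin_exp {p q : ℕ} {L E H α E' R : FreeAlgebra Q Letter} (hL : HasParity p L)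
    (hE : HasParity 0 E) (hH : HasParity 0 H) (hα : HasParity 1 α) (hE' : HasParity 0 E')
    (hR : HasParity q R) (hnE : ∀ s, IsNilpotent (evQ Q s E))
    (hnH : ∀ s, IsNilpotent (evQ Q s H)) (hnE' : ∀ s, IsNilpotent (evQ Q s E'))
    (hαα : ∀ s, evQ Q s α * evQ Q s α = 0) (hαH : ∀ s, Commute (evQ Q s H) (evQ Q s α)) (c : Q) :
    ∀ᶠ r in atTop, vevQ Q (twin L L * texp Q r (evQ Q false E + evQ Q true E)
        * texp Q r (evQ Q false H + evQ Q true H + c • twin α α)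
        * texp Q r (evQ Q false E' + evQ Q true E') * twin R R)
      = (-1) ^ (q * p) * wick Q (L * texp Q r E * texp Q r H * texp Q r E' * R) ^ 2
        + c * ((-1) ^ p * (-1) ^ (q * (p + 1))
          * wick Q (L * texp Q r E * texp Q r H * α * texp Q r E' * R) ^ 2) := by
  filter_upwards [texp_twin hE hnE, texp_twin hE' hnE',
    texp_twin_interaction hH hα c hnH hαα hαH] with r h1 h2 h3
  have pE := hE.texp r
  have pH := hH.texp r
  have pE' := hE'.texp r
  rw [h1, h2, h3, twin_mul_twin_even pE, mul_add, twin_mul_twin_even pH, mul_smul_comm,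
    ← mul_assoc, twin_mul_twin_even pH, twin_mul_twin ((hL.mul pE).mul pH) hα, add_mul,
    twin_mul_twin_even pE', smul_mul_assoc, smul_mul_assoc, twin_mul_twin_even pE', add_mul,
    twin_mul_twin (((hL.mul pE).mul pH).mul pE') hR, smul_mul_assoc, smul_mul_assoc,
    twin_mul_twin ((((hL.mul pE).mul pH).mul hα).mul pE') hR, map_add, map_smul, map_smul,
    map_smul, map_smul, vevQ_twin_self, vevQ_twin_self]
  simp only [smul_eq_mul, add_zero, one_mul]
  ring

/-- `√2` in `Q`. -/
def rtTwo (Q : Type) [CommRing Q] [Algebra ℂ Q] : Q := algebraMap ℂ Q sqrtTwo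

theorem rtTwo_mul_rtTwo : rtTwo Q * rtTwo Q = 2 := by
  rw [rtTwo, ← map_mul, sqrtTwo_mul_self, map_ofNat]

theorem phi_sq : opQ Q phi * opQ Q phi = algebraMap ℂ Q (1 / 2) • 1 := by
  rw [opQ_phi_mul_phi, algebraMap_smul]

theorem two_mul_half : (2 : Q) * algebraMap ℂ Q (1 / 2) = 1 := by
  rw [← map_ofNat (algebraMap ℂ Q) 2, ← map_mul]; norm_num

theorem HasParity.phi_mul {p : ℕ} {w : FreeAlgebra Q Letter} (hw : HasParity p w) :
    opQ Q phi * evQ Q false w = (-1 : Q) ^ p • (evQ Q false w * opQ Q phi) := by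
  rw [phi_mul_evQ, hw, map_smul, smul_mul_assoc]

/-- The type B counterpart: αφ squares to zero because α does, and the even word of E' lets φ
through to the right end. -/
theorem texp_phi {E H α E' : FreeAlgebra Q Letter} (hH : HasParity 0 H)
    (hα : HasParity 1 α) (hE' : HasParity 0 E') (hnH : IsNilpotent (evQ Q false H))
    (hαα : evQ Q false α * evQ Q false α = 0) (hαH : Commute (evQ Q false H) (evQ Q false α)) :
    ∀ᶠ r in atTop, texp Q r (evQ Q false E)
        * texp Q r (evQ Q false H + rtTwo Q • (evQ Q false α * opQ Q phi))
        * texp Q r (evQ Q false E')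
      = evQ Q false (texp Q r E * texp Q r H * texp Q r E')
        + rtTwo Q • (evQ Q false (texp Q r E * texp Q r H * α * texp Q r E') * opQ Q phi) := by
  have h0 : rtTwo Q • (evQ Q false α * opQ Q phi) * rtTwo Q • (evQ Q false α * opQ Q phi) = 0 := by
    rw [smul_mul_smul_comm, mul_assoc, ← mul_assoc (opQ Q phi), hα.phi_mul, smul_mul_assoc,
      mul_smul_comm, ← mul_assoc, ← mul_assoc, hαα]
    simp
  have hc : Commute (evQ Q false H) (rtTwo Q • (evQ Q false α * opQ Q phi)) := by
    refine Commute.smul_right (hαH.mul_right ?_) _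
    have := hH.phi_mul
    rw [pow_zero, one_smul] at this
    exact this.symm
  filter_upwards [texp_add (Q := Q) hc hnH ⟨2, by rw [sq, h0]⟩, eventually_ge_atTop 2] with r h1 h2
  have pE' := (hE'.texp r).phi_mul
  rw [pow_zero, one_smul] at pE'
  rw [h1, texp_of_sq_eq_zero h0 h2]
  simp only [map_mul, map_texp] at pE' ⊢
  simp only [mul_add, add_mul, mul_one, mul_smul_comm, smul_mul_assoc, mul_assoc, pE']

end Main

/-! ### Expectation values with truncated exponentials, by the parities of n and m. -/

section Main

variable {Q : Type} [CommRing Q] [Algebra ℂ Q]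

theorem opQ_smul (a : ℂ) (X : Op) : opQ Q (a • X) = algebraMap ℂ Q a • opQ Q X := by
  rw [map_smul, algebraMap_smul]

variable (Q) in
/-- The word of `Ψ_m`. -/
def ketWord : ℤ → FreeAlgebra Q Letter
  | Int.ofNat n => descProd n fun k => FreeAlgebra.ι Q (Sum.inl (k : ℤ))
  | Int.negSucc n => descProd (n + 1) fun k => FreeAlgebra.ι Q (Sum.inr (-1 - (k : ℤ)))

variable (Q) in
/-- The word of `Ψ†_n`. -/
def braWord : ℤ → FreeAlgebra Q Letter
  | Int.ofNat n => ascProd n fun k => FreeAlgebra.ι Q (Sum.inr (k : ℤ))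
  | Int.negSucc n => ascProd (n + 1) fun k => FreeAlgebra.ι Q (Sum.inl (-1 - (k : ℤ)))

theorem hasParity_ketWord (m : ℤ) : HasParity m.natAbs (ketWord Q m) := by
  cases m <;> exact hasParity_descProd _ _

theorem hasParity_braWord (m : ℤ) : HasParity m.natAbs (braWord Q m) := by
  cases m <;> exact hasParity_ascProd _ _

theorem opQ_chargeKet (s : Bool) (m : ℤ) :
    opQ Q (chargeKet (fR s) (fdR s) m) = evQ Q s (ketWord Q m) := by
  rcases m with n | n
  · change opQ Q (descProd n fun k => fR s k) = _
    rw [map_descProd, ketWord, map_descProd]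
    simp [letterOp]
  · change opQ Q (descProd (n + 1) fun k => fdR s (-1 - k)) = _
    rw [map_descProd, ketWord, map_descProd]
    simp [letterOp]

theorem opQ_chargeBra (s : Bool) (m : ℤ) :
    opQ Q (chargeBra (fR s) (fdR s) m) = evQ Q s (braWord Q m) := by
  rcases m with n | n
  · change opQ Q (ascProd n fun k => fdR s k) = _
    rw [map_ascProd, braWord, map_ascProd]
    simp [letterOp]
  · change opQ Q (ascProd (n + 1) fun k => fR s (-1 - k)) = _
    rw [map_ascProd, braWord, map_ascProd]
    simp [letterOp]

theorem opQ_ketB (m : ℤ) : opQ Q (ketB m) = if Even m then evQ Q false (ketWord Q m)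
    else rtTwo Q • (evQ Q false (ketWord Q m) * opQ Q phi) := by
  have h1 : psiB = fR false := funext psiB_eq
  have h2 : psiBDag = fdR false := funext psiBDag_eq
  rw [ketB, h1, h2, ← opQ_chargeKet]
  split_ifs
  · rfl
  · rw [opQ_smul, map_mul, rtTwo]

theorem opQ_braB (m : ℤ) : opQ Q (braB m) = if Even m then evQ Q false (braWord Q m)
    else rtTwo Q • (opQ Q phi * evQ Q false (braWord Q m)) := by
  have h1 : psiB = fR false := funext psiB_eq
  have h2 : psiBDag = fdR false := funext psiBDag_eq
  rw [braB, h1, h2, ← opQ_chargeBra]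
  split_ifs
  · rfl
  · rw [opQ_smul, map_mul, rtTwo]

theorem opQ_ketTL (m : ℤ) : opQ Q (ketTL m (-m))
    = algebraMap ℂ Q ((-Complex.I) ^ m) • twin (ketWord Q m) (ketWord Q m) := by
  rw [ketTL_eq, opQ_smul, map_mul, opQ_chargeKet, opQ_chargeKet, twin]

theorem opQ_braTL (m : ℤ) : opQ Q (braTL m (-m))
    = algebraMap ℂ Q ((-Complex.I) ^ m) • twin (braWord Q m) (braWord Q m) := by
  rw [braTL_eq, opQ_smul, map_mul, opQ_chargeBra, opQ_chargeBra, twin]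

/-! ### Elimination of the neutral fermion φ. -/

section Neutral

variable {p q : ℕ} {L Y Z R : FreeAlgebra Q Letter}

theorem vevQ_evQ_phi_evQ (hR : HasParity q R) (u : FreeAlgebra Q Letter) :
    vevQ Q (evQ Q false u * opQ Q phi * evQ Q false R) = 0 := by
  rw [mul_assoc, hR.phi_mul, mul_smul_comm, ← mul_assoc, map_smul, ← map_mul, vevQ_evQ_phi,
    smul_zero]

theorem evQ_phi_evQ_phi (hR : HasParity q R) (u : FreeAlgebra Q Letter) :
    evQ Q false u * opQ Q phi * (evQ Q false R * opQ Q phi)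
      = ((-1) ^ q * algebraMap ℂ Q (1 / 2)) • evQ Q false (u * R) := by
  rw [mul_assoc, ← mul_assoc (opQ Q phi), hR.phi_mul, smul_mul_assoc, mul_smul_comm, mul_assoc,
    phi_sq, ← mul_assoc, ← map_mul, mul_smul_comm, smul_smul, mul_one]

/-- In this and the next three lemmas Y is the part without α and Z the part with one α. A single φ
has vanishing expectation value, so Y survives when the number of φ's from the two vacua is even,
and Z when it is odd. A pair of φ's gives 1/2, against the two factors √2 attached to it. -/
theorem vevQ_neutral_even_even (hR : HasParity q R) :
    vevQ Q (evQ Q false L * (evQ Q false Y + rtTwo Q • (evQ Q false Z * opQ Q phi))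
        * evQ Q false R) = wick Q (L * Y * R) := by
  rw [mul_add, add_mul, map_add, mul_smul_comm, smul_mul_assoc, map_smul, ← mul_assoc,
    ← map_mul (evQ Q false) L Z, vevQ_evQ_phi_evQ hR, smul_zero, add_zero, ← map_mul, ← map_mul,
    vevQ_evQ]

theorem vevQ_neutral_even_odd (hR : HasParity q R) :
    vevQ Q (evQ Q false L * (evQ Q false Y + rtTwo Q • (evQ Q false Z * opQ Q phi))
        * rtTwo Q • (evQ Q false R * opQ Q phi)) = (-1) ^ q * wick Q (L * Z * R) := by
  have h1 : evQ Q false L * evQ Q false Y * (evQ Q false R * opQ Q phi)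
      = evQ Q false (L * Y * R) * opQ Q phi := by simp only [map_mul, mul_assoc]
  have h2 : evQ Q false L * (evQ Q false Z * opQ Q phi) * (evQ Q false R * opQ Q phi)
      = ((-1) ^ q * algebraMap ℂ Q (1 / 2)) • evQ Q false (L * Z * R) := by
    rw [← mul_assoc (evQ Q false L), ← map_mul, evQ_phi_evQ_phi hR]
  simp only [mul_add, add_mul, smul_mul_assoc, mul_smul_comm, h1, h2, map_add, map_smul,
    vevQ_evQ_phi, vevQ_evQ, smul_eq_mul, zero_add]
  linear_combination (-1) ^ q * wick Q (L * Z * R)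
    * (algebraMap ℂ Q (1 / 2) * rtTwo_mul_rtTwo (Q := Q) + two_mul_half (Q := Q))

theorem vevQ_neutral_odd_even (hLZ : HasParity p (L * Z)) :
    vevQ Q (rtTwo Q • (opQ Q phi * evQ Q false L)
        * (evQ Q false Y + rtTwo Q • (evQ Q false Z * opQ Q phi))
        * evQ Q false R) = (-1) ^ p * wick Q (L * Z * R) := by
  have h1 : opQ Q phi * evQ Q false L * evQ Q false Y * evQ Q false R
      = opQ Q phi * evQ Q false (L * Y * R) := by simp only [map_mul, mul_assoc]
  have h2 : opQ Q phi * evQ Q false L * (evQ Q false Z * opQ Q phi) * evQ Q false R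
      = ((-1) ^ p * algebraMap ℂ Q (1 / 2)) • evQ Q false (L * Z * R) := by
    rw [mul_assoc (opQ Q phi), ← mul_assoc (evQ Q false L), ← map_mul, ← mul_assoc, hLZ.phi_mul,
      smul_mul_assoc, smul_mul_assoc, mul_assoc (evQ Q false _), phi_sq, mul_smul_comm,
      smul_mul_assoc, smul_smul, mul_one, ← map_mul]
  simp only [mul_add, add_mul, smul_mul_assoc, mul_smul_comm, h1, h2, map_add, map_smul,
    vevQ_phi_evQ, vevQ_evQ, smul_eq_mul, mul_zero, zero_add]
  linear_combination (-1) ^ p * wick Q (L * Z * R)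
    * (algebraMap ℂ Q (1 / 2) * rtTwo_mul_rtTwo (Q := Q) + two_mul_half (Q := Q))

theorem vevQ_neutral_odd_odd (hLYR : HasParity p (L * Y * R)) (hR : HasParity q R) :
    vevQ Q (rtTwo Q • (opQ Q phi * evQ Q false L)
        * (evQ Q false Y + rtTwo Q • (evQ Q false Z * opQ Q phi))
        * rtTwo Q • (evQ Q false R * opQ Q phi)) = (-1) ^ p * wick Q (L * Y * R) := by
  have h1 : opQ Q phi * evQ Q false L * evQ Q false Y * (evQ Q false R * opQ Q phi)
      = ((-1) ^ p * algebraMap ℂ Q (1 / 2)) • evQ Q false (L * Y * R) := by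
    have : opQ Q phi * evQ Q false L * evQ Q false Y * (evQ Q false R * opQ Q phi)
        = opQ Q phi * evQ Q false (L * Y * R) * opQ Q phi := by simp only [map_mul, mul_assoc]
    rw [this, hLYR.phi_mul, smul_mul_assoc, mul_assoc, phi_sq, mul_smul_comm, smul_smul, mul_one]
  have h2 : opQ Q phi * evQ Q false L * (evQ Q false Z * opQ Q phi) * (evQ Q false R * opQ Q phi)
      = ((-1) ^ q * algebraMap ℂ Q (1 / 2)) • (opQ Q phi * evQ Q false (L * Z * R)) := by
    rw [mul_assoc (opQ Q phi), ← mul_assoc (evQ Q false L), ← map_mul, mul_assoc (opQ Q phi),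
      evQ_phi_evQ_phi hR, mul_smul_comm]
  simp only [mul_add, add_mul, smul_mul_assoc, mul_smul_comm, h1, h2, map_add, map_smul,
    vevQ_phi_evQ, vevQ_evQ, smul_eq_mul, mul_zero, add_zero]
  linear_combination (-1) ^ p * wick Q (L * Y * R)
    * (algebraMap ℂ Q (1 / 2) * rtTwo_mul_rtTwo (Q := Q) + two_mul_half (Q := Q))

end Neutral

/-- The expectation value of type B, with truncated exponentials. -/
def vevB (n m : ℤ) (r : ℕ) (E H α E' : FreeAlgebra Q Letter) : Q :=
  vevQ Q (opQ Q (braB n) * (texp Q r (evQ Q false E)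
    * texp Q r (evQ Q false H + rtTwo Q • (evQ Q false α * opQ Q phi))
    * texp Q r (evQ Q false E')) * opQ Q (ketB m))

/-- The expectation value of the Toda lattice, with truncated exponentials. -/
def vevTL (n m : ℤ) (r : ℕ) (E H α E' : FreeAlgebra Q Letter) (c : Q) : Q :=
  algebraMap ℂ Q ((-1) ^ (n * (n + 1) / 2 + m * (m + 1) / 2)) *
    vevQ Q (opQ Q (braTL n (-n)) * (texp Q r (evQ Q false E + evQ Q true E)
      * texp Q r (evQ Q false H + evQ Q true H + c • twin α α)
      * texp Q r (evQ Q false E' + evQ Q true E')) * opQ Q (ketTL m (-m)))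

/-- For n - m even only the words without α have even parity, and the value does not depend on c.
For n - m odd only the words with α survive and the value is linear in c = ±i. The reordering signs
combine with the factor i per odd index, and with c when n - m is odd, to 1 for c = i. -/
theorem vevB_sq (n m : ℤ) {E H α E' : FreeAlgebra Q Letter}
    (hE : HasParity 0 E) (hH : HasParity 0 H) (hα : HasParity 1 α) (hE' : HasParity 0 E')
    (hnE : ∀ s, IsNilpotent (evQ Q s E)) (hnH : ∀ s, IsNilpotent (evQ Q s H))
    (hnE' : ∀ s, IsNilpotent (evQ Q s E')) (hαα : ∀ s, evQ Q s α * evQ Q s α = 0)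
    (hαH : ∀ s, Commute (evQ Q s H) (evQ Q s α)) :
    ∀ᶠ r in atTop,
      vevB n m r E H α E' ^ 2 = vevTL n m r E H α E' (algebraMap ℂ Q Complex.I) ∧
      vevB n m r E H α E' ^ 2 = algebraMap ℂ Q ((-1) ^ (n - m))
        * vevTL n m r E H α E' (-algebraMap ℂ Q Complex.I) := by
  have hL := hasParity_braWord (Q := Q) n
  have hR := hasParity_ketWord (Q := Q) m
  filter_upwards [texp_phi (E := E) hH hα hE' (hnH false) (hαα false) (hαH false),
    vevQ_twin_exp hL hE hH hα hE' hR hnE hnH hnE' hαα hαH (algebraMap ℂ Q Complex.I),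
    vevQ_twin_exp hL hE hH hα hE' hR hnE hnH hnE' hαα hαH (-algebraMap ℂ Q Complex.I)]
    with r h1 h2 h3
  have pY : HasParity (n.natAbs + m.natAbs)
      (braWord Q n * (texp Q r E * texp Q r H * texp Q r E') * ketWord Q m) := by
    have := (hL.mul (((hE.texp r).mul (hH.texp r)).mul (hE'.texp r))).mul hR
    simpa using this
  have pZ : HasParity (n.natAbs + 1)
      (braWord Q n * (texp Q r E * texp Q r H * α * texp Q r E')) := by
    have := (hL.mul ((((hE.texp r).mul (hH.texp r)).mul hα).mul (hE'.texp r)))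
    simpa using this
  have pZ' := pZ.mul hR
  -- Collects the scalars from both charged vacua and from the normalization of τᵀᴸ.
  have hs : ∀ c : Q, vevTL n m r E H α E' c
      = algebraMap ℂ Q ((if Even n then 1 else Complex.I) * if Even m then 1 else Complex.I)
        * vevQ Q (twin (braWord Q n) (braWord Q n) * texp Q r (evQ Q false E + evQ Q true E)
          * texp Q r (evQ Q false H + evQ Q true H + c • twin α α)
          * texp Q r (evQ Q false E' + evQ Q true E') * twin (ketWord Q m) (ketWord Q m)) := by
    intro c
    rw [vevTL, opQ_braTL, opQ_ketTL, ← neg_one_zpow_mul_neg_I_zpow,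
      ← neg_one_zpow_mul_neg_I_zpow, zpow_add₀ (by norm_num)]
    simp only [smul_mul_assoc, mul_smul_comm, map_smul, smul_eq_mul, mul_assoc, map_mul]
    ring
  rw [hs, hs, h2, h3, vevB, h1, opQ_braB, opQ_ketB]
  have eY : braWord Q n * texp Q r E * texp Q r H * texp Q r E' * ketWord Q m
      = braWord Q n * (texp Q r E * texp Q r H * texp Q r E') * ketWord Q m := by
    simp only [mul_assoc]
  have eZ : braWord Q n * texp Q r E * texp Q r H * α * texp Q r E' * ketWord Q m
      = braWord Q n * (texp Q r E * texp Q r H * α * texp Q r E') * ketWord Q m := by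
    simp only [mul_assoc]
  rw [eY, eZ]
  have hI : algebraMap ℂ Q Complex.I * algebraMap ℂ Q Complex.I = -1 := by
    rw [← map_mul, Complex.I_mul_I, map_neg, map_one]
  rcases Int.even_or_odd n with hn | hn <;> rcases Int.even_or_odd m with hm | hm
  · have hn' := Int.natAbs_even.2 hn
    have hm' := Int.natAbs_even.2 hm
    rw [if_pos hn, if_pos hm, if_pos hn, if_pos hm, vevQ_neutral_even_even hR,
      pZ'.wick_eq_zero (by rw [add_right_comm]; exact (hn'.add hm').add_one), (hn.sub hm).neg_one_zpow,
      (hm'.mul_right _).neg_one_pow]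
    simp
  · have hn' := Int.natAbs_even.2 hn
    have hm' := Int.natAbs_odd.2 hm
    have hm'' := Int.not_even_iff_odd.2 hm
    rw [if_pos hn, if_neg hm'', if_pos hn, if_neg hm'', vevQ_neutral_even_odd hR,
      pY.wick_eq_zero (hn'.add_odd hm'), (hn.sub_odd hm).neg_one_zpow, hn'.neg_one_pow,
      hm'.neg_one_pow, (hm'.mul hn'.add_one).neg_one_pow]
    simp only [one_mul, map_neg, map_one]
    constructor
    · linear_combination wick Q (braWord Q n * (texp Q r E * texp Q r H * α * texp Q r E')
        * ketWord Q m) ^ 2 * hI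
    · linear_combination wick Q (braWord Q n * (texp Q r E * texp Q r H * α * texp Q r E')
        * ketWord Q m) ^ 2 * hI
  · have hn' := Int.natAbs_odd.2 hn
    have hm' := Int.natAbs_even.2 hm
    have hn'' := Int.not_even_iff_odd.2 hn
    rw [if_neg hn'', if_pos hm, if_neg hn'', if_pos hm, vevQ_neutral_odd_even pZ,
      pY.wick_eq_zero (hn'.add_even hm'), (hn.sub_even hm).neg_one_zpow, hn'.neg_one_pow,
      hn'.add_one.neg_one_pow, (hm'.mul_right (n.natAbs + 1)).neg_one_pow]
    simp only [one_mul, mul_one, map_neg, map_one]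
    constructor
    · linear_combination wick Q (braWord Q n * (texp Q r E * texp Q r H * α * texp Q r E')
        * ketWord Q m) ^ 2 * hI
    · linear_combination wick Q (braWord Q n * (texp Q r E * texp Q r H * α * texp Q r E')
        * ketWord Q m) ^ 2 * hI
  · have hn' := Int.natAbs_odd.2 hn
    have hm' := Int.natAbs_odd.2 hm
    have hn'' := Int.not_even_iff_odd.2 hn
    have hm'' := Int.not_even_iff_odd.2 hm
    rw [if_neg hn'', if_neg hm'', if_neg hn'', if_neg hm'', vevQ_neutral_odd_odd pY hR,
      pZ'.wick_eq_zero (by rw [add_right_comm]; exact (hn'.add_odd hm').add_one),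
      (hn.sub_odd hm).neg_one_zpow, (hn'.add_odd hm').neg_one_pow, (hm'.mul hn').neg_one_pow,
      Complex.I_mul_I]
    simp

end Main

/-! ### Words -/

section Words

variable {ι : Type}

/-- Prefixing a word by a letter. -/
def consEmbedding : ι × List ι ↪ List ι where
  toFun p := p.1 :: p.2
  inj' := by
    intro p q h
    have h' := List.cons.inj h
    exact Prod.ext h'.1 h'.2

theorem consEmbedding_apply (p : ι × List ι) : consEmbedding p = p.1 :: p.2 := rfl

/-- The words of length `n` in the letters of `S`. -/
def words (S : Finset ι) : ℕ → Finset (List ι)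
  | 0 => {[]}
  | n + 1 => (S ×ˢ words S n).map consEmbedding

theorem mem_words {S : Finset ι} {n : ℕ} {w : List ι} :
    w ∈ words S n ↔ w.length = n ∧ ∀ x ∈ w, x ∈ S := by
  induction n generalizing w with
  | zero =>
    simp only [words, Finset.mem_singleton, List.length_eq_zero_iff]
    constructor
    · rintro rfl; simp
    · exact fun h => h.1
  | succ n ih =>
    simp only [words, Finset.mem_map, Finset.mem_product, consEmbedding_apply,
      Prod.exists]
    constructor
    · rintro ⟨a, v, ⟨ha, hv⟩, rfl⟩
      rw [ih] at hv
      simpa [hv.1, ha] using hv.2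
    · rintro ⟨h1, h2⟩
      cases w with
      | nil => simp at h1
      | cons a v =>
        refine ⟨a, v, ⟨h2 a (by simp), ih.2 ⟨by simpa using h1, fun x hx => h2 x (by simp [hx])⟩⟩,
          rfl⟩

theorem sum_pow_eq_sum_words {A : Type*} [Semiring A] (S : Finset ι) (X : ι → A) (n : ℕ) :
    (∑ x ∈ S, X x) ^ n = ∑ w ∈ words S n, (w.map X).prod := by
  induction n with
  | zero => simp [words]
  | succ n ih =>
    rw [pow_succ', ih, words, Finset.sum_map, Finset.sum_product, Finset.sum_mul_sum]
    simp [consEmbedding_apply]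

theorem words_pairwiseDisjoint (S : Finset ι) (s : Set ℕ) : s.PairwiseDisjoint (words S) := by
  intro m _ n _ h
  rw [Function.onFun, Finset.disjoint_left]
  intro w h1 h2
  rw [mem_words] at h1 h2
  exact h (h1.1.symm.trans h2.1)

/-- The words of length less than `n` in the letters of `S`. -/
def wordsLT (S : Finset ι) (n : ℕ) : Finset (List ι) :=
  (Finset.range n).disjiUnion (words S) (words_pairwiseDisjoint S _)

theorem mem_wordsLT {S : Finset ι} {n : ℕ} {w : List ι} :
    w ∈ wordsLT S n ↔ w.length < n ∧ ∀ x ∈ w, x ∈ S := by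
  simp [wordsLT, mem_words]

theorem sum_wordsLT {A : Type*} [AddCommMonoid A] (S : Finset ι) (n : ℕ) (F : List ι → A) :
    ∑ w ∈ wordsLT S n, F w = ∑ i ∈ Finset.range n, ∑ w ∈ words S i, F w := by
  rw [wordsLT, Finset.sum_disjiUnion]

/-- A repeated letter can be moved next to its other occurrence, up to sign. This bounds the length
of nonzero interaction words, which the times do not control. -/
theorem prod_map_eq_zero_of_not_nodup {A : Type*} [Ring A] {X : ι → A}
    (hX : ∀ x y, X x * X y = X y * X x ∨ X x * X y = -(X y * X x)) (h0 : ∀ x, X x * X x = 0)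
    {w : List ι} (hw : ¬ w.Nodup) : (w.map X).prod = 0 := by
  have hcomm : ∀ x (v : List ι), X x * (v.map X).prod = (v.map X).prod * X x ∨
      X x * (v.map X).prod = -((v.map X).prod * X x) := by
    intro x v
    induction v with
    | nil => simp
    | cons y v ih =>
      rw [List.map_cons, List.prod_cons]
      rcases hX x y with h | h <;> rcases ih with h' | h' <;> rw [← mul_assoc, h] <;>
        simp [mul_assoc, h']
  induction w with
  | nil => simp at hw
  | cons x w ih =>
    rw [List.nodup_cons, not_and_or, not_not] at hw
    rw [List.map_cons, List.prod_cons]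
    rcases hw with hx | hw
    · obtain ⟨u, v, rfl⟩ := List.append_of_mem hx
      rw [List.map_append, List.prod_append, List.map_cons, List.prod_cons, ← mul_assoc]
      have hz : (u.map X).prod * X x * (X x * (v.map X).prod) = 0 := by
        rw [mul_assoc, ← mul_assoc (X x), h0, zero_mul, mul_zero]
      rcases hcomm x u with h | h <;> simp [h, hz]
    · rw [ih hw, mul_zero]

end Words

/-! ### Support properties of vectors and functionals -/

section Supp

variable {M : Type} [AddCommGroup M] [Module ℂ M] {σ : Type}

/-- Families `f`, `f†` of operators that anticommute, except possibly `f s i` and `f† t i`. -/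
structure IsAnti (f fd : σ → ℤ → Module.End ℂ M) : Prop where
  ff : ∀ s i t j, f s i * f t j = -(f t j * f s i)
  dd : ∀ s i t j, fd s i * fd t j = -(fd t j * fd s i)
  anti : ∀ s i t j, i ≠ j → f s i * fd t j = -(fd t j * f s i)

/-- The vector `v` is killed by `f s i` for `i < -N` and by `f† s i` for `i ≥ N`. -/
def Supp (f fd : σ → ℤ → Module.End ℂ M) (N : ℤ) (v : M) : Prop :=
  (∀ s i, i < -N → f s i v = 0) ∧ ∀ s i, N ≤ i → fd s i v = 0

variable {f fd : σ → ℤ → Module.End ℂ M}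

theorem Supp.mono {N N' : ℤ} {v : M} (h : Supp f fd N v) (hN : N ≤ N') : Supp f fd N' v :=
  ⟨fun s i hi => h.1 s i (by omega), fun s i hi => h.2 s i (by omega)⟩

theorem Supp.apply_of_anti {N : ℤ} {v : M} (h : Supp f fd N v) {X : Module.End ℂ M}
    (h1 : ∀ s i, i < -N → f s i * X = -(X * f s i))
    (h2 : ∀ s i, N ≤ i → fd s i * X = -(X * fd s i)) : Supp f fd N (X v) := by
  refine ⟨fun s i hi => ?_, fun s i hi => ?_⟩
  · rw [← Module.End.mul_apply, h1 s i hi]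
    simp [h.1 s i hi]
  · rw [← Module.End.mul_apply, h2 s i hi]
    simp [h.2 s i hi]

theorem Supp.smul {N : ℤ} {v : M} (h : Supp f fd N v) (c : ℂ) : Supp f fd N (c • v) :=
  ⟨fun s i hi => by rw [map_smul, h.1 s i hi, smul_zero],
    fun s i hi => by rw [map_smul, h.2 s i hi, smul_zero]⟩

theorem IsAnti.exists_supp_f (ha : IsAnti f fd) {v : M} (h : ∃ N, Supp f fd N v) (t : σ) (j : ℤ) :
    ∃ N, Supp f fd N (f t j v) := by
  obtain ⟨N, hN⟩ := h
  refine ⟨max N (|j| + 1), (hN.mono (le_max_left _ _)).apply_of_anti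
    (fun s i _ => ha.ff s i t j) fun s i hi => ?_⟩
  have h1 := le_trans (le_max_right N (|j| + 1)) hi
  have h2 := le_abs_self j
  rw [ha.anti t j s i (by omega), neg_neg]

theorem IsAnti.exists_supp_d (ha : IsAnti f fd) {v : M} (h : ∃ N, Supp f fd N v) (t : σ) (j : ℤ) :
    ∃ N, Supp f fd N (fd t j v) := by
  obtain ⟨N, hN⟩ := h
  refine ⟨max N (|j| + 1), (hN.mono (le_max_left _ _)).apply_of_anti
    (fun s i hi => ?_) fun s i _ => ha.dd s i t j⟩
  have h1 := le_max_right N (|j| + 1)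
  have h2 := neg_abs_le j
  exact ha.anti s i t j (by omega)

/-- If l < -N, then f_l passes f†_{l-k}, as k ≠ 0, and kills v; if l - k ≥ N, then f†_{l-k} kills v.
For the remaining l, both indices lie in [-N-k, N+k), so the modes outside this window pass through
to v. -/
theorem IsAnti.flow_apply (ha : IsAnti f fd) {N k l : ℤ} (hk : 0 < k) {v : M}
    (h : Supp f fd N v) (s t : σ) (c : ℂ) :
    Supp f fd (N + k) ((c • (f s l * fd t (l - k))) v) ∧
      ((c • (f s l * fd t (l - k))) v ≠ 0 → -N ≤ l ∧ l < N + k) := by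
  have hne : (f s l * fd t (l - k)) v ≠ 0 → -N ≤ l ∧ l < N + k := by
    intro h0
    constructor
    · by_contra hl
      apply h0
      rw [ha.anti s l t (l - k) (by omega)]
      simp [h.1 s l (by omega)]
    · by_contra hl
      apply h0
      rw [Module.End.mul_apply, h.2 t (l - k) (by omega), map_zero]
  refine ⟨?_, fun h0 => hne fun h1 => h0 (by rw [LinearMap.smul_apply, h1, smul_zero])⟩
  rw [LinearMap.smul_apply]
  refine Supp.smul ?_ c
  by_cases h0 : (f s l * fd t (l - k)) v = 0
  · rw [h0]; exact ⟨fun _ _ _ => map_zero _, fun _ _ _ => map_zero _⟩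
  obtain ⟨h1, h2⟩ := hne h0
  refine ⟨fun s' i hi => ?_, fun s' i hi => ?_⟩
  · rw [← Module.End.mul_apply, ← mul_assoc, ha.ff, neg_mul, mul_assoc,
      ha.anti s' i t (l - k) (by omega)]
    simp [h.1 s' i (by omega)]
  · rw [← Module.End.mul_apply, ← mul_assoc,
      show fd s' i * f s l = -(f s l * fd s' i) by rw [ha.anti s l s' i (by omega), neg_neg],
      neg_mul, mul_assoc, ha.dd]
    simp [h.2 s' i (by omega)]

theorem IsAnti.flow_word (ha : IsAnti f fd) {ι : Type} {X : ι → Module.End ℂ M} {k : ι → ℕ}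
    {l : ι → ℤ} (hk : ∀ x, 0 < k x)
    (hX : ∀ x, ∃ (c : ℂ) (s t : σ), X x = c • (f s (l x) * fd t (l x - k x)))
    {N : ℤ} {v : M} (h : Supp f fd N v) (w : List ι) :
    Supp f fd (N + (w.map k).sum) ((w.map X).prod v) ∧
      ((w.map X).prod v ≠ 0 → ∀ x ∈ w, |l x| ≤ N + (w.map k).sum) := by
  induction w with
  | nil => simpa using h
  | cons x w ih =>
    obtain ⟨c, s, t, hx⟩ := hX x
    have hflow := ha.flow_apply (l := l x) (k := k x) (by exact_mod_cast hk x) ih.1 s t c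
    rw [← hx] at hflow
    rw [List.map_cons, List.map_cons, List.prod_cons, List.sum_cons, Module.End.mul_apply]
    rw [Nat.cast_add]
    refine ⟨?_, fun h0 y hy => ?_⟩
    · rw [add_comm (k x : ℤ), ← add_assoc]
      exact hflow.1
    · have h1 := hflow.2 h0
      have hk' := hk x
      rw [List.mem_cons] at hy
      rcases hy with rfl | hy
      · rw [abs_le]; omega
      · have := ih.2 (fun h => h0 (by rw [h, map_zero])) y hy
        omega

/-- The interaction contains no f†, so f_p can be pulled out of its letter and moved right to v,
which it kills if p < -N. -/
theorem interaction_word {κ : Type} {X : κ → Module.End ℂ M} {pos : κ → List ℤ}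
    (hX : ∀ x, ∀ p ∈ pos x, ∃ (s : σ) (Z : Module.End ℂ M), X x = Z * f s p)
    (hc : ∀ x s i, Commute (f s i) (X x)) {N : ℤ} {v : M} (h : ∀ s i, i < -N → f s i v = 0)
    {w : List κ}
    (h0 : (w.map X).prod v ≠ 0) {x : κ} (hx : x ∈ w) {p : ℤ} (hp : p ∈ pos x) : -N ≤ p := by
  by_contra hlt
  apply h0
  obtain ⟨u, w', rfl⟩ := List.append_of_mem hx
  obtain ⟨s, Z, hZ⟩ := hX x p hp
  have hcomm : Commute (f s p) (w'.map X).prod := by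
    refine Commute.list_prod_right _ _ fun y hy => ?_
    obtain ⟨y, _, rfl⟩ := List.mem_map.1 hy
    exact hc y s p
  rw [List.map_append, List.prod_append, List.map_cons, List.prod_cons, hZ, mul_assoc Z, hcomm.eq]
  simp [h s p (by omega)]

end Supp

/-! ### Finiteness of the coefficients -/

section Finiteness

variable {σ : Type} [DecidableEq σ] {f fd : σ → ℤ → Op}

theorem IsFermi.isAnti (h : IsFermi f fd) : IsAnti f fd := by
  refine ⟨h.ff', h.dd', fun s i t j hij => ?_⟩
  have := h.anti s i t j
  rw [if_neg fun h => hij h.2] at this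
  exact eq_neg_of_add_eq_zero_left this

/-- The transpose of the family `f s i`, with reflected indices. -/
def transposed (f : σ → ℤ → Op) (s : σ) (i : ℤ) : Module.End ℂ (Module.Dual ℂ Fock) :=
  (f s (-1 - i)).dualMap

theorem dualMap_mul (X Y : Op) :
    (X * Y).dualMap = (Y.dualMap * X.dualMap : Module.End ℂ (Module.Dual ℂ Fock)) := rfl

theorem dualMap_neg (X : Op) :
    (-X).dualMap = (-X.dualMap : Module.End ℂ (Module.Dual ℂ Fock)) := by
  ext; simp

theorem dualMap_smul (c : ℂ) (X : Op) :
    (c • X).dualMap = (c • X.dualMap : Module.End ℂ (Module.Dual ℂ Fock)) := by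
  ext; simp

theorem dualMap_list_prod (w : List Op) :
    w.prod.dualMap = ((w.reverse.map fun X => X.dualMap).prod :
      Module.End ℂ (Module.Dual ℂ Fock)) := by
  induction w with
  | nil => rfl
  | cons X w ih =>
    rw [List.prod_cons, dualMap_mul, ih, List.reverse_cons, List.map_append, List.prod_append]
    simp

/-- With the reflected indices, ⟨0| f_i = 0 for i ≥ 0 takes the form of the condition f_i|0⟩ = 0 for
i < 0. All support estimates for vectors thus apply to functionals. -/
theorem IsFermi.isAnti_transposed (h : IsFermi f fd) :
    IsAnti (transposed f) (transposed fd) := by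
  have ha := h.isAnti
  refine ⟨fun s i t j => ?_, fun s i t j => ?_, fun s i t j hij => ?_⟩ <;>
    simp only [transposed, ← dualMap_mul, ← dualMap_neg]
  · rw [ha.ff]
  · rw [ha.dd]
  · rw [ha.anti s (-1 - i) t (-1 - j) (by omega), neg_neg]

/-- A family `E` of terms `c t_k f s l f† t (l + ε k)`, where `k = k x` and `l = l x`. -/
structure IsFlow (f fd : σ → ℤ → Op) (g : ℕ+ → ℕ+ ⊕ ℕ+) (ε : ℤ) {ι : Type}
    (E : ι → TimeSeries × Op) (k : ι → ℕ+) (l : ι → ℤ) : Prop where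
  series : ∀ x, ∃ c, (E x).1 = MvPowerSeries.monomial (Finsupp.single (g (k x)) 1) c
  op : ∀ x, ∃ (c : ℂ) (s t : σ), (E x).2 = c • (f s (l x) * fd t (l x + ε * (k x : ℕ)))
  finite : ∀ N : ℕ, {x | (k x : ℕ) ≤ N ∧ |l x| ≤ N}.Finite

/-- A family `H` of terms, each divisible by the `f s p` with `p` in a list of positions. -/
structure IsInteraction (f : σ → ℤ → Op) {κ : Type} (H : κ → TimeSeries × Op)
    (pos : κ → List ℤ) : Prop where
  series : ∀ x, ∃ c, (H x).1 = MvPowerSeries.monomial 0 c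
  right : ∀ x, ∀ p ∈ pos x, ∃ (s : σ) (Z : Op), (H x).2 = Z * f s p
  left : ∀ x, ∀ p ∈ pos x, ∃ (s : σ) (Z : Op), (H x).2 = f s p * Z
  comm : ∀ x s i, Commute (f s i) (H x).2
  swap : ∀ x y, (H x).2 * (H y).2 = (H y).2 * (H x).2 ∨ (H x).2 * (H y).2 = -((H y).2 * (H x).2)
  sq : ∀ x, (H x).2 * (H x).2 = 0
  finite : ∀ N : ℕ, {x | ∀ p ∈ pos x, |p| ≤ N}.Finite

theorem list_prod_fst_snd {ι : Type} (E : ι → TimeSeries × Op) (w : List ι) :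
    (w.map E).prod = ((w.map fun x => (E x).1).prod, (w.map fun x => (E x).2).prod) := by
  induction w with
  | nil => rfl
  | cons x w ih => simp only [List.map_cons, List.prod_cons, ih]; rfl

theorem exists_monomial_prod {ι : Type} (F : ι → TimeSeries) (e : ι → (ℕ+ ⊕ ℕ+) →₀ ℕ)
    (h : ∀ x, ∃ c, F x = MvPowerSeries.monomial (e x) c) (w : List ι) :
    ∃ c, (w.map F).prod = MvPowerSeries.monomial (w.map e).sum c := by
  induction w with
  | nil => exact ⟨1, by simp⟩
  | cons x w ih =>
    obtain ⟨c, hc⟩ := ih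
    obtain ⟨c', hc'⟩ := h x
    exact ⟨c' * c, by
      rw [List.map_cons, List.map_cons, List.prod_cons, List.sum_cons, hc, hc',
        MvPowerSeries.monomial_mul_monomial]⟩

/-- The weight of a monomial, where `t_k` and `t̄_k` have weight `k`. -/
def weight : ((ℕ+ ⊕ ℕ+) →₀ ℕ) →+ ℕ :=
  (Finsupp.weight (Sum.elim (fun k : ℕ+ => (k : ℕ)) fun k : ℕ+ => (k : ℕ)))

theorem weight_list_sum {ι : Type} (g : ℕ+ → ℕ+ ⊕ ℕ+) (hg : g = Sum.inl ∨ g = Sum.inr)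
    (k : ι → ℕ+) (w : List ι) :
    weight (w.map fun x => Finsupp.single (g (k x)) 1).sum = (w.map fun x => (k x : ℕ)).sum := by
  induction w with
  | nil => simp
  | cons x w ih =>
    rw [List.map_cons, List.sum_cons, map_add, ih, List.map_cons, List.sum_cons]
    congr 1
    rcases hg with rfl | rfl <;> simp [weight, Finsupp.weight_single]

theorem length_le_sum_map {ι : Type} (k : ι → ℕ+) (w : List ι) :
    w.length ≤ (w.map fun x => (k x : ℕ)).sum := by
  induction w with
  | nil => simp
  | cons x w ih =>
    have := (k x).pos
    simp only [List.length_cons, List.map_cons, List.sum_cons]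
    omega

/-- The functional `⟨0| L`. -/
def bra (L : Op) : Module.Dual ℂ Fock :=
  (ExteriorAlgebra.algebraMapInv (R := ℂ) (M := Mode →₀ ℂ)).toLinearMap ∘ₗ L

theorem vev_mul_mul (L X R : Op) : vev (L * X * R) = bra L (X (R 1)) := rfl

theorem bra_mul (L X : Op) : bra (L * X) = X.dualMap (bra L) := rfl

variable {ι κ ι' : Type} {L R : Op} {E : ι → TimeSeries × Op} {H : κ → TimeSeries × Op}
  {E' : ι' → TimeSeries × Op} {k : ι → ℕ+} {l : ι → ℤ} {k' : ι' → ℕ+} {l' : ι' → ℤ}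
  {pos : κ → List ℤ}

theorem bra_flow_word (hf : IsFermi f fd) (hE : IsFlow f fd Sum.inl 1 E k l)
    {N : ℤ} (hL : Supp (transposed f) (transposed fd) N (bra L)) (w : List ι) :
    Supp (transposed f) (transposed fd) (N + (w.map fun x => (k x : ℕ)).sum)
        (bra (L * (w.map fun x => (E x).2).prod)) ∧
      (bra (L * (w.map fun x => (E x).2).prod) ≠ 0 → ∀ x ∈ w,
        |l x| ≤ N + (w.map fun x => (k x : ℕ)).sum + 1) := by
  have h1 : (w.map fun x => (E x).2).prod.dualMap
      = ((w.reverse.map fun x => (E x).2.dualMap).prod :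
        Module.End ℂ (Module.Dual ℂ Fock)) := by
    rw [dualMap_list_prod, ← List.map_reverse, List.map_map]
    rfl
  have h2 := hf.isAnti_transposed.flow_word (X := fun x => (E x).2.dualMap)
    (k := fun x => (k x : ℕ)) (l := fun x => -1 - l x) (fun x => (k x).pos)
    (fun x => by
      obtain ⟨c, s, t, h⟩ := hE.op x
      -- Transposition reverses the product; restoring the order of f and f† costs the sign. The
      -- reflection l to -1-l also explains the extra 1 in the bound.
      refine ⟨-c, s, t, ?_⟩
      have hk := (k x).pos
      rw [h, hf.isAnti.anti s (l x) t _ (by omega), smul_neg, ← neg_smul, dualMap_smul]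
      congr 1
      rw [dualMap_mul, transposed, transposed]
      congr 3 <;> ring) hL w.reverse
  rw [← h1, List.map_reverse, List.sum_reverse, ← bra_mul] at h2
  refine ⟨h2.1, fun h0 x hx => ?_⟩
  have := h2.2 h0 x (by simpa using hx)
  rw [abs_le] at this ⊢
  omega

theorem ket_flow_word (hf : IsFermi f fd) (hE' : IsFlow f fd Sum.inr (-1) E' k' l')
    {N : ℤ} {v : Fock} (hR : Supp f fd N v) (w : List ι') :
    Supp f fd (N + (w.map fun x => (k' x : ℕ)).sum) ((w.map fun x => (E' x).2).prod v) ∧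
      ((w.map fun x => (E' x).2).prod v ≠ 0 → ∀ x ∈ w,
        |l' x| ≤ N + (w.map fun x => (k' x : ℕ)).sum) :=
  hf.isAnti.flow_word (X := fun x => (E' x).2) (k := fun x => (k' x : ℕ)) (fun x => (k' x).pos)
    (fun x => by
      obtain ⟨c, s, t, h⟩ := hE'.op x
      exact ⟨c, s, t, by rw [h]; congr 3; ring⟩) hR w

theorem interaction_pos_le (hH : IsInteraction f H pos) {N : ℤ}
    (hL : Supp (transposed f) (transposed fd) N (bra L)) {w : List κ}
    (h0 : bra (L * (w.map fun x => (H x).2).prod) ≠ 0) {x : κ} (hx : x ∈ w) {p : ℤ}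
    (hp : p ∈ pos x) : p < N := by
  have h1 : (w.map fun x => (H x).2).prod.dualMap
      = ((w.reverse.map fun x => (H x).2.dualMap).prod :
        Module.End ℂ (Module.Dual ℂ Fock)) := by
    rw [dualMap_list_prod, ← List.map_reverse, List.map_map]
    rfl
  rw [bra_mul, h1] at h0
  have := interaction_word (f := transposed f) (X := fun x => (H x).2.dualMap)
    (pos := fun x => (pos x).map fun p => -1 - p) (fun x q hq => by
      obtain ⟨p, hp, rfl⟩ := List.mem_map.1 hq
      obtain ⟨s, Z, h⟩ := hH.left x p hp
      exact ⟨s, Z.dualMap, by rw [h, dualMap_mul, transposed, sub_sub_cancel]⟩)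
    (fun x s i => by
      have := hH.comm x s (-1 - i)
      simp only [transposed, Commute, SemiconjBy, ← dualMap_mul]
      rw [this.eq]) hL.1 h0 (x := x) (by simpa using hx) (p := -1 - p)
    (List.mem_map.2 ⟨p, hp, rfl⟩)
  omega

/-- Each flow letter contributes one time of its own weight and the interaction contributes none, so
the monomial fixes the total weight of the flow words. -/
theorem coeff_ne_zero_weight (hE : IsFlow f fd Sum.inl 1 E k l) (hH : IsInteraction f H pos)
    (hE' : IsFlow f fd Sum.inr (-1) E' k' l') {d : (ℕ+ ⊕ ℕ+) →₀ ℕ} {u : List ι} {h : List κ}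
    {v : List ι'} (h0 : MvPowerSeries.coeff d ((u.map fun x => (E x).1).prod
      * (h.map fun x => (H x).1).prod * (v.map fun x => (E' x).1).prod) ≠ 0) :
    (u.map fun x => (k x : ℕ)).sum + (v.map fun x => (k' x : ℕ)).sum = weight d := by
  obtain ⟨c₁, h₁⟩ := exists_monomial_prod _ _ hE.series u
  obtain ⟨c₂, h₂⟩ := exists_monomial_prod _ (fun _ => 0) hH.series h
  obtain ⟨c₃, h₃⟩ := exists_monomial_prod _ _ hE'.series v
  classical
  rw [h₁, h₂, h₃, MvPowerSeries.monomial_mul_monomial, MvPowerSeries.monomial_mul_monomial,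
    MvPowerSeries.coeff_monomial] at h0
  have hd := (ite_ne_right_iff.1 h0).1
  have h4 : (h.map fun _ : κ => (0 : (ℕ+ ⊕ ℕ+) →₀ ℕ)).sum = 0 := by
    simp
  rw [hd, h4, add_zero, map_add, weight_list_sum _ (Or.inl rfl), weight_list_sum _ (Or.inr rfl)]

/-- The weight bounds the length and the positions of the flow words, and the supports of the bra
and the ket after the flows. The ket bounds the modes of the interaction from below, the bra from
above; finitely many letters without repetition form finitely many words. -/
theorem expVevFinite_of_isFermi (hf : IsFermi f fd) (hE : IsFlow f fd Sum.inl 1 E k l)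
    (hH : IsInteraction f H pos) (hE' : IsFlow f fd Sum.inr (-1) E' k' l')
    (hL : ∃ N, Supp (transposed f) (transposed fd) N (bra L)) (hR : ∃ N, Supp f fd N (R 1)) :
    ExpVevFinite L E H E' R := by
  intro d
  obtain ⟨N₁, hL⟩ := hL
  obtain ⟨N₂, hR⟩ := hR
  -- A common bound for all positions and weights; the final 1 absorbs the reflection on the bra
  -- side.
  obtain ⟨N, hN⟩ : ∃ N : ℕ, N = N₁.natAbs + N₂.natAbs + weight d + 1 := ⟨_, rfl⟩
  have fE := hE.finite N
  have fH := hH.finite N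
  have fE' := hE'.finite N
  refine Set.Finite.subset ((wordsLT fE.toFinset (N + 1) ×ˢ
    (wordsLT fH.toFinset (fH.toFinset.card + 1) ×ˢ wordsLT fE'.toFinset (N + 1))).finite_toSet) ?_
  rintro ⟨u, h, v⟩ hw
  rw [Function.mem_support, expTerm] at hw
  simp only [list_prod_fst_snd, Prod.mk_mul_mk] at hw
  have hw1 := right_ne_zero_of_mul hw
  have hwt := coeff_ne_zero_weight hE hH hE' (left_ne_zero_of_mul hw1)
  have hvev := right_ne_zero_of_mul hw1
  rw [vev_mul_mul, Module.End.mul_apply, Module.End.mul_apply] at hvev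
  have hU := bra_flow_word hf hE hL u
  have hV := ket_flow_word hf hE' hR v
  have hv0 : (v.map fun x => (E' x).2).prod (R 1) ≠ 0 := fun h0 => hvev (by
    rw [h0, map_zero, map_zero, map_zero])
  have hu0 : bra (L * (u.map fun x => (E x).2).prod) ≠ 0 := fun h0 => hvev (by
    have := LinearMap.congr_fun h0 ((h.map fun x => (H x).2).prod
      ((v.map fun x => (E' x).2).prod (R 1)))
    exact this)
  have hk0 : (h.map fun x => (H x).2).prod ((v.map fun x => (E' x).2).prod (R 1)) ≠ 0 :=
    fun h0 => hvev (by rw [h0, map_zero, map_zero])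
  have hb0 : bra (L * (u.map fun x => (E x).2).prod * (h.map fun x => (H x).2).prod) ≠ 0 :=
    fun h0 => hvev (by
      have := LinearMap.congr_fun h0 ((v.map fun x => (E' x).2).prod (R 1))
      exact this)
  have hlu := length_le_sum_map k u
  have hlv := length_le_sum_map k' v
  simp only [Finset.coe_product, Set.mem_prod, Finset.mem_coe, mem_wordsLT,
    Set.Finite.mem_toFinset, Set.mem_ofPred_eq]
  have hnodup : h.Nodup := by
    by_contra hnd
    rw [prod_map_eq_zero_of_not_nodup hH.swap hH.sq hnd] at hk0
    exact hk0 rfl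
  have hh : ∀ x ∈ h, ∀ p ∈ pos x, |p| ≤ N := by
    intro x hx p hp
    have h1 := interaction_word hH.right hH.comm hV.1.1 hk0 hx hp
    have h2 := interaction_pos_le hH hU.1 hb0 hx hp
    rw [abs_le]
    omega
  refine ⟨⟨by omega, fun x hx => ⟨?_, ?_⟩⟩, ⟨?_, hh⟩, ⟨by omega, fun x hx => ⟨?_, ?_⟩⟩⟩
  · have := List.single_le_sum (l := u.map fun x => (k x : ℕ)) (by simp) (k x)
      (List.mem_map.2 ⟨x, hx, rfl⟩)
    omega
  · have := hU.2 hu0 x hx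
    omega
  · classical
    rw [← List.toFinset_card_of_nodup hnodup, Nat.lt_succ_iff]
    refine Finset.card_le_card fun x hx => ?_
    rw [Set.Finite.mem_toFinset]
    exact hh x (List.mem_toFinset.1 hx)
  · have := List.single_le_sum (l := v.map fun x => (k' x : ℕ)) (by simp) (k' x)
      (List.mem_map.2 ⟨x, hx, rfl⟩)
    omega
  · have := hV.2 hv0 x hx
    omega

end Finiteness

/-! ### The families of type B and of the Toda lattice -/

section Locality

variable {σ : Type} [DecidableEq σ] {f fd : σ → ℤ → Op}

/-- The operators that preserve the vectors and the functionals of bounded support. -/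
def localOps (f fd : σ → ℤ → Op) : Submonoid Op where
  carrier := {X | (∀ v, (∃ N, Supp f fd N v) → ∃ N, Supp f fd N (X v)) ∧
    ∀ L, (∃ N, Supp (transposed f) (transposed fd) N (bra L)) →
      ∃ N, Supp (transposed f) (transposed fd) N (bra (L * X))}
  one_mem' := ⟨fun v h => h, fun L h => by rwa [mul_one]⟩
  mul_mem' := fun {X Y} hX hY => ⟨fun v h => hX.1 _ (hY.1 v h), fun L h => by
    rw [← mul_assoc]; exact hY.2 _ (hX.2 L h)⟩

theorem smul_mem_localOps {X : Op} (h : X ∈ localOps f fd) (c : ℂ) : c • X ∈ localOps f fd := by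
  refine ⟨fun v hv => ?_, fun L hL => ?_⟩
  · obtain ⟨N, hN⟩ := h.1 v hv
    exact ⟨N, hN.smul c⟩
  · obtain ⟨N, hN⟩ := h.2 L hL
    refine ⟨N, ?_⟩
    rw [mul_smul_comm]
    have : bra (c • (L * X)) = c • bra (L * X) := by
      rw [bra, LinearMap.comp_smul]; rfl
    rw [this]
    exact hN.smul c

theorem IsFermi.f_mem_localOps (h : IsFermi f fd) (s : σ) (i : ℤ) : f s i ∈ localOps f fd := by
  refine ⟨fun v hv => h.isAnti.exists_supp_f hv s i, fun L hL => ?_⟩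
  have := h.isAnti_transposed.exists_supp_f hL s (-1 - i)
  rwa [transposed, sub_sub_cancel] at this

theorem IsFermi.d_mem_localOps (h : IsFermi f fd) (s : σ) (i : ℤ) : fd s i ∈ localOps f fd := by
  refine ⟨fun v hv => h.isAnti.exists_supp_d hv s i, fun L hL => ?_⟩
  have := h.isAnti_transposed.exists_supp_d hL s (-1 - i)
  rwa [transposed, sub_sub_cancel] at this

theorem IsFermi.f_mul_phi (h : IsFermi f fd) (s : σ) (i : ℤ) :
    f s i * phi = -(phi * f s i) :=
  eq_neg_of_add_eq_zero_left (by rw [add_comm, h.phi_f])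

theorem IsFermi.d_mul_phi (h : IsFermi f fd) (s : σ) (i : ℤ) :
    fd s i * phi = -(phi * fd s i) :=
  eq_neg_of_add_eq_zero_left (by rw [add_comm, h.phi_d])

theorem IsFermi.phi_mem_localOps (h : IsFermi f fd) : phi ∈ localOps f fd := by
  refine ⟨fun v ⟨N, hv⟩ => ⟨N, hv.apply_of_anti (fun s i _ => h.f_mul_phi s i)
    fun s i _ => h.d_mul_phi s i⟩, fun L ⟨N, hL⟩ => ⟨N, ?_⟩⟩
  rw [bra_mul]
  refine Supp.apply_of_anti (X := phi.dualMap) hL (fun s i _ => ?_) fun s i _ => ?_ <;>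
    rw [transposed, ← dualMap_mul, ← dualMap_mul, ← dualMap_neg]
  · rw [h.f_mul_phi, neg_neg]
  · rw [h.d_mul_phi, neg_neg]

theorem IsFermi.exists_supp_ket (h : IsFermi f fd) {X : Op} (hX : X ∈ localOps f fd) :
    ∃ N, Supp f fd N (X 1) :=
  hX.1 1 ⟨0, fun s i hi => h.f_one s i (by simpa using hi), fun s i hi => h.d_one s i hi⟩

theorem IsFermi.exists_supp_bra (h : IsFermi f fd) {X : Op} (hX : X ∈ localOps f fd) :
    ∃ N, Supp (transposed f) (transposed fd) N (bra X) := by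
  have := hX.2 1 ⟨0, fun s i hi => ?_, fun s i hi => ?_⟩
  · rwa [one_mul] at this
  · exact LinearMap.ext fun v => h.vac_f s _ (by omega) v
  · exact LinearMap.ext fun v => h.vac_d s _ (by omega) v

theorem chargeKet_mem {S : Submonoid Op} {g gd : ℤ → Op} (h : ∀ i, g i ∈ S) (hd : ∀ i, gd i ∈ S)
    (n : ℤ) : chargeKet g gd n ∈ S := by
  rcases n with n | n <;> refine S.list_prod_mem fun X hX => ?_ <;>
    obtain ⟨k, _, rfl⟩ := List.mem_map.1 hX
  · exact h _
  · exact hd _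

theorem chargeBra_mem {S : Submonoid Op} {g gd : ℤ → Op} (h : ∀ i, g i ∈ S) (hd : ∀ i, gd i ∈ S)
    (n : ℤ) : chargeBra g gd n ∈ S := by
  rcases n with n | n <;> refine S.list_prod_mem fun X hX => ?_ <;>
    obtain ⟨k, _, rfl⟩ := List.mem_map.1 hX
  · exact hd _
  · exact h _

theorem ketB_mem (m : ℤ) :
    ketB m ∈ localOps (fun _ : Unit => psiB) fun _ : Unit => psiBDag := by
  have h := isFermi_psiB
  have h1 := chargeKet_mem (h.f_mem_localOps ()) (h.d_mem_localOps ()) m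
  rw [ketB]
  split_ifs
  · exact h1
  · exact smul_mem_localOps (mul_mem h1 h.phi_mem_localOps) _

theorem braB_mem (m : ℤ) :
    braB m ∈ localOps (fun _ : Unit => psiB) fun _ : Unit => psiBDag := by
  have h := isFermi_psiB
  have h1 := chargeBra_mem (h.f_mem_localOps ()) (h.d_mem_localOps ()) m
  rw [braB]
  split_ifs
  · exact h1
  · exact smul_mem_localOps (mul_mem h.phi_mem_localOps h1) _

theorem psi_zero_eq (i : ℤ) : psi 0 i = fT false i := rfl

theorem psiDag_zero_eq (i : ℤ) : psiDag 0 i = fdT false i := rfl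

theorem psi_one_eq (i : ℤ) : psi 1 i = fdT true (-1 - i) := by simp [fdT]

theorem psiDag_one_eq (i : ℤ) : psiDag 1 i = fT true (-1 - i) := by simp [fT]

theorem ketTL_mem (m₁ m₂ : ℤ) : ketTL m₁ m₂ ∈ localOps fT fdT := by
  have h := isFermi_fT
  refine mul_mem (chargeKet_mem (fun i => ?_) (fun i => ?_) m₂)
    (chargeKet_mem (h.f_mem_localOps false) (h.d_mem_localOps false) m₁)
  · rw [psi_one_eq]; exact h.d_mem_localOps _ _
  · rw [psiDag_one_eq]; exact h.f_mem_localOps _ _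

theorem braTL_mem (m₁ m₂ : ℤ) : braTL m₁ m₂ ∈ localOps fT fdT := by
  have h := isFermi_fT
  refine mul_mem (chargeBra_mem (h.f_mem_localOps false) (h.d_mem_localOps false) m₁)
    (chargeBra_mem (fun i => ?_) (fun i => ?_) m₂)
  · rw [psi_one_eq]; exact h.d_mem_localOps _ _
  · rw [psiDag_one_eq]; exact h.f_mem_localOps _ _

/-! ### The vacua are killed by the low modes -/

theorem IsFermi.sq_eq_zero (h : IsFermi f fd) (s : σ) (i : ℤ) : f s i * f s i = 0 :=
  self_mul_self_eq_zero (eq_neg_of_add_eq_zero_left (h.ff s i s i))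

/-- For m ≥ 0 either f_i already occurs in Ψ_m, and f_i² = 0, or i < 0 and f_i reaches v. For m < 0
the operators f†_m, …, f†_{-1} all anticommute with f_i, as i < m. -/
theorem IsFermi.apply_chargeKet (h : IsFermi f fd) (s : σ) {v : Fock}
    (hv : ∀ i, i < 0 → f s i v = 0) (m : ℤ) {i : ℤ} (hi : i < m) :
    f s i (chargeKet (f s) (fd s) m v) = 0 := by
  obtain ⟨n, rfl | rfl⟩ := m.eq_nat_or_neg
  · rw [chargeKet_natCast]
    induction n with
    | zero => exact hv i hi
    | succ n ih =>
      rw [descProd_succ, Module.End.mul_apply, ← Module.End.mul_apply]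
      by_cases hin : i = n
      · rw [hin, h.sq_eq_zero, LinearMap.zero_apply]
      · rw [h.isAnti.ff, LinearMap.neg_apply, Module.End.mul_apply,
          ih (by push_cast at hi; omega), map_zero, neg_zero]
  · rw [chargeKet_neg_natCast]
    induction n with
    | zero => exact hv i (by simpa using hi)
    | succ n ih =>
      push_cast at hi
      rw [descProd_succ, Module.End.mul_apply, ← Module.End.mul_apply,
        h.isAnti.anti _ _ _ _ (by omega), LinearMap.neg_apply, Module.End.mul_apply,
        ih (by omega), map_zero, neg_zero]

theorem IsFermi.apply_chargeKet_ne (h : IsFermi f fd) {s t : σ} (hst : s ≠ t) {v : Fock} {i : ℤ}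
    (hv : f s i v = 0) (m : ℤ) : f s i (chargeKet (f t) (fd t) m v) = 0 := by
  have key : ∀ w : List Op, (∀ X ∈ w, f s i * X = -(X * f s i)) → f s i (w.prod v) = 0 := by
    intro w hw
    induction w with
    | nil => exact hv
    | cons X w ih =>
      rw [List.prod_cons, Module.End.mul_apply, ← Module.End.mul_apply, hw X (by simp),
        LinearMap.neg_apply, Module.End.mul_apply, ih fun Y hY => hw Y (by simp [hY]), map_zero,
        neg_zero]
  rcases m with n | n <;> refine key _ fun X hX => ?_ <;>
    obtain ⟨k, _, rfl⟩ := List.mem_map.1 hX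
  · exact h.isAnti.ff _ _ _ _
  · have := h.anti s i t (-1 - k)
    rw [if_neg fun h => hst h.1] at this
    exact eq_neg_of_add_eq_zero_left this

theorem psiB_ketB {m i : ℤ} (hi : i < m) : psiB i (ketB m 1) = 0 := by
  have h := isFermi_psiB
  have h1 := fun v hv => h.apply_chargeKet () (v := v) hv m hi
  rw [ketB]
  split_ifs
  · exact h1 1 (h.f_one ())
  · rw [LinearMap.smul_apply, map_smul, Module.End.mul_apply, h1 (phi 1) fun j hj => ?_, smul_zero]
    have h2 := LinearMap.congr_fun (h.f_mul_phi () j) 1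
    rw [LinearMap.neg_apply, Module.End.mul_apply, Module.End.mul_apply, h.f_one () j hj,
      map_zero, neg_zero] at h2
    exact h2

/-- The factorized vacuum is killed by both ψ_i and ψ̂_i, hence by their combinations. -/
theorem fT_ketTL {m i : ℤ} (hi : i < m) (s : Bool) : fT s i (ketTL m (-m) 1) = 0 := by
  have h := isFermi_fR
  have hR : ∀ s, fR s i (ketTL m (-m) 1) = 0 := by
    intro s
    rw [ketTL_eq, LinearMap.smul_apply, map_smul, Module.End.mul_apply]
    cases s
    · rw [h.apply_chargeKet false (fun j hj => ?_) m hi, smul_zero]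
      exact h.apply_chargeKet_ne (by simp) (h.f_one _ _ hj) m
    · rw [h.apply_chargeKet_ne (by simp) (h.apply_chargeKet true (h.f_one true) m hi) m, smul_zero]
  cases s
  · rw [fT_false]; simp [hR]
  · rw [fT_true]; simp [hR]

end Locality

/-! ### Flows and interactions in the fermions `psiB` and `fT`. -/

section Families

theorem vev_mul_eq_zero {σ : Type} [DecidableEq σ] {f fd : σ → ℤ → Op} (h : IsFermi f fd)
    (s t : σ) {i j : ℤ} (hij : i ≠ j) : vev (f s i * fd t j) = 0 := by
  by_cases hi : 0 ≤ i
  · exact h.vac_f s i hi _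
  · rw [h.isAnti.anti s i t j hij, vev, LinearMap.neg_apply, Module.End.mul_apply,
      h.f_one s i (by omega)]
    simp

theorem vev_mul_eq_zero' {σ : Type} [DecidableEq σ] {f fd : σ → ℤ → Op} (h : IsFermi f fd)
    (s t : σ) {i j : ℤ} (hij : i ≠ j) : vev (fd t j * f s i) = 0 := by
  have h1 := vev_mul_eq_zero h s t hij
  rw [h.isAnti.anti s i t j hij, vev, LinearMap.neg_apply, map_neg, neg_eq_zero] at h1
  exact h1

/-- Normal ordering subtracts nothing, since the two indices differ by εk ≠ 0. -/
theorem flowB_apply {ε : ℤ} (hε : ε ≠ 0) (s : ℕ+ → TimeSeries) (k : ℕ+) (l : ℤ) :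
    flowB ε s (k, l) = (s k, psiB l * psiBDag (l + ε * (k : ℕ))) := by
  have hk : l ≠ l + ε * (k : ℕ) := by
    have := mul_ne_zero hε (Nat.cast_ne_zero (R := ℤ).2 k.ne_zero)
    omega
  rw [flowB, normalOrder, vev_mul_eq_zero isFermi_psiB () () hk, zero_smul, sub_zero]

/-- The position of the letter `(a, k, i)` in terms of the families `fT` and `fdT`. -/
def flowEquiv (ε : ℤ) : Bool × ℕ+ × ℤ ≃ Fin 2 × ℕ+ × ℤ where
  toFun x := if x.1 then (1, x.2.1, -1 - x.2.2 - ε * (x.2.1 : ℕ)) else (0, x.2.1, x.2.2)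
  invFun x := if x.1 = 0 then (false, x.2.1, x.2.2)
    else (true, x.2.1, -1 - x.2.2 - ε * (x.2.1 : ℕ))
  left_inv := by
    rintro ⟨a, k, i⟩
    cases a
    · simp
    · simp only [reduceIte, one_ne_zero, Prod.mk.injEq, true_and]
      ring
  right_inv := by
    rintro ⟨a, k, i⟩
    fin_cases a
    · simp
    · simp only [Fin.mk_one, one_ne_zero, reduceIte, Prod.mk.injEq, true_and]
      ring

/-- In the second component, reordering ψψ† after the exchange of particles and holes gives a sign.
The choice t⁽²⁾ = -t⁽¹⁾ cancels it. -/
theorem flowTL_apply {ε : ℤ} (hε : ε ≠ 0) (s : ℕ+ → TimeSeries) (b : Bool) (k : ℕ+) (j : ℤ) :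
    flowTL ε ![s, -s] (flowEquiv ε (b, k, j))
      = (if b then -s k else s k, (if b then -1 else 1 : ℂ) •
          (fT b j * fdT b (j + ε * (k : ℕ)))) := by
  have hk : j ≠ j + ε * (k : ℕ) := by
    have := mul_ne_zero hε (Nat.cast_ne_zero (R := ℤ).2 k.ne_zero)
    omega
  cases b
  · simp [flowTL, flowEquiv, normalOrder, psi_zero_eq, psiDag_zero_eq,
      vev_mul_eq_zero isFermi_fT false false hk]
  · have h1 : psi 1 (-1 - j - ε * (k : ℕ)) = fdT true (j + ε * (k : ℕ)) := by
      rw [psi_one_eq]; congr 1; ring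
    have h2 : psiDag 1 (-1 - j) = fT true j := by
      rw [psiDag_one_eq]; congr 1; ring
    simp [flowTL, flowEquiv, normalOrder, h1, h2, vev_mul_eq_zero' isFermi_fT true true hk,
      isFermi_fT.isAnti.anti true j true _ hk]

/-- The letters of a flow of index at most `N`. -/
def flowSet (N : ℕ) : Finset (ℕ+ × ℤ) :=
  Finset.Icc 1 N.succPNat ×ˢ Finset.Icc (-N : ℤ) N

theorem mem_flowSet {N : ℕ} {k : ℕ+} {l : ℤ} :
    (k, l) ∈ flowSet N ↔ (k : ℕ) ≤ N + 1 ∧ |l| ≤ N := by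
  simp only [flowSet, Finset.mem_product, Finset.mem_Icc, one_le, true_and, abs_le]
  rw [← PNat.coe_le_coe, Nat.succPNat_coe]

theorem isFlow_flowB {ε : ℤ} (hε : ε ≠ 0) (g : ℕ+ → ℕ+ ⊕ ℕ+) (s : ℕ+ → TimeSeries)
    (hs : ∀ k, ∃ c, s k = MvPowerSeries.monomial (Finsupp.single (g k) 1) c) :
    IsFlow (fun _ : Unit => psiB) (fun _ : Unit => psiBDag) g ε (flowB ε s) (fun x => x.1)
      fun x => x.2 := by
  refine ⟨fun x => hs x.1, fun x => ⟨1, (), (), ?_⟩, fun N => ?_⟩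
  · rw [← Prod.mk.eta (p := x), flowB_apply hε, one_smul]
  · refine (flowSet N).finite_toSet.subset ?_
    rintro ⟨k, l⟩ ⟨h1, h2⟩
    exact mem_flowSet.2 ⟨by simp at h1; omega, h2⟩

theorem isFlow_flowTL {ε : ℤ} (hε : ε ≠ 0) (g : ℕ+ → ℕ+ ⊕ ℕ+) (s : ℕ+ → TimeSeries)
    (hs : ∀ k, ∃ c, s k = MvPowerSeries.monomial (Finsupp.single (g k) 1) c) :
    IsFlow fT fdT g ε (flowTL ε ![s, -s]) (fun x => ((flowEquiv ε).symm x).2.1)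
      fun x => ((flowEquiv ε).symm x).2.2 := by
  refine ⟨fun x => ?_, fun x => ?_, fun N => ?_⟩
  · obtain ⟨⟨b, k, j⟩, rfl⟩ := (flowEquiv ε).surjective x
    rw [flowTL_apply hε, Equiv.symm_apply_apply]
    obtain ⟨c, hc⟩ := hs k
    cases b
    · exact ⟨c, hc⟩
    · exact ⟨-c, by simp [hc]⟩
  · obtain ⟨⟨b, k, j⟩, rfl⟩ := (flowEquiv ε).surjective x
    rw [flowTL_apply hε, Equiv.symm_apply_apply]
    exact ⟨_, _, _, rfl⟩
  · refine (((Finset.univ : Finset Bool) ×ˢ flowSet N).finite_toSet.image (flowEquiv ε)).subset ?_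
    intro x hx
    obtain ⟨⟨b, k, j⟩, rfl⟩ := (flowEquiv ε).surjective x
    refine ⟨_, ?_, rfl⟩
    simp only [Set.mem_ofPred_eq, Equiv.symm_apply_apply] at hx
    simp only [Finset.coe_product, Set.mem_prod, Finset.coe_univ, Set.mem_univ, true_and,
      Finset.mem_coe]
    exact mem_flowSet.2 ⟨by omega, hx.2⟩

/-- The interaction of type B, with given moments. -/
def pairingB (W : ℤ → ℤ → ℂ) (v : ℤ → ℂ) : (ℤ × ℤ) ⊕ ℤ → TimeSeries × Op
  | Sum.inl x => (MvPowerSeries.C (1 / 2 * W x.1 x.2), psiB x.1 * psiB x.2)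
  | Sum.inr i => (MvPowerSeries.C (sqrtTwo * v i), psiB i * phi)

/-- The interaction of the Toda lattice, with given moments. -/
def pairingTL (W : ℤ → ℤ → ℂ) (x : ℤ × ℤ) : TimeSeries × Op :=
  (MvPowerSeries.C (W x.1 (-x.2 - 1)), psi 0 x.1 * psiDag 1 x.2)

/-- The indices of the fermions `f` in a letter of `pairingB`. -/
def posB : (ℤ × ℤ) ⊕ ℤ → List ℤ
  | Sum.inl x => [x.1, x.2]
  | Sum.inr i => [i]

/-- The indices of the fermions `f` in a letter of `pairingTL`. -/
def posTL (x : ℤ × ℤ) : List ℤ := [x.1, -1 - x.2]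

theorem commute_mul_of_anti {A : Type*} [Ring A] {a b c : A} (hb : a * b = -(b * a))
    (hc : a * c = -(c * a)) : Commute a (b * c) := by
  rw [Commute, SemiconjBy, ← mul_assoc, hb, neg_mul, mul_assoc, hc, mul_neg, neg_neg, mul_assoc]

theorem mul_eq_neg_mul_of_anti {A : Type*} [Ring A] {a b : A} (h : a * b = -(b * a)) :
    a * b = -b * a := by rw [h, neg_mul]

theorem mul_eq_mul_neg_of_anti {A : Type*} [Ring A] {a b : A} (h : a * b = -(b * a)) :
    a * b = b * -a := by rw [h, mul_neg]

theorem mul_mul_mul_self_of_anti {A : Type*} [Ring A] {a b : A} (h : a * b = -(b * a))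
    (ha : a * a = 0) : a * b * (a * b) = 0 := by
  have hb : b * a = -(a * b) := by rw [h, neg_neg]
  rw [mul_assoc, ← mul_assoc b, hb, neg_mul, mul_neg, ← mul_assoc, ← mul_assoc, ha, zero_mul,
    zero_mul, neg_zero]

theorem mul_mul_mul_swap_of_anti {A : Type*} [Ring A] {a b c : A} (hab : a * b = -(b * a))
    (ha : a * c = -(c * a)) (hb : b * c = -(c * b)) : a * c * (b * c) = -(b * c * (a * c)) := by
  have ha' : c * a = -(a * c) := by rw [ha, neg_neg]
  have hb' : c * b = -(b * c) := by rw [hb, neg_neg]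
  rw [mul_assoc a, mul_assoc b, ← mul_assoc c b, ← mul_assoc c a, ha', hb', neg_mul, neg_mul,
    mul_neg, mul_neg, neg_neg, mul_assoc b, mul_assoc a, ← mul_assoc a, ← mul_assoc b, hab,
    neg_mul, neg_neg]

/-- Letters ff commute with everything in sight. Two letters fφ anticommute, because they share φ;
they still square to zero. -/
theorem isInteraction_of_isFermi {σ : Type} [DecidableEq σ] {f fd : σ → ℤ → Op}
    (h : IsFermi f fd) {κ : Type} {H : κ → TimeSeries × Op} {pos : κ → List ℤ}
    (hs : ∀ x, ∃ c, (H x).1 = MvPowerSeries.C c)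
    (hop : ∀ x, (∃ s i t j, (H x).2 = f s i * f t j ∧ pos x = [i, j]) ∨
      ∃ s i, (H x).2 = f s i * phi ∧ pos x = [i])
    (hfin : ∀ N : ℕ, {x | ∀ p ∈ pos x, |p| ≤ N}.Finite) : IsInteraction f H pos := by
  have ha := h.isAnti
  have comm : ∀ x s i, Commute (f s i) (H x).2 := by
    intro x s i
    rcases hop x with ⟨s', i', t, j, hx, -⟩ | ⟨s', i', hx, -⟩ <;> rw [hx]
    · exact commute_mul_of_anti (ha.ff _ _ _ _) (ha.ff _ _ _ _)
    · exact commute_mul_of_anti (ha.ff _ _ _ _) (h.f_mul_phi _ _)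
  refine ⟨fun x => ?_, fun x p hp => ?_, fun x p hp => ?_, comm, fun x y => ?_, fun x => ?_, hfin⟩
  · obtain ⟨c, hc⟩ := hs x
    exact ⟨c, hc⟩
  · rcases hop x with ⟨s', i', t, j, hx, hpos⟩ | ⟨s', i', hx, hpos⟩ <;> rw [hpos] at hp <;> rw [hx]
    · simp only [List.mem_cons, List.not_mem_nil, or_false] at hp
      rcases hp with rfl | rfl
      · exact ⟨s', -f t j, mul_eq_neg_mul_of_anti (ha.ff _ _ _ _)⟩
      · exact ⟨t, f s' i', rfl⟩
    · simp only [List.mem_cons, List.not_mem_nil, or_false] at hp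
      subst hp
      exact ⟨s', -phi, mul_eq_neg_mul_of_anti (h.f_mul_phi _ _)⟩
  · rcases hop x with ⟨s', i', t, j, hx, hpos⟩ | ⟨s', i', hx, hpos⟩ <;> rw [hpos] at hp <;> rw [hx]
    · simp only [List.mem_cons, List.not_mem_nil, or_false] at hp
      rcases hp with rfl | rfl
      · exact ⟨s', f t j, rfl⟩
      · exact ⟨t, -f s' i', mul_eq_mul_neg_of_anti (ha.ff _ _ _ _)⟩
    · simp only [List.mem_cons, List.not_mem_nil, or_false] at hp
      subst hp
      exact ⟨s', phi, rfl⟩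
  · rcases hop x with ⟨s, i, t, j, hx, -⟩ | ⟨s, i, hx, -⟩
    · left
      rw [hx]
      exact (comm y s i).mul_left (comm y t j)
    · rcases hop y with ⟨s', i', t', j', hy, -⟩ | ⟨s', i', hy, -⟩
      · left
        rw [hy]
        exact ((comm x s' i').mul_left (comm x t' j')).symm.eq
      · right
        rw [hx, hy]
        exact mul_mul_mul_swap_of_anti (ha.ff _ _ _ _) (h.f_mul_phi _ _) (h.f_mul_phi _ _)
  · rcases hop x with ⟨s, i, t, j, hx, -⟩ | ⟨s, i, hx, -⟩ <;> rw [hx]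
    · exact mul_mul_mul_self_of_anti (ha.ff _ _ _ _) (h.sq_eq_zero _ _)
    · exact mul_mul_mul_self_of_anti (h.f_mul_phi _ _) (h.sq_eq_zero _ _)

theorem isInteraction_pairingB (W : ℤ → ℤ → ℂ) (v : ℤ → ℂ) :
    IsInteraction (fun _ : Unit => psiB) (pairingB W v) posB := by
  refine isInteraction_of_isFermi isFermi_psiB (fun x => ?_) (fun x => ?_) fun N => ?_
  · rcases x with x | i <;> exact ⟨_, rfl⟩
  · rcases x with x | i
    · exact Or.inl ⟨(), _, (), _, rfl, rfl⟩
    · exact Or.inr ⟨(), _, rfl, rfl⟩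
  · refine Set.Finite.subset (((Finset.Icc (-N : ℤ) N ×ˢ Finset.Icc (-N : ℤ) N).disjSum
      (Finset.Icc (-N : ℤ) N)).finite_toSet) ?_
    rintro (⟨i, j⟩ | i) hx
    · simpa [posB, abs_le] using hx
    · simpa [posB, abs_le] using hx

theorem isInteraction_pairingTL (W : ℤ → ℤ → ℂ) : IsInteraction fT (pairingTL W) posTL := by
  refine isInteraction_of_isFermi isFermi_fT (fun x => ⟨_, rfl⟩)
    (fun x => Or.inl ⟨false, _, true, _, ?_, rfl⟩) fun N => ?_
  · rw [pairingTL, psiDag_one_eq, psi_zero_eq]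
  · refine Set.Finite.subset ((Finset.Icc (-N - 1 : ℤ) (N + 1)
      ×ˢ Finset.Icc (-N - 1 : ℤ) (N + 1)).finite_toSet) ?_
    rintro ⟨i, j⟩ hx
    simp only [posTL, Set.mem_ofPred_eq, List.mem_cons, List.not_mem_nil, or_false,
      forall_eq_or_imp, forall_eq, abs_le] at hx
    simp only [Finset.coe_product, Finset.coe_Icc, Set.mem_prod, Set.mem_Icc]
    omega

theorem exists_time (k : ℕ+) :
    ∃ c, time k = MvPowerSeries.monomial (Finsupp.single (Sum.inl k) 1) c := ⟨1, rfl⟩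

theorem exists_smul_timeBar (c : ℂ) (k : ℕ+) : ∃ c',
    (c • timeBar) k = MvPowerSeries.monomial (Finsupp.single (Sum.inr k) 1) c' :=
  ⟨c, by
    rw [Pi.smul_apply, timeBar, MvPowerSeries.X, ← map_smul, smul_eq_mul, mul_one]⟩

/-- The scalar c covers both cases of the theorem: c = 1 gives t̄, and c = 0 gives t̄ = 0. -/
theorem finite_B (n m : ℤ) (W : ℤ → ℤ → ℂ) (v : ℤ → ℂ) (c : ℂ) :
    ExpVevFinite (braB n) (flowB 1 time) (pairingB W v) (flowB (-1) (c • timeBar)) (ketB m) :=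
  expVevFinite_of_isFermi isFermi_psiB (isFlow_flowB (by norm_num) _ _ exists_time)
    (isInteraction_pairingB W v) (isFlow_flowB (by norm_num) _ _ (exists_smul_timeBar c))
    (isFermi_psiB.exists_supp_bra (braB_mem n)) (isFermi_psiB.exists_supp_ket (ketB_mem m))

theorem finite_TL (n m : ℤ) (W : ℤ → ℤ → ℂ) (c : ℂ) :
    ExpVevFinite (braTL n (-n)) (flowTL 1 ![time, -time]) (pairingTL W)
      (flowTL (-1) ![c • timeBar, -(c • timeBar)]) (ketTL m (-m)) :=
  expVevFinite_of_isFermi isFermi_fT (isFlow_flowTL (by norm_num) _ _ exists_time)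
    (isInteraction_pairingTL W) (isFlow_flowTL (by norm_num) _ _ (exists_smul_timeBar c))
    (isFermi_fT.exists_supp_bra (braTL_mem _ _)) (isFermi_fT.exists_supp_ket (ketTL_mem _ _))

end Families

/-! ### Expectation values modulo high powers of the times -/

section Truncation

/-- The power series without monomials that divide `d`. -/
def truncIdeal (d : (ℕ+ ⊕ ℕ+) →₀ ℕ) : Ideal TimeSeries where
  carrier := {f | ∀ e ≤ d, MvPowerSeries.coeff e f = 0}
  zero_mem' := fun e _ => map_zero _
  add_mem' := fun {f g} hf hg e he => by rw [map_add, hf e he, hg e he, add_zero]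
  smul_mem' := fun f g hg e he => by
    classical
    rw [smul_eq_mul, MvPowerSeries.coeff_mul]
    refine Finset.sum_eq_zero fun p hp => ?_
    rw [hg p.2 (le_add_self.trans ((Finset.HasAntidiagonal.mem_antidiagonal.1 hp).le.trans he)), mul_zero]

/-- The quotient by `truncIdeal d`. -/
abbrev Trunc (d : (ℕ+ ⊕ ℕ+) →₀ ℕ) : Type := TimeSeries ⧸ truncIdeal d

/-- The projection to `Trunc d`. -/
def trunc (d : (ℕ+ ⊕ ℕ+) →₀ ℕ) : TimeSeries →ₐ[ℂ] Trunc d := Ideal.Quotient.mkₐ ℂ (truncIdeal d)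

theorem trunc_eq_iff {d : (ℕ+ ⊕ ℕ+) →₀ ℕ} {f g : TimeSeries} : trunc d f = trunc d g ↔
    ∀ e ≤ d, MvPowerSeries.coeff e f = MvPowerSeries.coeff e g := by
  rw [trunc, Ideal.Quotient.mkₐ_eq_mk, Ideal.Quotient.mk_eq_mk_iff_sub_mem]
  refine forall₂_congr fun e _ => ?_
  rw [map_sub, sub_eq_zero]

variable {Q : Type} [CommRing Q] [Algebra ℂ Q] (π : TimeSeries →ₐ[ℂ] Q)

/-- The operators of a family, with coefficients in `Q`. -/
def famQ {ι : Type} (E : ι → TimeSeries × Op) (x : ι) : QOp Q := π (E x).1 • opQ Q (E x).2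

theorem prod_map_famQ {ι : Type} (E : ι → TimeSeries × Op) (w : List ι) :
    (w.map (famQ π E)).prod = π (w.map E).prod.1 • opQ Q (w.map E).prod.2 := by
  induction w with
  | nil => simp
  | cons x w ih =>
    rw [List.map_cons, List.map_cons, List.prod_cons, List.prod_cons, ih, famQ,
      smul_mul_smul_comm, ← map_mul, ← map_mul]
    rfl

theorem texp_sum {ι : Type} {A : Type} [Ring A] [Algebra Q A] (S : Finset ι) (X : ι → A) (r : ℕ) :
    texp Q r (∑ x ∈ S, X x)
      = ∑ w ∈ wordsLT S r, algebraMap ℂ Q ((w.length.factorial : ℂ)⁻¹) • (w.map X).prod := by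
  rw [texp, sum_wordsLT]
  refine Finset.sum_congr rfl fun n _ => ?_
  rw [sum_pow_eq_sum_words, Finset.smul_sum]
  refine Finset.sum_congr rfl fun w hw => ?_
  rw [(mem_words.1 hw).1]

variable {ι κ ι' : Type} {L R : Op} {E : ι → TimeSeries × Op} {H : κ → TimeSeries × Op}
  {E' : ι' → TimeSeries × Op}

/-- Expanding finite sums and truncated exponentials yields exactly the terms of `expTerm` for words
shorter than r in the chosen letters. -/
theorem vevQ_texp_sum (S₁ : Finset ι) (S₂ : Finset κ) (S₃ : Finset ι') (r : ℕ) :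
    ∃ F : TimeSeries, vevQ Q (opQ Q L * (texp Q r (∑ x ∈ S₁, famQ π E x)
        * texp Q r (∑ x ∈ S₂, famQ π H x) * texp Q r (∑ x ∈ S₃, famQ π E' x)) * opQ Q R) = π F ∧
      ∀ e, MvPowerSeries.coeff e F
        = ∑ w ∈ wordsLT S₁ r ×ˢ (wordsLT S₂ r ×ˢ wordsLT S₃ r), expTerm L E H E' R e w := by
  refine ⟨∑ w ∈ wordsLT S₁ r ×ˢ (wordsLT S₂ r ×ˢ wordsLT S₃ r),
    ((w.1.length.factorial : ℂ) * w.2.1.length.factorial * w.2.2.length.factorial)⁻¹ •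
      vev (L * ((w.1.map E).prod * (w.2.1.map H).prod * (w.2.2.map E').prod).2 * R) •
      ((w.1.map E).prod * (w.2.1.map H).prod * (w.2.2.map E').prod).1, ?_, fun e => ?_⟩
  · rw [texp_sum, texp_sum, texp_sum, Finset.sum_mul_sum]
    simp only [Finset.sum_mul]
    simp only [Finset.mul_sum, Finset.sum_mul, map_sum, Finset.sum_product, prod_map_famQ]
    refine Finset.sum_congr rfl fun u _ => ?_
    refine Finset.sum_congr rfl fun h _ => ?_
    refine Finset.sum_congr rfl fun v _ => ?_
    simp only [smul_mul_assoc, mul_smul_comm, map_smul, ← map_mul (opQ Q), vevQ_opQ, smul_eq_mul,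
      Prod.fst_mul, Prod.snd_mul]
    simp only [Algebra.smul_def, map_mul, mul_inv]
    ring
  · rw [map_sum]
    refine Finset.sum_congr rfl fun w _ => ?_
    rw [expTerm, map_smul, map_smul, smul_eq_mul, smul_eq_mul]
    ring

/-- Finitely many triples of words contribute to the finitely many coefficients below d, so large
cut-offs miss none. The set of letters is fixed before r, so that r can later be enlarged depending
on nilpotency orders. -/
theorem eventually_trunc_expVev (hfin : ExpVevFinite L E H E' R) {S₁ : ℕ → Finset ι}
    {S₂ : ℕ → Finset κ} {S₃ : ℕ → Finset ι'} (h₁ : ∀ x, ∀ᶠ N in atTop, x ∈ S₁ N)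
    (h₂ : ∀ x, ∀ᶠ N in atTop, x ∈ S₂ N) (h₃ : ∀ x, ∀ᶠ N in atTop, x ∈ S₃ N)
    (d : (ℕ+ ⊕ ℕ+) →₀ ℕ) :
    ∀ᶠ N in atTop, ∀ᶠ r in atTop, trunc d (expVev L E H E' R)
      = vevQ (Trunc d) (opQ (Trunc d) L * (texp (Trunc d) r (∑ x ∈ S₁ N, famQ (trunc d) E x)
        * texp (Trunc d) r (∑ x ∈ S₂ N, famQ (trunc d) H x)
        * texp (Trunc d) r (∑ x ∈ S₃ N, famQ (trunc d) E' x)) * opQ (Trunc d) R) := by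
  have hU : (⋃ e ∈ Set.Iic d, Function.support (expTerm L E H E' R e)).Finite :=
    (Set.finite_Iic d).biUnion fun e _ => hfin e
  have hl : ∀ {α : Type} (S : ℕ → Finset α), (∀ x, ∀ᶠ N in atTop, x ∈ S N) → ∀ w : List α,
      ∀ᶠ N in atTop, ∀ x ∈ w, x ∈ S N := fun S hS w =>
    (eventually_all_finite w.finite_toSet).2 fun x _ => hS x
  have hN : ∀ᶠ N in atTop, ∀ w ∈ ⋃ e ∈ Set.Iic d, Function.support (expTerm L E H E' R e),
      (∀ x ∈ w.1, x ∈ S₁ N) ∧ (∀ x ∈ w.2.1, x ∈ S₂ N) ∧ ∀ x ∈ w.2.2, x ∈ S₃ N :=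
    (eventually_all_finite hU).2 fun w _ =>
      (hl S₁ h₁ w.1).and ((hl S₂ h₂ w.2.1).and (hl S₃ h₃ w.2.2))
  have hr : ∀ᶠ r in atTop, ∀ w ∈ ⋃ e ∈ Set.Iic d, Function.support (expTerm L E H E' R e),
      w.1.length < r ∧ w.2.1.length < r ∧ w.2.2.length < r :=
    (eventually_all_finite hU).2 fun w _ =>
      (eventually_gt_atTop _).and ((eventually_gt_atTop _).and (eventually_gt_atTop _))
  filter_upwards [hN] with N hN
  filter_upwards [hr] with r hr
  obtain ⟨F, hF, hcoeff⟩ := vevQ_texp_sum (L := L) (R := R) (E := E) (H := H) (E' := E')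
    (trunc d) (S₁ N) (S₂ N) (S₃ N) r
  rw [hF, trunc_eq_iff]
  intro e he
  rw [hcoeff]
  change ∑ᶠ w, expTerm L E H E' R e w = _
  refine finsum_eq_sum_of_support_subset _ fun w hw => ?_
  have hw' : w ∈ ⋃ e ∈ Set.Iic d, Function.support (expTerm L E H E' R e) :=
    Set.mem_biUnion (show e ∈ Set.Iic d from he) hw
  obtain ⟨a₁, a₂, a₃⟩ := hN w hw'
  obtain ⟨b₁, b₂, b₃⟩ := hr w hw'
  simp only [Finset.coe_product, Set.mem_prod, Finset.mem_coe, mem_wordsLT]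
  exact ⟨⟨b₁, a₁⟩, ⟨b₂, a₂⟩, b₃, a₃⟩

end Truncation

/-! ### The exponents as images of words -/

/-- Exchanging the indices negates the sum. The sign ε lets U be symmetric and Z antisymmetric, or
conversely. -/
theorem sum_smul_antisymm {A : Type*} [AddCommGroup A] [Module ℂ A] (T : Finset ℤ)
    {U : ℤ → ℤ → ℂ} {Z : ℤ → ℤ → A} {ε : ℂ} (hU : ∀ i j, U j i = ε * U i j)
    (hZ : ∀ i j, Z j i = -ε • Z i j) (hε : ε * ε = 1) :
    ∑ x ∈ T ×ˢ T, U x.1 x.2 • Z x.1 x.2 = 0 := by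
  have h : ∑ x ∈ T ×ˢ T, U x.1 x.2 • Z x.1 x.2 = -∑ x ∈ T ×ˢ T, U x.1 x.2 • Z x.1 x.2 := by
    conv_lhs => rw [Finset.sum_product_right, ← Finset.sum_product' (f := fun j i => U i j • Z i j)]
    rw [← Finset.sum_neg_distrib]
    refine Finset.sum_congr rfl fun x _ => ?_
    rw [hU, hZ, smul_smul, ← neg_smul]
    congr 1
    linear_combination -U x.1 x.2 * hε
  have h2 : (2 : ℂ) • ∑ x ∈ T ×ˢ T, U x.1 x.2 • Z x.1 x.2 = 0 := by
    rw [two_smul]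
    nth_rewrite 1 [h]
    exact neg_add_cancel _
  exact (smul_eq_zero.1 h2).resolve_left two_ne_zero

/-- `∑ v_i g_i`. -/
def linOp (T : Finset ℤ) (g : ℤ → Op) (v : ℤ → ℂ) : Op := ∑ i ∈ T, v i • g i

/-- `½ ∑ W_{ij} g_i g_j`. -/
def quadOp (T : Finset ℤ) (g : ℤ → Op) (W : ℤ → ℤ → ℂ) : Op :=
  ∑ x ∈ T ×ˢ T, (1 / 2 * W x.1 x.2) • (g x.1 * g x.2)

theorem linOp_mul_linOp (T : Finset ℤ) (g h : ℤ → Op) (v : ℤ → ℂ) :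
    linOp T g v * linOp T h v = ∑ x ∈ T ×ˢ T, (v x.1 * v x.2) • (g x.1 * h x.2) := by
  simp only [linOp, Finset.sum_mul_sum, Finset.sum_product, smul_mul_smul_comm]

theorem linOp_mul_self (T : Finset ℤ) (s : Bool) (v : ℤ → ℂ) :
    linOp T (fR s) v * linOp T (fR s) v = 0 := by
  rw [linOp_mul_linOp]
  refine sum_smul_antisymm T (U := fun i j => v i * v j) (Z := fun i j => fR s i * fR s j)
    (ε := 1) (fun i j => by ring) (fun i j => ?_) (by norm_num)
  rw [isFermi_fR.isAnti.ff, neg_one_smul]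

/-- A finite sum of commuting terms, each of square zero. -/
theorem isNilpotent_quadOp (T : Finset ℤ) (s : Bool) (W : ℤ → ℤ → ℂ) :
    IsNilpotent (quadOp T (fR s) W) := by
  have ha := isFermi_fR.isAnti
  have hc : ∀ i j k, Commute (fR s i) (fR s j * fR s k) := fun i j k =>
    commute_mul_of_anti (ha.ff _ _ _ _) (ha.ff _ _ _ _)
  refine Commute.isNilpotent_sum (fun x _ => ?_) fun x y _ _ => ?_
  · refine ⟨2, ?_⟩
    rw [sq, smul_mul_smul_comm, mul_mul_mul_self_of_anti (ha.ff _ _ _ _)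
      (isFermi_fR.sq_eq_zero _ _), smul_zero]
  · exact (((hc _ _ _).mul_left (hc _ _ _)).smul_left _).smul_right _

theorem commute_quadOp_linOp (T : Finset ℤ) (s : Bool) (W : ℤ → ℤ → ℂ) (v : ℤ → ℂ) :
    Commute (quadOp T (fR s) W) (linOp T (fR s) v) := by
  have ha := isFermi_fR.isAnti
  refine Commute.sum_left _ _ _ fun x _ => Commute.sum_right _ _ _ fun i _ => ?_
  exact ((commute_mul_of_anti (ha.ff _ _ _ _) (ha.ff _ _ _ _)).symm.smul_left _).smul_right _

theorem fT_mul_fT (i j : ℤ) : fT false i * fT true j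
    = (1 / 2 : ℂ) • (fR false i * fR false j + fR true i * fR true j
      + Complex.I • (fR false i * fR true j + fR false j * fR true i)) := by
  rw [fT_false, fT_true, smul_mul_smul_comm, inv_sqrtTwo_mul_self, sub_mul, mul_add, mul_add,
    smul_mul_assoc, smul_mul_assoc, mul_smul_comm, mul_smul_comm, smul_smul, Complex.I_mul_I,
    isFermi_fR.isAnti.ff true i false j]
  congr 1
  module

/-- In `fT_mul_fT` the unmixed terms are antisymmetric in i, j and the mixed ones symmetric. Hence W
contributes only H and Ĥ, while the rank one part v_i v_j contributes only the mixed term, which is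
ciαα̂. -/
theorem sum_fT_mul_fT (T : Finset ℤ) {W : ℤ → ℤ → ℂ} (hW : ∀ i j, W j i = -W i j) (v : ℤ → ℂ)
    (c : ℂ) : ∑ x ∈ T ×ˢ T, (W x.1 x.2 + c * (v x.1 * v x.2)) • (fT false x.1 * fT true x.2)
      = quadOp T (fR false) W + quadOp T (fR true) W
        + (c * Complex.I) • (linOp T (fR false) v * linOp T (fR true) v) := by
  have ha := isFermi_fR.isAnti
  have hff : ∀ s, ∑ x ∈ T ×ˢ T, (v x.1 * v x.2) • (fR s x.1 * fR s x.2) = 0 := fun s => by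
    rw [← linOp_mul_linOp, linOp_mul_self]
  have hX : ∑ x ∈ T ×ˢ T, W x.1 x.2 • (fR false x.1 * fR true x.2 + fR false x.2 * fR true x.1)
      = 0 :=
    sum_smul_antisymm T (U := W) (Z := fun i j => fR false i * fR true j + fR false j * fR true i)
      (ε := -1) (fun i j => by rw [hW]; ring) (fun i j => by rw [neg_neg, one_smul, add_comm])
      (by norm_num)
  have hY : ∑ x ∈ T ×ˢ T, (v x.1 * v x.2) •
      (fR false x.2 * fR true x.1 - fR false x.1 * fR true x.2) = 0 :=
    sum_smul_antisymm T (U := fun i j => v i * v j)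
      (Z := fun i j => fR false j * fR true i - fR false i * fR true j)
      (ε := 1) (fun i j => by ring) (fun i j => by rw [neg_one_smul, neg_sub]) (by norm_num)
  -- An identity term by term, in which the last four sums are those shown to vanish.
  have key : ∑ x ∈ T ×ˢ T, (W x.1 x.2 + c * (v x.1 * v x.2)) • (fT false x.1 * fT true x.2)
      = quadOp T (fR false) W + quadOp T (fR true) W
        + (c * Complex.I) • (linOp T (fR false) v * linOp T (fR true) v)
        + (c / 2) • ∑ x ∈ T ×ˢ T, (v x.1 * v x.2) • (fR false x.1 * fR false x.2)
        + (c / 2) • ∑ x ∈ T ×ˢ T, (v x.1 * v x.2) • (fR true x.1 * fR true x.2)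
        + (Complex.I / 2) • ∑ x ∈ T ×ˢ T, W x.1 x.2 •
          (fR false x.1 * fR true x.2 + fR false x.2 * fR true x.1)
        + (c * Complex.I / 2) • ∑ x ∈ T ×ˢ T, (v x.1 * v x.2) •
          (fR false x.2 * fR true x.1 - fR false x.1 * fR true x.2) := by
    simp only [linOp_mul_linOp, quadOp, Finset.smul_sum, ← Finset.sum_add_distrib]
    refine Finset.sum_congr rfl fun x _ => ?_
    rw [fT_mul_fT]
    module
  rw [key, hff, hff, hX, hY]
  simp only [smul_zero, add_zero]

/-- The sum over the copies is a Hermitian form, invariant under the unitary change of fermions. -/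
theorem fT_mul_fdT_add (i j : ℤ) : fT false i * fdT false j + fT true i * fdT true j
    = fR false i * fdR false j + fR true i * fdR true j := by
  rw [fT_false, fT_true, fdT_false, fdT_true, smul_mul_smul_comm, smul_mul_smul_comm,
    inv_sqrtTwo_mul_self]
  simp only [sub_mul, mul_sub, add_mul, mul_add, smul_mul_assoc, mul_smul_comm]
  match_scalars <;>
    first | ring1 | linear_combination Complex.I_sq | linear_combination -Complex.I_sq

/-- The coefficients are central and generate a nilpotent ideal, so the Y's need not commute. -/
theorem isNilpotent_sum_smul {Q A : Type*} {ι : Type} [CommRing Q] [Ring A] [Algebra Q A] (S : Finset ι)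
    (a : ι → Q) (Y : ι → A) (ha : ∀ x, IsNilpotent (a x)) :
    IsNilpotent (∑ x ∈ S, a x • Y x) := by
  classical
  have hJ : IsNilpotent (Ideal.span (S.image a : Set Q)) := by
    rw [Ideal.FG.isNilpotent_iff_le_nilradical ⟨_, rfl⟩, Ideal.span_le]
    intro y hy
    obtain ⟨x, _, rfl⟩ := Finset.mem_image.1 hy
    exact ha x
  obtain ⟨n, hn⟩ := hJ
  refine ⟨n, ?_⟩
  have hc : ∀ w : List ι, (∀ x ∈ w, x ∈ S) →
      (w.map a).prod ∈ Ideal.span (S.image a : Set Q) ^ w.length := by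
    intro w hw
    induction w with
    | nil => simp
    | cons x w ih =>
      rw [List.map_cons, List.prod_cons, List.length_cons, pow_succ']
      exact Ideal.mul_mem_mul (Ideal.subset_span (Finset.mem_image_of_mem a (hw x (by simp))))
        (ih fun y hy => hw y (by simp [hy]))
  have hs : ∀ w : List ι, (w.map fun x => a x • Y x).prod = (w.map a).prod • (w.map Y).prod := by
    intro w
    induction w with
    | nil => simp
    | cons x w ih => rw [List.map_cons, List.prod_cons, ih, smul_mul_smul_comm]; rfl
  rw [sum_pow_eq_sum_words]
  refine Finset.sum_eq_zero fun w hw => ?_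
  obtain ⟨h1, h2⟩ := mem_words.1 hw
  have := hc w h2
  rw [h1, hn] at this
  rw [hs, Ideal.mem_bot.1 this, zero_smul]

/-! ### Truncated flows and interactions as words, and the identity for arbitrary moments. -/

variable {Q : Type} [CommRing Q] [Algebra ℂ Q]

variable (Q) in
/-- The word of `∑ v_i ψ_i`. -/
def linWord (T : Finset ℤ) (v : ℤ → ℂ) : FreeAlgebra Q Letter :=
  ∑ i ∈ T, algebraMap ℂ Q (v i) • FreeAlgebra.ι Q (Sum.inl i)

variable (Q) in
/-- The word of `½ ∑ W_{ij} ψ_i ψ_j`. -/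
def quadWord (T : Finset ℤ) (W : ℤ → ℤ → ℂ) : FreeAlgebra Q Letter :=
  ∑ x ∈ T ×ˢ T, algebraMap ℂ Q (1 / 2 * W x.1 x.2) •
    (FreeAlgebra.ι Q (Sum.inl x.1) * FreeAlgebra.ι Q (Sum.inl x.2))

/-- The word of `∑ s_k ψ_l ψ†_{l + ε k}`. -/
def flowWord (T : Finset (ℕ+ × ℤ)) (ε : ℤ) (s : ℕ+ → Q) : FreeAlgebra Q Letter :=
  ∑ x ∈ T, s x.1 • (FreeAlgebra.ι Q (Sum.inl x.2)
    * FreeAlgebra.ι Q (Sum.inr (x.2 + ε * (x.1 : ℕ))))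

theorem hasParity_linWord (T : Finset ℤ) (v : ℤ → ℂ) : HasParity 1 (linWord Q T v) :=
  HasParity.sum _ _ fun _ _ => (hasParity_ι _).smul _

theorem HasParity.of_two {w : FreeAlgebra Q Letter} (h : HasParity 2 w) : HasParity 0 w := by
  simpa [HasParity] using h

theorem hasParity_quadWord (T : Finset ℤ) (W : ℤ → ℤ → ℂ) : HasParity 0 (quadWord Q T W) :=
  HasParity.sum _ _ fun _ _ => (((hasParity_ι _).mul (hasParity_ι _)).of_two).smul _

theorem hasParity_flowWord (T : Finset (ℕ+ × ℤ)) (ε : ℤ) (s : ℕ+ → Q) :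
    HasParity 0 (flowWord T ε s) :=
  HasParity.sum _ _ fun _ _ => (((hasParity_ι _).mul (hasParity_ι _)).of_two).smul _

theorem evQ_linWord (T : Finset ℤ) (s : Bool) (v : ℤ → ℂ) :
    evQ Q s (linWord Q T v) = opQ Q (linOp T (fR s) v) := by
  simp only [linWord, linOp, map_sum, map_smul, evQ_ι]
  simp only [algebraMap_smul]
  rfl

theorem evQ_quadWord (T : Finset ℤ) (s : Bool) (W : ℤ → ℤ → ℂ) :
    evQ Q s (quadWord Q T W) = opQ Q (quadOp T (fR s) W) := by
  simp only [quadWord, quadOp, map_sum, map_smul, map_mul (evQ Q s), evQ_ι,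
    map_mul (opQ Q)]
  simp only [algebraMap_smul]
  rfl

theorem evQ_flowWord (T : Finset (ℕ+ × ℤ)) (ε : ℤ) (b : Bool) (s : ℕ+ → Q) :
    evQ Q b (flowWord T ε s)
      = ∑ x ∈ T, s x.1 • opQ Q (fR b x.2 * fdR b (x.2 + ε * (x.1 : ℕ))) := by
  simp only [flowWord, map_sum, map_smul, map_mul, evQ_ι]
  rfl

variable (π : TimeSeries →ₐ[ℂ] Q)

theorem sum_famQ_flowB {ε : ℤ} (hε : ε ≠ 0) (T : Finset (ℕ+ × ℤ)) (s : ℕ+ → TimeSeries) :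
    ∑ x ∈ T, famQ π (flowB ε s) x = evQ Q false (flowWord T ε fun k => π (s k)) := by
  rw [evQ_flowWord]
  refine Finset.sum_congr rfl fun x _ => ?_
  rw [famQ, ← Prod.mk.eta (p := x), flowB_apply hε, psiB_eq, psiBDag_eq]

theorem sum_famQ_flowTL {ε : ℤ} (hε : ε ≠ 0) (T : Finset (ℕ+ × ℤ)) (s : ℕ+ → TimeSeries) :
    ∑ x ∈ ((Finset.univ : Finset Bool) ×ˢ T).map (flowEquiv ε).toEmbedding,
        famQ π (flowTL ε ![s, -s]) x
      = evQ Q false (flowWord T ε fun k => π (s k))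
        + evQ Q true (flowWord T ε fun k => π (s k)) := by
  rw [evQ_flowWord, evQ_flowWord, Finset.sum_map, Finset.sum_product_right,
    ← Finset.sum_add_distrib]
  refine Finset.sum_congr rfl fun x _ => ?_
  have h : ∀ b, famQ π (flowTL ε ![s, -s]) (flowEquiv ε (b, x))
      = π (s x.1) • opQ Q (fT b x.2 * fdT b (x.2 + ε * (x.1 : ℕ))) := by
    intro b
    rw [famQ, ← Prod.mk.eta (p := x), flowTL_apply hε]
    cases b <;> simp
  simp only [Equiv.coe_toEmbedding, h, Fintype.sum_bool]
  rw [← smul_add, ← smul_add, ← map_add, ← map_add, add_comm, fT_mul_fdT_add]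

theorem famQ_C {ι : Type} {E : ι → TimeSeries × Op} {x : ι} {c : ℂ} {X : Op}
    (h : E x = (MvPowerSeries.C c, X)) : famQ π E x = opQ Q (c • X) := by
  have hc : π (MvPowerSeries.C c) = algebraMap ℂ Q c := π.commutes c
  rw [famQ, h, opQ_smul, hc]

theorem sum_famQ_pairingB (T : Finset ℤ) (W : ℤ → ℤ → ℂ) (v : ℤ → ℂ) :
    ∑ x ∈ (T ×ˢ T).disjSum T, famQ π (pairingB W v) x
      = evQ Q false (quadWord Q T W)
        + rtTwo Q • (evQ Q false (linWord Q T v) * opQ Q phi) := by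
  rw [Finset.sum_disjSum, evQ_quadWord, evQ_linWord, quadOp, linOp, rtTwo, ← map_mul, ← opQ_smul,
    Finset.sum_mul, Finset.smul_sum, map_sum, map_sum]
  congr 1
  · refine Finset.sum_congr rfl fun x _ => famQ_C π ?_
    rw [pairingB, psiB_eq, psiB_eq]
  · refine Finset.sum_congr rfl fun x _ => ?_
    rw [smul_mul_assoc, smul_smul]
    refine famQ_C π ?_
    rw [pairingB, psiB_eq]

/-- The reflection of the second index. -/
def reflectSnd : ℤ × ℤ ≃ ℤ × ℤ :=
  Equiv.prodCongr (Equiv.refl ℤ) ⟨fun j => -1 - j, fun j => -1 - j, fun j => by ring,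
    fun j => by ring⟩

theorem sum_famQ_pairingTL (T : Finset ℤ) {W : ℤ → ℤ → ℂ} (hW : ∀ i j, W j i = -W i j)
    (v : ℤ → ℂ) (c : ℂ) :
    ∑ x ∈ (T ×ˢ T).map reflectSnd.toEmbedding,
        famQ π (pairingTL fun i j => W i j + c * (v i * v j)) x
      = evQ Q false (quadWord Q T W) + evQ Q true (quadWord Q T W)
        + algebraMap ℂ Q (c * Complex.I) • twin (linWord Q T v) (linWord Q T v) := by
  rw [twin, evQ_linWord, evQ_linWord, evQ_quadWord, evQ_quadWord, ← map_mul, ← opQ_smul,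
    ← map_add, ← map_add, ← sum_fT_mul_fT T hW, Finset.sum_map, map_sum]
  refine Finset.sum_congr rfl fun x _ => famQ_C π ?_
  have h : -(-1 - x.2) - 1 = x.2 := by ring
  change (MvPowerSeries.C _, psi 0 x.1 * psiDag 1 (-1 - x.2)) = _
  rw [psiDag_one_eq, psi_zero_eq, sub_sub_cancel]
  change (MvPowerSeries.C (W x.1 (-(-1 - x.2) - 1) + c * (v x.1 * v (-(-1 - x.2) - 1))), _) = _
  rw [h]

/-- The power d a + 1 of a time no longer divides d. -/
theorem isNilpotent_trunc {d : (ℕ+ ⊕ ℕ+) →₀ ℕ} {f : TimeSeries} {a : ℕ+ ⊕ ℕ+} {c : ℂ}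
    (h : f = MvPowerSeries.monomial (Finsupp.single a 1) c) : IsNilpotent (trunc d f) := by
  classical
  refine ⟨d a + 1, ?_⟩
  rw [← map_pow, ← map_zero (trunc d), trunc_eq_iff, h, MvPowerSeries.monomial_pow]
  intro e he
  rw [MvPowerSeries.coeff_monomial, if_neg, map_zero]
  rintro rfl
  have := he a
  simp at this

theorem eventually_mem_Icc (i : ℤ) : ∀ᶠ N : ℕ in atTop, i ∈ Finset.Icc (-N : ℤ) N := by
  filter_upwards [eventually_ge_atTop i.natAbs] with N hN
  rw [Finset.mem_Icc]
  omega

theorem eventually_mem_flowSet (x : ℕ+ × ℤ) : ∀ᶠ N : ℕ in atTop, x ∈ flowSet N := by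
  filter_upwards [eventually_ge_atTop (x.2.natAbs + (x.1 : ℕ))] with N hN
  refine mem_flowSet.2 ⟨by omega, ?_⟩
  rw [abs_le]
  omega

/-- A power series is determined by its images in all `Trunc d`, and there common cut-offs turn the
three series into the values compared in `vevB_sq`. -/
theorem expVev_sq (n m : ℤ) {W : ℤ → ℤ → ℂ} (hW : ∀ i j, W j i = -W i j) (v : ℤ → ℂ) (c : ℂ) :
    expVev (braB n) (flowB 1 time) (pairingB W v) (flowB (-1) (c • timeBar)) (ketB m) ^ 2
      = ((-1 : ℂ) ^ (n * (n + 1) / 2 + m * (m + 1) / 2)) • expVev (braTL n (-n))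
        (flowTL 1 ![time, -time]) (pairingTL fun i j => W i j + 1 * (v i * v j))
        (flowTL (-1) ![c • timeBar, -(c • timeBar)]) (ketTL m (-m)) ∧
    expVev (braB n) (flowB 1 time) (pairingB W v) (flowB (-1) (c • timeBar)) (ketB m) ^ 2
      = ((-1 : ℂ) ^ (n - m)) • ((-1 : ℂ) ^ (n * (n + 1) / 2 + m * (m + 1) / 2)) •
        expVev (braTL n (-n))
        (flowTL 1 ![time, -time]) (pairingTL fun i j => W i j + -1 * (v i * v j))
        (flowTL (-1) ![c • timeBar, -(c • timeBar)]) (ketTL m (-m)) := by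
  have key : ∀ d, trunc d (expVev (braB n) (flowB 1 time) (pairingB W v)
        (flowB (-1) (c • timeBar)) (ketB m) ^ 2)
      = trunc d (((-1 : ℂ) ^ (n * (n + 1) / 2 + m * (m + 1) / 2)) • expVev (braTL n (-n))
        (flowTL 1 ![time, -time]) (pairingTL fun i j => W i j + 1 * (v i * v j))
        (flowTL (-1) ![c • timeBar, -(c • timeBar)]) (ketTL m (-m))) ∧
      trunc d (expVev (braB n) (flowB 1 time) (pairingB W v)
        (flowB (-1) (c • timeBar)) (ketB m) ^ 2)
      = trunc d (((-1 : ℂ) ^ (n - m)) • ((-1 : ℂ) ^ (n * (n + 1) / 2 + m * (m + 1) / 2)) •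
        expVev (braTL n (-n))
        (flowTL 1 ![time, -time]) (pairingTL fun i j => W i j + -1 * (v i * v j))
        (flowTL (-1) ![c • timeBar, -(c • timeBar)]) (ketTL m (-m))) := by
    intro d
    have hflow : ∀ (ε : ℤ) (x : Fin 2 × ℕ+ × ℤ), ∀ᶠ N in atTop,
        x ∈ ((Finset.univ : Finset Bool) ×ˢ flowSet N).map (flowEquiv ε).toEmbedding := by
      intro ε x
      filter_upwards [eventually_mem_flowSet ((flowEquiv ε).symm x).2] with N hN
      rw [Finset.mem_map_equiv, Finset.mem_product]
      exact ⟨Finset.mem_univ _, hN⟩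
    have hTL : ∀ x : ℤ × ℤ, ∀ᶠ N : ℕ in atTop,
        x ∈ (Finset.Icc (-N : ℤ) N ×ˢ Finset.Icc (-N : ℤ) N).map reflectSnd.toEmbedding := by
      intro x
      filter_upwards [eventually_mem_Icc (reflectSnd.symm x).1,
        eventually_mem_Icc (reflectSnd.symm x).2] with N h1 h2
      rw [Finset.mem_map_equiv, Finset.mem_product]
      exact ⟨h1, h2⟩
    have hB : ∀ x : (ℤ × ℤ) ⊕ ℤ, ∀ᶠ N : ℕ in atTop,
        x ∈ (Finset.Icc (-N : ℤ) N ×ˢ Finset.Icc (-N : ℤ) N).disjSum (Finset.Icc (-N : ℤ) N) := by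
      rintro (x | i)
      · filter_upwards [eventually_mem_Icc x.1, eventually_mem_Icc x.2] with N h1 h2
        rw [Finset.inl_mem_disjSum, Finset.mem_product]
        exact ⟨h1, h2⟩
      · filter_upwards [eventually_mem_Icc i] with N h1
        rwa [Finset.inr_mem_disjSum]
    -- One N serves all three expectation values; only then are the exponents fixed elements with
    -- nilpotency orders, from which a common r is chosen below.
    obtain ⟨N, h1, h2, h3⟩ := ((eventually_trunc_expVev (finite_B n m W v c)
      eventually_mem_flowSet hB eventually_mem_flowSet d).and
      ((eventually_trunc_expVev (finite_TL n m (fun i j => W i j + 1 * (v i * v j)) c)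
      (hflow 1) hTL (hflow (-1)) d).and
      (eventually_trunc_expVev (finite_TL n m (fun i j => W i j + -1 * (v i * v j)) c)
      (hflow 1) hTL (hflow (-1)) d))).exists
    have hnil : ∀ (ε : ℤ) (s : ℕ+ → Trunc d), (∀ k, IsNilpotent (s k)) → ∀ b,
        IsNilpotent (evQ (Trunc d) b (flowWord (flowSet N) ε s)) := by
      intro ε s hs b
      rw [evQ_flowWord]
      exact isNilpotent_sum_smul _ _ _ fun x => hs x.1
    have hsq := vevB_sq (Q := Trunc d) n m (hasParity_flowWord (flowSet N) 1 fun k => trunc d (time k))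
      (hasParity_quadWord (Finset.Icc (-N : ℤ) N) W) (hasParity_linWord (Finset.Icc (-N : ℤ) N) v)
      (hasParity_flowWord (flowSet N) (-1) fun k => trunc d ((c • timeBar) k))
      (hnil _ _ fun k => isNilpotent_trunc (exists_time k).choose_spec)
      (fun s => by
        rw [evQ_quadWord]
        exact (isNilpotent_quadOp _ s W).map _)
      (hnil _ _ fun k => isNilpotent_trunc (exists_smul_timeBar c k).choose_spec)
      (fun s => by rw [evQ_linWord, ← map_mul, linOp_mul_self, map_zero])
      (fun s => by
        rw [evQ_linWord, evQ_quadWord]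
        exact (commute_quadOp_linOp _ s W v).map _)
    obtain ⟨r, h1, h2, h3, h4⟩ := (h1.and (h2.and (h3.and hsq))).exists
    rw [sum_famQ_flowB _ (by norm_num), sum_famQ_flowB _ (by norm_num), sum_famQ_pairingB,
      ← vevB] at h1
    rw [sum_famQ_flowTL _ (by norm_num), sum_famQ_flowTL _ (by norm_num),
      sum_famQ_pairingTL _ _ hW, one_mul] at h2
    rw [sum_famQ_flowTL _ (by norm_num), sum_famQ_flowTL _ (by norm_num),
      sum_famQ_pairingTL _ _ hW, neg_one_mul, map_neg] at h3
    have hs : ∀ (a : ℂ) (f : TimeSeries), trunc d (a • f) = algebraMap ℂ (Trunc d) a * trunc d f :=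
      fun a f => (map_smul (trunc d) a f).trans (Algebra.smul_def a (trunc d f))
    rw [map_pow, h1, hs, hs, hs, h2, h3]
    rw [vevTL, vevTL] at h4
    exact h4
  constructor <;> ext d
  · exact trunc_eq_iff.1 (key d).1 d le_rfl
  · exact trunc_eq_iff.1 (key d).2 d le_rfl

/-! ### The moments that do not contribute at `t̄ = 0` -/

section Restriction

variable {σ ι κ ι' : Type} {f : σ → ℤ → Op} {L R : Op} {E : ι → TimeSeries × Op}
  {H H' : κ → TimeSeries × Op} {E' : ι' → TimeSeries × Op} {pos : κ → List ℤ}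

/-- When the right flow vanishes, the interaction acts directly on |m⟩, and a word containing a mode
below m gives zero whatever its coefficient. -/
theorem expVev_congr_of_pos (hH : IsInteraction f H pos) (hop : ∀ x, (H' x).2 = (H x).2) {m : ℤ}
    (hs : ∀ x, (∀ p ∈ pos x, m ≤ p) → (H' x).1 = (H x).1)
    (hR : ∀ s i, i < m → f s i (R 1) = 0) (hE' : ∀ x, (E' x).1 = 0) :
    expVev L E H E' R = expVev L E H' E' R := by
  have key : ∀ d w, expTerm L E H E' R d w = expTerm L E H' E' R d w := by
    rintro d ⟨u, h, v⟩
    simp only [expTerm, list_prod_fst_snd, Prod.mk_mul_mk, hop]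
    congr 1
    rcases v with _ | ⟨y, v⟩
    · by_cases hx : ∀ x ∈ h, ∀ p ∈ pos x, m ≤ p
      · rw [List.map_congr_left fun x hxh => hs x (hx x hxh)]
      · push Not at hx
        obtain ⟨x, hxh, p, hp, hpm⟩ := hx
        have h0 : (h.map fun x => (H x).2).prod (R 1) = 0 := by
          by_contra h0
          have := interaction_word hH.right hH.comm (N := -m) (v := R 1)
            (fun s i hi => hR s i (by omega)) h0 hxh hp
          omega
        have hv : vev (L * ((u.map fun x => (E x).2).prod * (h.map fun x => (H x).2).prod
            * (([] : List ι').map fun x => (E' x).2).prod) * R) = 0 := by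
          rw [vev_mul_mul, List.map_nil, List.prod_nil, mul_one, Module.End.mul_apply, h0,
            map_zero, map_zero]
        rw [hv, mul_zero, mul_zero]
    · rw [List.map_cons, List.prod_cons, hE', zero_mul, mul_zero, mul_zero]
  funext d
  exact finsum_congr (key d)

end Restriction

/-! ### Application to the tau functions. -/

theorem interactionB_eq (ω : ComplexMeasure (ℂ × ℂ)) (ν : ComplexMeasure ℂ) :
    interactionB ω ν = pairingB (biMoment ω) (moment ν) := by
  funext x
  rcases x with x | i <;> rfl

theorem interactionTL_eq (μ : ComplexMeasure (ℂ × ℂ)) :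
    interactionTL μ = pairingTL (biMoment μ) := rfl

theorem expVev_pairingB_congr {n m : ℤ} {W W' : ℤ → ℤ → ℂ} {v v' : ℤ → ℂ}
    (hW : ∀ i j, m ≤ i → m ≤ j → W' i j = W i j) (hv : ∀ i, m ≤ i → v' i = v i) :
    expVev (braB n) (flowB 1 time) (pairingB W v) (flowB (-1) 0) (ketB m)
      = expVev (braB n) (flowB 1 time) (pairingB W' v') (flowB (-1) 0) (ketB m) := by
  refine expVev_congr_of_pos (isInteraction_pairingB W v) (fun x => ?_) (m := m) (fun x hx => ?_)
    (fun _ i hi => psiB_ketB hi) fun x => rfl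
  · rcases x with x | i <;> rfl
  · rcases x with x | i
    · simp only [posB, List.mem_cons, List.not_mem_nil, or_false, forall_eq_or_imp, forall_eq]
        at hx
      rw [pairingB, pairingB, hW _ _ hx.1 hx.2]
    · rw [pairingB, pairingB, hv _ (hx i (by simp [posB]))]

theorem expVev_pairingTL_congr {n m : ℤ} {W W' : ℤ → ℤ → ℂ}
    (hW : ∀ i j, m ≤ i → m ≤ j → W' i j = W i j) :
    expVev (braTL n (-n)) (flowTL 1 ![time, -time]) (pairingTL W) (flowTL (-1) ![0, -0])
        (ketTL m (-m))
      = expVev (braTL n (-n)) (flowTL 1 ![time, -time]) (pairingTL W') (flowTL (-1) ![0, -0])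
        (ketTL m (-m)) := by
  refine expVev_congr_of_pos (isInteraction_pairingTL W) (fun x => rfl) (m := m) (fun x hx => ?_)
    (fun s i hi => fT_ketTL hi s) fun x => ?_
  · simp only [posTL, List.mem_cons, List.not_mem_nil, or_false, forall_eq_or_imp, forall_eq]
      at hx
    rw [pairingTL, pairingTL, hW _ _ hx.1 (by omega)]
  · obtain ⟨a, k, i⟩ := x
    rw [flowTL]
    fin_cases a <;> simp

theorem tau_finite (n m : ℤ) (ω : ComplexMeasure (ℂ × ℂ)) (ν : ComplexMeasure ℂ) (c : ℂ) :
    TauBFinite n m ω ν time (c • timeBar) ∧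
      ∀ μ, TauTLFinite n m μ time (-time) (c • timeBar) (-(c • timeBar)) := by
  refine ⟨?_, fun μ => finite_TL n m (biMoment μ) c⟩
  rw [TauBFinite, interactionB_eq]
  exact finite_B n m _ _ c

end PfaffToda

end

theorem mainTheorem3
    (ω : MeasureTheory.ComplexMeasure (ℂ × ℂ)) (ν : MeasureTheory.ComplexMeasure ℂ)
    (hω : ω.map Prod.swap = -ω) (n m : ℤ) (tbar : ℕ+ → PfaffToda.TimeSeries)
    (htbar : (tbar = PfaffToda.timeBar ∧ PfaffToda.HasMoments Set.univ ω ν) ∨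
      (tbar = 0 ∧ PfaffToda.HasMoments (Set.Ici m) ω ν)) :
    (PfaffToda.TauBFinite n m ω ν PfaffToda.time tbar ∧
      PfaffToda.TauTLFinite n m (ω + PfaffToda.square ν)
        PfaffToda.time (-PfaffToda.time) tbar (-tbar) ∧
      PfaffToda.TauTLFinite n m (ω - PfaffToda.square ν)
        PfaffToda.time (-PfaffToda.time) tbar (-tbar)) ∧
    PfaffToda.tauB n m ω ν PfaffToda.time tbar ^ 2 =
      PfaffToda.tauTL n m (ω + PfaffToda.square ν)
        PfaffToda.time (-PfaffToda.time) tbar (-tbar) ∧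
    PfaffToda.tauB n m ω ν PfaffToda.time tbar ^ 2 =
      ((-1 : ℂ) ^ (n - m)) • PfaffToda.tauTL n m (ω - PfaffToda.square ν)
        PfaffToda.time (-PfaffToda.time) tbar (-tbar) := by
  have hswap : ∀ i j, PfaffToda.biMoment ω j i = -PfaffToda.biMoment ω i j :=
    PfaffToda.biMoment_swap hω
  rcases htbar with ⟨rfl, hm⟩ | ⟨rfl, hm⟩
  · obtain ⟨hB, hTL⟩ := PfaffToda.tau_finite n m ω ν 1
    obtain ⟨h1, h2⟩ := PfaffToda.expVev_sq n m hswap (PfaffToda.moment ν) 1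
    rw [one_smul] at hB hTL h1 h2
    have hp : (fun i j => PfaffToda.biMoment ω i j
        + 1 * (PfaffToda.moment ν i * PfaffToda.moment ν j))
        = PfaffToda.biMoment (ω + PfaffToda.square ν) := by
      funext i j
      rw [PfaffToda.biMoment_add_square hm (Set.mem_univ i) (Set.mem_univ j), one_mul]
    have hn : (fun i j => PfaffToda.biMoment ω i j
        + -1 * (PfaffToda.moment ν i * PfaffToda.moment ν j))
        = PfaffToda.biMoment (ω - PfaffToda.square ν) := by
      funext i j
      rw [PfaffToda.biMoment_sub_square hm (Set.mem_univ i) (Set.mem_univ j)]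
      ring
    rw [hp] at h1
    rw [hn] at h2
    refine ⟨⟨hB, hTL _, hTL _⟩, ?_, ?_⟩ <;>
      rw [PfaffToda.tauB, PfaffToda.interactionB_eq, PfaffToda.tauTL, PfaffToda.interactionTL_eq]
    · exact h1
    · exact h2
  · obtain ⟨hB, hTL⟩ := PfaffToda.tau_finite n m ω ν 0
    classical
    -- Moments with an exponent below m are replaced by 0. This keeps antisymmetry and the rank one
    -- form of the perturbation, and changes none of the tau functions at t̄ = 0; Fubini is then
    -- needed only where the moments converge.
    have hW : ∀ i j, (if m ≤ j ∧ m ≤ i then PfaffToda.biMoment ω j i else 0)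
        = -(if m ≤ i ∧ m ≤ j then PfaffToda.biMoment ω i j else 0) := by
      intro i j
      by_cases h : m ≤ i ∧ m ≤ j
      · rw [if_pos h, if_pos h.symm, hswap]
      · rw [if_neg h, if_neg fun h' => h h'.symm, neg_zero]
    obtain ⟨h1, h2⟩ := PfaffToda.expVev_sq n m
      (W := fun i j => if m ≤ i ∧ m ≤ j then PfaffToda.biMoment ω i j else 0) hW
      (fun i => if m ≤ i then PfaffToda.moment ν i else 0) 0
    rw [zero_smul] at hB hTL h1 h2
    have hB' := PfaffToda.expVev_pairingB_congr (n := n) (m := m)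
      (W := PfaffToda.biMoment ω) (v := PfaffToda.moment ν)
      (W' := fun i j => if m ≤ i ∧ m ≤ j then PfaffToda.biMoment ω i j else 0)
      (v' := fun i => if m ≤ i then PfaffToda.moment ν i else 0)
      (fun i j hi hj => if_pos ⟨hi, hj⟩) fun i hi => if_pos hi
    rw [← hB'] at h1 h2
    rw [← PfaffToda.expVev_pairingTL_congr (W := PfaffToda.biMoment (ω + PfaffToda.square ν))
      fun i j hi hj => by
        rw [PfaffToda.biMoment_add_square hm hi hj, if_pos ⟨hi, hj⟩, if_pos hi, if_pos hj,
          one_mul]] at h1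
    rw [← PfaffToda.expVev_pairingTL_congr (W := PfaffToda.biMoment (ω - PfaffToda.square ν))
      fun i j hi hj => by
        rw [PfaffToda.biMoment_sub_square hm hi hj, if_pos ⟨hi, hj⟩, if_pos hi, if_pos hj]
        ring] at h2
    refine ⟨⟨hB, hTL _, hTL _⟩, ?_, ?_⟩ <;>
      rw [PfaffToda.tauB, PfaffToda.interactionB_eq, PfaffToda.tauTL, PfaffToda.interactionTL_eq]
    · exact h1
    · exact h2
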